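/- Let $n,m,Q$ be natural numbers. Let $\mathcal A_Q(\mathbb R^m)$ be the set of unordered $Q$-tuples $\sum_{i=1}^Q[\![P_i]\!]$ of points of $\mathbb R^m$ with the distance $\mathcal G\big(\sum_i[\![P_i]\!],\sum_i[\![S_i]\!]\big)=\min_{\sigma}\big(\sum_i|P_i-S_{\sigma(i)}|^2\big)^{1/2}$, $\sigma$ ranging over the permutations of $\{1,\dots,Q\}$, and put $|T|=\mathcal G(T,Q[\![0]\!])$. For an open ball $\Omega\subset\mathbb R^n$, a map $f:\Omega\to\mathcal A_Q(\mathbb R^m)$ belongs to $W^{1,2}(\Omega,\mathcal A_Q(\mathbb R^m))$ if there are $\varphi_1,\dots,\varphi_n\in L^2(\Omega)$ such that, for every $T\in\mathcal A_Q(\mathbb R^m)$, $\mathcal G(f,T)\in W^{1,2}(\Omega)$ and $|\partial_j\mathcal G(f,T)|\le\varphi_j$ a.e. for $j=1,\dots,n$. Such a map is approximately differentiable a.e.: for a.e. $x$ one can write $f(x)=\sum_i[\![f_i(x)]\!]$, and there are linear maps $Df_i(x):\mathbb R^n\to\mathbb R^m$, with $Df_i(x)=Df_k(x)$ whenever $f_i(x)=f_k(x)$,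 such that $\mathcal G\big(f(y),\sum_i[\![f_i(x)+Df_i(x)(y-x)]\!]\big)=o(|y-x|)$ as $y\to x$ within some measurable set that contains $x$ and has density $1$ at $x$; the pairs $(f_i(x),Df_i(x))$ are unique up to order. Write $\langle A:B\rangle$ for the Hilbert–Schmidt product of matrices and $|Df|^2=\sum_i\langle Df_i:Df_i\rangle$. The map $f\in W^{1,2}(\Omega,\mathcal A_Q(\mathbb R^m))$ is called Dir-stationary if $$\int_\Omega\sum_{i=1}^Q\big[\langle Df_i(x):D_x\psi(x,f_i(x))\rangle+\langle Df_i(x):D_u\psi(x,f_i(x))\cdot Df_i(x)\rangle\big]\,dx=0$$ for every $\psi=\psi(x,u)\in C^\infty(\Omega\times\mathbb R^m;\mathbb R^m)$ that vanishes for $x$ outside a compact subset of $\Omega$ and satisfies $|D_u\psi|\le C$ and $|\psi|+|D_x\psi|\le C(1+|u|)$ for some constant $C<\infty$, and $$2\int_\Omega\sum_{i=1}^Q\langle Df_i:Df_i\cdot D\phi\rangle\,dx-\int_\Omega|Df|^2\operatorname{div}\phi\,dx=0\qquad\text{for every }\phi\in C_c^\infty(\Omega,\mathbb R^n).$$ **Theorem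 (strong unique continuation).** Let $B_r\subset\mathbb R^n$ be the open ball of radius $r$ centred at $0$, let $f\in W^{1,2}(B_1,\mathcal A_Q(\mathbb R^m))$ be Dir-stationary, and suppose that $$\lim_{r\to0^+}\frac1{r^N}\int_{B_r}|f|^2\,dx=0\qquad\text{for every }N\in\mathbb N.$$ Then $f=Q[\![0]\!]$ almost everywhere in $B_1$. -/

import Mathlib

open MeasureTheory Filter Topology Set
open scoped ContDiff

noncomputable section

namespace QValued

/-- `ℝⁿ` with its Euclidean norm. -/
abbrev Eu (n : ℕ) : Type := EuclideanSpace ℝ (Fin n)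

/-- The space `𝒜_Q(ℝᵐ)` of unordered `Q`-tuples of points of `ℝᵐ` (sums of `Q` Dirac masses). -/
abbrev AQ (Q m : ℕ) : Type := Sym (Eu m) Q

/-- The `Q`-point `∑ i, ⟦p i⟧`. -/
def ofPoints {Q m : ℕ} (p : Fin Q → Eu m) : AQ Q m :=
  ⟨Finset.univ.val.map p, by simp⟩

/-- The distance `𝒢(S, T) = min_σ (∑ i, |S_i - T_{σ(i)}|²)^{1/2}`: the infimum runs over all
enumerations of `S` and of `T`, so over all ways to match their points. -/
def dG {Q m : ℕ} (S T : AQ Q m) : ℝ :=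
  sInf {d : ℝ | ∃ s t : Fin Q → Eu m, ofPoints s = S ∧ ofPoints t = T ∧
    d = Real.sqrt (∑ i, ‖s i - t i‖ ^ 2)}

/-- The modulus `|S| = 𝒢(S, Q⟦0⟧)`. -/
def modulus {Q m : ℕ} (S : AQ Q m) : ℝ := dG S (Sym.replicate Q 0)

/-- The `j`-th vector of the standard basis. -/
def stdVec {n : ℕ} (j : Fin n) : Eu n := EuclideanSpace.single j (1 : ℝ)

/-- `v` is the weak partial derivative `∂_j u` on the open set `Ω`. -/
def IsWeakPartial {n : ℕ} (Ω : Set (Eu n)) (j : Fin n) (u v : Eu n → ℝ) : Prop :=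
  LocallyIntegrableOn u Ω ∧ LocallyIntegrableOn v Ω ∧
  ∀ η : Eu n → ℝ, ContDiff ℝ ∞ η → HasCompactSupport η → tsupport η ⊆ Ω →
    ∫ x in Ω, u x * fderiv ℝ η x (stdVec j) = - ∫ x in Ω, v x * η x

/-- `f ∈ W^{1,2}(Ω, 𝒜_Q(ℝᵐ))`: all the functions `𝒢(f, T)` belong to `W^{1,2}(Ω)`, and their
partial derivatives are dominated by functions `φ_j ∈ L²(Ω)` that do not depend on `T`.
The (Lebesgue) measurability of `f` is that of the functions `𝒢(f, T)`. -/
def MemW12 {n m Q : ℕ} (Ω : Set (Eu n)) (f : Eu n → AQ Q m) : Prop :=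
  ∃ φ : Fin n → Eu n → ℝ, (∀ j, MemLp (φ j) 2 (volume.restrict Ω)) ∧
    ∀ T : AQ Q m, MemLp (fun x => dG (f x) T) 2 (volume.restrict Ω) ∧
      ∀ j, ∃ v : Eu n → ℝ, MemLp v 2 (volume.restrict Ω) ∧
        IsWeakPartial Ω j (fun x => dG (f x) T) v ∧
        ∀ᵐ x ∂volume.restrict Ω, |v x| ≤ φ j x

/-- `A` has Lebesgue density one at `x`. -/
def HasDensityOne {n : ℕ} (A : Set (Eu n)) (x : Eu n) : Prop :=
  Tendsto (fun r : ℝ => volume (A ∩ Metric.ball x r) / volume (Metric.ball x r))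
    (𝓝[>] 0) (𝓝 1)

/-- `f` is approximately differentiable at `x` with `f(x) = ∑ i, ⟦(J i).1⟧` and the differentials
`Df_i(x) = (J i).2`: equal points carry equal differentials, and on a measurable set that contains
`x` and has density one there, `𝒢(f(y), ∑ i, ⟦f_i(x) + Df_i(x)(y - x)⟧) = o(|y - x|)`. -/
def HasApproxJet {n m Q : ℕ} (f : Eu n → AQ Q m) (x : Eu n)
    (J : Fin Q → Eu m × (Eu n →L[ℝ] Eu m)) : Prop :=
  f x = ofPoints (fun i => (J i).1) ∧
  (∀ i k, (J i).1 = (J k).1 → (J i).2 = (J k).2) ∧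
  ∃ A : Set (Eu n), MeasurableSet A ∧ x ∈ A ∧ HasDensityOne A x ∧
    (fun y => dG (f y) (ofPoints fun i => (J i).1 + (J i).2 (y - x)))
      =o[𝓝[A] x] fun y => ‖y - x‖

open Classical in
/-- An enumeration of the pairs `(f_i(x), Df_i(x))` where `f` is approximately differentiable, which
a `W^{1,2}` map is almost everywhere. The pairs are unique up to their order, on which none of
the sums below depends. The value at the other points is irrelevant. -/
def jet {n m Q : ℕ} (f : Eu n → AQ Q m) (x : Eu n) : Fin Q → Eu m × (Eu n →L[ℝ] Eu m) :=
  if h : ∃ J, HasApproxJet f x J then h.choose else fun _ => (0, 0)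

/-- The value `f_i(x)`. -/
def sheet {n m Q : ℕ} (f : Eu n → AQ Q m) (i : Fin Q) (x : Eu n) : Eu m := (jet f x i).1

/-- The approximate differential `Df_i(x)`. -/
def sheetDeriv {n m Q : ℕ} (f : Eu n → AQ Q m) (i : Fin Q) (x : Eu n) : Eu n →L[ℝ] Eu m :=
  (jet f x i).2

/-- The Hilbert–Schmidt product `⟨A : B⟩` of `m × n` matrices. -/
def hs {n m : ℕ} (A B : Eu n →L[ℝ] Eu m) : ℝ := ∑ j, inner ℝ (A (stdVec j)) (B (stdVec j))

/-- The divergence of a vector field. -/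
def divergence {n : ℕ} (φ : Eu n → Eu n) (x : Eu n) : ℝ := ∑ j, fderiv ℝ φ x (stdVec j) j

/-- The differential `D_x ψ(x, u)`. -/
def derivX {n m : ℕ} (ψ : Eu n × Eu m → Eu m) (x : Eu n) (u : Eu m) : Eu n →L[ℝ] Eu m :=
  fderiv ℝ (fun y => ψ (y, u)) x

/-- The differential `D_u ψ(x, u)`. -/
def derivU {n m : ℕ} (ψ : Eu n × Eu m → Eu m) (x : Eu n) (u : Eu m) : Eu m →L[ℝ] Eu m :=
  fderiv ℝ (fun w => ψ (x, w)) u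

/-- Admissible test functions for outer variations on `Ω`: smooth, compactly supported in `x`
(and so extended by zero to all `x`), with `|D_u ψ| ≤ C` and `|ψ| + |D_x ψ| ≤ C (1 + |u|)`. -/
def IsOuterTest {n m : ℕ} (Ω : Set (Eu n)) (ψ : Eu n × Eu m → Eu m) : Prop :=
  ContDiff ℝ ∞ ψ ∧
  (∃ K : Set (Eu n), IsCompact K ∧ K ⊆ Ω ∧ ∀ x, x ∉ K → ∀ u, ψ (x, u) = 0) ∧
  ∃ C : ℝ, ∀ x u, ‖derivU ψ x u‖ ≤ C ∧ ‖ψ (x, u)‖ + ‖derivX ψ x u‖ ≤ C * (1 + ‖u‖)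

/-- The outer variation `𝒪(f, ψ)`. -/
def outerVariation {n m Q : ℕ} (Ω : Set (Eu n)) (f : Eu n → AQ Q m)
    (ψ : Eu n × Eu m → Eu m) : ℝ :=
  ∫ x in Ω, ∑ i, (hs (sheetDeriv f i x) (derivX ψ x (sheet f i x)) +
    hs (sheetDeriv f i x) ((derivU ψ x (sheet f i x)).comp (sheetDeriv f i x)))

/-- The inner variation `ℐ(f, φ)`. -/
def innerVariation {n m Q : ℕ} (Ω : Set (Eu n)) (f : Eu n → AQ Q m) (φ : Eu n → Eu n) : ℝ :=
  2 * (∫ x in Ω, ∑ i, hs (sheetDeriv f i x) ((sheetDeriv f i x).comp (fderiv ℝ φ x))) -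
    ∫ x in Ω, (∑ i, hs (sheetDeriv f i x) (sheetDeriv f i x)) * divergence φ x

/-- `f ∈ W^{1,2}(Ω, 𝒜_Q(ℝᵐ))` is Dir-stationary: the outer and the inner variations of its
Dirichlet energy vanish. -/
def DirStationary {n m Q : ℕ} (Ω : Set (Eu n)) (f : Eu n → AQ Q m) : Prop :=
  MemW12 Ω f ∧
  (∀ ψ : Eu n × Eu m → Eu m, IsOuterTest Ω ψ → outerVariation Ω f ψ = 0) ∧
  ∀ φ : Eu n → Eu n, ContDiff ℝ ∞ φ → HasCompactSupport φ → tsupport φ ⊆ Ω →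
    innerVariation Ω f φ = 0

end QValued

end

noncomputable section

namespace QValued

/-! ### The space of Q-points and its metric. -/

section Distance

variable {Q m : ℕ}

/-! The theorem rests on Almgren's monotonicity of the frequency, carried out with solid integrals
in the variable `s = r²`. Let `M`, `D` and `R` be the integrals over `{‖x‖² < s}` of `|f|²`, `|Df|²`
and `∑ |Df_i(x) x|²`, and let `G` be that of `x · ∇|f|² = 2 ∑ ⟨f_i, Df_i x⟩`. Outer variations along
`ζ(‖x‖²) u`, with `ζ(t)` approaching `(s - t)₊`, give `G(s) = ∫ (s - ‖x‖²)₊ |Df|²`, hence `G' = D`.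
Inner variations along `ζ(‖x‖²) x` give `2 s D = 4 R + n G`. Integrating `|f|²` by parts against the
same field gives `2 s M' = G + n M`. With the Cauchy–Schwarz inequality `G² ≤ 4 R M` these make `G /
M` nondecreasing wherever `M > 0`. Since `M' / M = (G / M + n) / (2 s)`, a bound on `G / M` forces
`M(s) ≥ c s ^ k` with `c > 0`, which is incompatible with vanishing to infinite order
(`eq_zero_of_frequency`). Solid integrals avoid traces on spheres altogether.

The rest of the work links the two descriptions of `f`. Membership in `W^{1,2}` only speaks of the
scalar functions `𝒢(f, T)`, whereas the variations are written with the approximate jets `(f_i,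
Df_i)`. A scalar Sobolev function is approximately differentiable almost everywhere, its
differential being the weak gradient (`ae_hasApproxFDerivAt`). The ball is covered by countably many
pieces on which `f` splits into branches near fixed, well separated centres. By polarization, each
coordinate of a branch is an affine function of the squares of two distances `𝒢(f, T)`
(`clusterMean_ofPoints`), so the branches are approximately differentiable almost everywhere on
their piece. At density points of the piece they provide the jet and show that it is unique
(`ae_jet_eq_branch`).

From this follow the integrability of the energy and the identity `∑ ⟨f_i, ∂_j f_i⟩ = |f| ∂_j|f|`
(`MemW12.integrableOn_energyForm_and_gradient`). Neither continuity of `f` nor a Lipschitz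
approximation is used. -/

theorem ofPoints_comp_perm (p : Fin Q → Eu m) (σ : Equiv.Perm (Fin Q)) :
    ofPoints (p ∘ σ) = ofPoints p := by
  apply Subtype.ext
  change Finset.univ.val.map (p ∘ σ) = Finset.univ.val.map p
  rw [← Multiset.map_map]
  exact congrArg (Multiset.map p) (congrArg Finset.val (Finset.map_univ_equiv σ))

theorem exists_ofPoints_eq (S : AQ Q m) : ∃ p : Fin Q → Eu m, ofPoints p = S := by
  obtain ⟨s, hs⟩ := S
  induction s using Quotient.inductionOn with
  | h l =>
    have hl : l.length = Q := by simpa using hs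
    subst hl
    refine ⟨l.get, Subtype.ext ?_⟩
    change Finset.univ.val.map l.get = (l : Multiset (Eu m))
    rw [Fin.univ_val_map]
    simp

theorem ofPoints_eq_iff (p q : Fin Q → Eu m) :
    ofPoints p = ofPoints q ↔ ∃ σ : Equiv.Perm (Fin Q), p = q ∘ σ := by
  constructor
  · intro h
    have h' : Finset.univ.val.map p = Finset.univ.val.map q := congrArg Subtype.val h
    classical
    have hcard : ∀ a : Eu m, Fintype.card {i // p i = a} = Fintype.card {i // q i = a} := by
      intro a
      have := congrArg (Multiset.count a) h'
      rw [Multiset.count_map, Multiset.count_map] at this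
      rw [Fintype.card_subtype, Fintype.card_subtype, Finset.card_def, Finset.card_def,
        Finset.filter_val, Finset.filter_val]
      simpa [eq_comm] using this
    have e : ∀ a : Eu m, {i // p i = a} ≃ {i // q i = a} := fun a =>
      Fintype.equivOfCardEq (hcard a)
    -- Equal multiplicities give a bijection between the fibres over each value; gluing these
    -- bijections gives the permutation.
    refine ⟨(Equiv.sigmaFiberEquiv p).symm.trans
      ((Equiv.sigmaCongrRight e).trans (Equiv.sigmaFiberEquiv q)), ?_⟩
    funext i
    exact (e (p i) ⟨i, rfl⟩).2.symm
  · rintro ⟨σ, rfl⟩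
    exact ofPoints_comp_perm q σ

theorem dG_set_bddBelow (S T : AQ Q m) :
    BddBelow {d : ℝ | ∃ s t : Fin Q → Eu m, ofPoints s = S ∧ ofPoints t = T ∧
      d = Real.sqrt (∑ i, ‖s i - t i‖ ^ 2)} :=
  ⟨0, by rintro d ⟨s, t, -, -, rfl⟩; positivity⟩

theorem dG_ofPoints_le (s t : Fin Q → Eu m) :
    dG (ofPoints s) (ofPoints t) ≤ Real.sqrt (∑ i, ‖s i - t i‖ ^ 2) :=
  csInf_le (dG_set_bddBelow _ _) ⟨s, t, rfl, rfl, rfl⟩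

/-- Two enumerations of a Q-point differ by a permutation, so the infimum defining `dG` runs over a
finite set and is attained. The enumeration of one argument may be kept fixed. -/
theorem exists_perm_dG_eq (s t : Fin Q → Eu m) : ∃ σ : Equiv.Perm (Fin Q),
    dG (ofPoints s) (ofPoints t) = Real.sqrt (∑ i, ‖s i - t (σ i)‖ ^ 2) := by
  have hset : {d : ℝ | ∃ s' t' : Fin Q → Eu m, ofPoints s' = ofPoints s ∧
      ofPoints t' = ofPoints t ∧ d = Real.sqrt (∑ i, ‖s' i - t' i‖ ^ 2)} =
      range fun σ : Equiv.Perm (Fin Q) => Real.sqrt (∑ i, ‖s i - t (σ i)‖ ^ 2) := by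
    ext d
    constructor
    · rintro ⟨s', t', hs, ht, rfl⟩
      obtain ⟨σ, rfl⟩ := (ofPoints_eq_iff _ _).1 hs
      obtain ⟨τ, rfl⟩ := (ofPoints_eq_iff _ _).1 ht
      refine ⟨σ.symm.trans τ, ?_⟩
      dsimp only
      congr 1
      rw [← Equiv.sum_comp σ]
      simp
    · rintro ⟨σ, rfl⟩
      exact ⟨s, t ∘ σ, rfl, ofPoints_comp_perm t σ, rfl⟩
  have hmem := (range_nonempty fun σ : Equiv.Perm (Fin Q) =>
    Real.sqrt (∑ i, ‖s i - t (σ i)‖ ^ 2)).csInf_mem (finite_range _)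
  obtain ⟨σ, hσ⟩ := hmem
  refine ⟨σ, ?_⟩
  unfold dG
  rw [hset]
  exact hσ.symm

theorem dG_nonneg (S T : AQ Q m) : 0 ≤ dG S T :=
  Real.sInf_nonneg (by rintro d ⟨s, t, -, -, rfl⟩; positivity)

theorem dG_self (S : AQ Q m) : dG S S = 0 := by
  obtain ⟨s, rfl⟩ := exists_ofPoints_eq S
  exact le_antisymm (by simpa using dG_ofPoints_le s s) (dG_nonneg _ _)

theorem sqrt_sum_norm_sq_add_le (a b : Fin Q → Eu m) :
    Real.sqrt (∑ i, ‖a i + b i‖ ^ 2) ≤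
      Real.sqrt (∑ i, ‖a i‖ ^ 2) + Real.sqrt (∑ i, ‖b i‖ ^ 2) := by
  have h := norm_add_le (WithLp.toLp 2 a : PiLp 2 fun _ : Fin Q => Eu m) (WithLp.toLp 2 b)
  simpa [PiLp.norm_eq_of_L2] using h

theorem dG_triangle (S T U : AQ Q m) : dG S U ≤ dG S T + dG T U := by
  obtain ⟨s, rfl⟩ := exists_ofPoints_eq S
  obtain ⟨t, rfl⟩ := exists_ofPoints_eq T
  obtain ⟨u, rfl⟩ := exists_ofPoints_eq U
  obtain ⟨σ, hσ⟩ := exists_perm_dG_eq s t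
  obtain ⟨τ, hτ⟩ := exists_perm_dG_eq t u
  have h1 : dG (ofPoints s) (ofPoints u) ≤
      Real.sqrt (∑ i, ‖s i - u (τ (σ i))‖ ^ 2) := by
    rw [← ofPoints_comp_perm u (σ.trans τ)]
    exact dG_ofPoints_le _ _
  have h2 : Real.sqrt (∑ i, ‖t i - u (τ i)‖ ^ 2) =
      Real.sqrt (∑ i, ‖t (σ i) - u (τ (σ i))‖ ^ 2) := by
    rw [← Equiv.sum_comp σ]
  rw [hσ, hτ, h2]
  refine h1.trans (le_trans (le_of_eq ?_) (sqrt_sum_norm_sq_add_le _ _))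
  simp

theorem dG_comm (S T : AQ Q m) : dG S T = dG T S := by
  unfold dG
  congr 1
  ext d
  constructor <;>
  · rintro ⟨s, t, hs, ht, rfl⟩
    exact ⟨t, s, ht, hs, by simp_rw [norm_sub_rev]⟩

theorem abs_dG_sub_dG_le (S S' T : AQ Q m) : |dG S T - dG S' T| ≤ dG S S' := by
  rw [abs_le]
  have h1 := dG_triangle S S' T
  have h2 := dG_triangle S' S T
  rw [dG_comm S' S] at h2
  constructor <;> linarith

theorem eq_of_dG_eq_zero {S T : AQ Q m} (h : dG S T = 0) : S = T := by
  obtain ⟨s, rfl⟩ := exists_ofPoints_eq S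
  obtain ⟨t, rfl⟩ := exists_ofPoints_eq T
  obtain ⟨σ, hσ⟩ := exists_perm_dG_eq s t
  rw [h] at hσ
  have h0 : ∑ i, ‖s i - t (σ i)‖ ^ 2 = 0 :=
    (Real.sqrt_eq_zero (by positivity)).1 hσ.symm
  rw [Finset.sum_eq_zero_iff_of_nonneg (fun _ _ => by positivity)] at h0
  refine (ofPoints_eq_iff _ _).2 ⟨σ, funext fun i => ?_⟩
  have := h0 i (Finset.mem_univ i)
  exact sub_eq_zero.1 (norm_eq_zero.1 (pow_eq_zero_iff two_ne_zero |>.1 this))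

theorem replicate_eq_ofPoints : (Sym.replicate Q (0 : Eu m)) = ofPoints fun _ => 0 := by
  apply Subtype.ext
  change Multiset.replicate Q (0 : Eu m) = (Finset.univ : Finset (Fin Q)).val.map fun _ => 0
  simp

theorem modulus_ofPoints_sq (s : Fin Q → Eu m) :
    modulus (ofPoints s) ^ 2 = ∑ i, ‖s i‖ ^ 2 := by
  unfold modulus
  rw [replicate_eq_ofPoints]
  obtain ⟨σ, hσ⟩ := exists_perm_dG_eq s fun _ => 0
  rw [hσ, Real.sq_sqrt (by positivity)]
  simp

/-- Near a `Q`-point whose distinct points are well separated, the optimal matching respects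
the clusters. -/
theorem dG_sq_of_clusters {p s t : Fin Q → Eu m} {δ : ℝ}
    (hp : ∀ i k, p i ≠ p k → 8 * δ ≤ ‖p i - p k‖)
    (hs : ∀ i, ‖s i - p i‖ ≤ 2 * δ) (ht : ∀ i, ‖t i - p i‖ ≤ δ)
    (htp : ∀ i k, p i = p k → t i = t k) :
    dG (ofPoints s) (ofPoints t) ^ 2 = ∑ i, ‖s i - t i‖ ^ 2 := by
  obtain ⟨σ, hσ⟩ := exists_perm_dG_eq s t
  have hle := dG_ofPoints_le s t
  have hge : Real.sqrt (∑ i, ‖s i - t i‖ ^ 2) ≤ dG (ofPoints s) (ofPoints t) := by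
    rw [hσ]
    refine Real.sqrt_le_sqrt (Finset.sum_le_sum fun i _ => ?_)
    by_cases h : p i = p (σ i)
    · rw [htp _ _ h]
    -- A partner from another cluster is at distance at least `8δ - 2δ - δ = 5δ`, while the partner
    -- from the right cluster is within `3δ`.
    · have h1 := hp _ _ h
      have h2 : ‖s i - t i‖ ≤ 3 * δ := by
        calc ‖s i - t i‖ = ‖(s i - p i) - (t i - p i)‖ := by congr 1; abel
          _ ≤ ‖s i - p i‖ + ‖t i - p i‖ := norm_sub_le _ _
          _ ≤ 3 * δ := by linarith [hs i, ht i]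
      have h3 : ‖p i - p (σ i)‖ ≤ ‖s i - p i‖ + ‖s i - t (σ i)‖ + ‖t (σ i) - p (σ i)‖ := by
        calc ‖p i - p (σ i)‖ = ‖(s i - t (σ i)) - (s i - p i) + (t (σ i) - p (σ i))‖ := by
              congr 1; abel
          _ ≤ ‖(s i - t (σ i)) - (s i - p i)‖ + ‖t (σ i) - p (σ i)‖ := norm_add_le _ _
          _ ≤ _ := by linarith [norm_sub_le (s i - t (σ i)) (s i - p i)]
      have h4 : ‖s i - t i‖ ≤ ‖s i - t (σ i)‖ := by
        have := (norm_nonneg _).trans (ht i)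
        linarith [hs i, ht (σ i)]
      gcongr
  rw [le_antisymm hle hge, Real.sq_sqrt (by positivity)]

end Distance

/-! ### Density points and approximate differentials. -/

section Density

variable {n : ℕ}

theorem volume_ball_ne_zero (x : Eu n) {r : ℝ} (hr : 0 < r) : volume (Metric.ball x r) ≠ 0 :=
  (Metric.measure_ball_pos volume x hr).ne'

theorem volume_ball_ne_top (x : Eu n) (r : ℝ) : volume (Metric.ball x r) ≠ ⊤ :=
  measure_ball_lt_top.ne

/-- The filter of the sets whose complement has outer density zero at `x`. -/
def densityFilter (x : Eu n) : Filter (Eu n) where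
  -- `volume` is an outer measure on non-measurable sets. Smallness of the complement, unlike
  -- fullness of the set itself, passes to intersections without any measurability.
  sets := {S | Tendsto (fun r : ℝ => volume (Sᶜ ∩ Metric.ball x r) / volume (Metric.ball x r))
    (𝓝[>] 0) (𝓝 0)}
  univ_sets := by simp
  sets_of_superset := by
    intro S T hS hST
    refine tendsto_of_tendsto_of_tendsto_of_le_of_le tendsto_const_nhds hS
      (fun _ => zero_le) fun r => ?_
    dsimp only
    gcongr
  inter_sets := by
    intro S T hS hT
    have h := Tendsto.add hS hT
    rw [add_zero] at h
    refine tendsto_of_tendsto_of_tendsto_of_le_of_le tendsto_const_nhds h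
      (fun _ => zero_le) fun r => ?_
    dsimp only
    rw [compl_inter, union_inter_distrib_right, ← ENNReal.add_div]
    gcongr
    exact measure_union_le _ _

theorem mem_densityFilter_iff {x : Eu n} {S : Set (Eu n)} : S ∈ densityFilter x ↔
    Tendsto (fun r : ℝ => volume (Sᶜ ∩ Metric.ball x r) / volume (Metric.ball x r))
      (𝓝[>] 0) (𝓝 0) := Iff.rfl

theorem densityFilter_le_nhds (x : Eu n) : densityFilter x ≤ 𝓝 x := by
  intro S hS
  obtain ⟨ε, hε, hb⟩ := Metric.mem_nhds_iff.1 hS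
  rw [mem_densityFilter_iff]
  refine tendsto_const_nhds.congr' ?_
  filter_upwards [Ioo_mem_nhdsGT hε] with r hr
  have : Sᶜ ∩ Metric.ball x r = ∅ := by
    rw [← disjoint_iff_inter_eq_empty, disjoint_compl_left_iff_subset]
    exact (Metric.ball_subset_ball hr.2.le).trans hb
  simp [this]

theorem volume_compl_inter_ball_div {A : Set (Eu n)} (hA : MeasurableSet A) (x : Eu n) {r : ℝ}
    (hr : 0 < r) :
    volume (Aᶜ ∩ Metric.ball x r) / volume (Metric.ball x r) =
      1 - volume (A ∩ Metric.ball x r) / volume (Metric.ball x r) := by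
  have h1 : volume (A ∩ Metric.ball x r) / volume (Metric.ball x r) +
      volume (Aᶜ ∩ Metric.ball x r) / volume (Metric.ball x r) = 1 := by
    rw [← ENNReal.add_div, inter_comm A, inter_comm Aᶜ, ← sdiff_eq,
      measure_inter_add_sdiff _ hA, ENNReal.div_self (volume_ball_ne_zero x hr)
        (volume_ball_ne_top x r)]
  refine ENNReal.eq_sub_of_add_eq ?_ (by rw [add_comm]; exact h1)
  exact ne_top_of_le_ne_top ENNReal.one_ne_top (h1 ▸ le_self_add)

theorem hasDensityOne_iff {A : Set (Eu n)} (hA : MeasurableSet A) (x : Eu n) :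
    HasDensityOne A x ↔ A ∈ densityFilter x := by
  rw [mem_densityFilter_iff]
  unfold HasDensityOne
  constructor
  · intro h
    have h2 := ENNReal.Tendsto.sub (tendsto_const_nhds (x := (1 : ENNReal))) h (by simp)
    rw [tsub_self] at h2
    refine h2.congr' ?_
    filter_upwards [self_mem_nhdsWithin] with r hr
    exact (volume_compl_inter_ball_div hA x hr).symm
  · intro h
    have h2 := ENNReal.Tendsto.sub (tendsto_const_nhds (x := (1 : ENNReal))) h (by simp)
    rw [tsub_zero] at h2
    refine h2.congr' ?_
    filter_upwards [self_mem_nhdsWithin] with r hr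
    have := volume_compl_inter_ball_div hA.compl x hr
    rw [compl_compl] at this
    exact this.symm

/-- Lebesgue's density theorem, applied to the complement of a measurable subset of full measure in
`A`. The theorem is about closed balls, which have the volume of the open ones. -/
theorem ae_mem_densityFilter {A : Set (Eu n)} (hA : NullMeasurableSet A) :
    ∀ᵐ x ∂volume.restrict A, A ∈ densityFilter x := by
  obtain ⟨B, hBA, hB, hae⟩ := hA.exists_measurable_subset_ae_eq
  rw [← Measure.restrict_congr_set hae, ae_restrict_iff' hB]
  filter_upwards [Besicovitch.ae_tendsto_measure_inter_div_of_measurableSet volume hB.compl]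
    with x hx hxB
  refine mem_of_superset ?_ hBA
  rw [mem_densityFilter_iff]
  rw [indicator_of_notMem (by simpa using hxB)] at hx
  refine tendsto_of_tendsto_of_tendsto_of_le_of_le' tendsto_const_nhds hx
    (Eventually.of_forall fun _ => zero_le) ?_
  filter_upwards [self_mem_nhdsWithin] with r hr
  have : volume (Metric.closedBall x r) = volume (Metric.ball x r) := by
    rw [Measure.addHaar_closedBall _ _ (le_of_lt hr), Measure.addHaar_ball_of_pos _ _ hr]
  rw [this]
  gcongr
  exact Metric.ball_subset_closedBall

/-- Countably many sets of the density filter at `x` almost contain a common measurable set of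
density one at `x`. -/
theorem exists_hasDensityOne_forall_eventually {x : Eu n} (S : ℕ → Set (Eu n))
    (hS : ∀ k, S k ∈ densityFilter x) (hx : ∀ k, x ∈ S k) :
    ∃ A, MeasurableSet A ∧ x ∈ A ∧ HasDensityOne A x ∧ ∀ k, ∀ᶠ y in 𝓝[A] x, y ∈ S k := by
  have hB : ∀ k, ∃ B, MeasurableSet B ∧ (S k)ᶜ ⊆ B ∧
      ∀ r, volume (B ∩ Metric.ball x r) = volume ((S k)ᶜ ∩ Metric.ball x r) := fun k =>
    ⟨toMeasurable volume (S k)ᶜ, measurableSet_toMeasurable _ _, subset_toMeasurable _ _,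
      fun r => Measure.measure_toMeasurable_inter_of_sFinite measurableSet_ball _⟩
  choose B hBm hSB hBv using hB
  -- Below the scale `ρ k` the `k`-th bad set fills at most the fraction `2⁻ᵏ` of every ball. Only
  -- its part inside the ball of radius `ρ k` is then removed, and the summable fractions dominate
  -- the total removed.
  have hr : ∀ k, ∃ ρ > 0, ∀ r, 0 < r → r ≤ ρ →
      volume (B k ∩ Metric.ball x r) ≤ (2⁻¹ : ENNReal) ^ k * volume (Metric.ball x r) := by
    intro k
    have h := (ENNReal.tendsto_nhds_zero.1 (mem_densityFilter_iff.1 (hS k))) ((2⁻¹ : ENNReal) ^ k)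
      (by simp [pos_iff_ne_zero])
    obtain ⟨ρ, hρ, hρ'⟩ := mem_nhdsGT_iff_exists_Ioo_subset.1 h
    refine ⟨ρ / 2, half_pos hρ, fun r h0 h1 => ?_⟩
    have h2 := hρ' ⟨h0, h1.trans_lt (half_lt_self hρ)⟩
    rw [hBv]
    exact (ENNReal.div_le_iff (volume_ball_ne_zero x h0) (volume_ball_ne_top x r)).1 h2
  choose ρ hρ hρB using hr
  set N : Set (Eu n) := (⋃ k, B k ∩ Metric.ball x (ρ k)) \ {x} with hN
  have hNm : MeasurableSet N :=
    (MeasurableSet.iUnion fun k => (hBm k).inter measurableSet_ball).diff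
      (measurableSet_singleton x)
  set a : ℝ → ℕ → ENNReal := fun r k =>
    volume (B k ∩ Metric.ball x (min (ρ k) r)) / volume (Metric.ball x r) with ha
  have hNv : ∀ r, volume (N ∩ Metric.ball x r) / volume (Metric.ball x r) ≤ ∑' k, a r k := by
    intro r
    simp only [ha, ENNReal.div_eq_inv_mul]
    rw [ENNReal.tsum_mul_left]
    gcongr
    refine (measure_mono ?_).trans (measure_iUnion_le _)
    rintro y ⟨⟨hy, -⟩, hyr⟩
    obtain ⟨k, hk⟩ := mem_iUnion.1 hy
    exact mem_iUnion.2 ⟨k, hk.1, by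
      rw [Metric.mem_ball, lt_min_iff]; exact ⟨hk.2, hyr⟩⟩
  have hlim : Tendsto (fun r => ∑' k, a r k) (𝓝[>] 0) (𝓝 0) := by
    -- Each term tends to zero and is at most `2⁻ᵏ`, so the series tends to zero by dominated
    -- convergence for the counting measure.
    have h := tendsto_lintegral_filter_of_dominated_convergence (μ := Measure.count)
      (l := 𝓝[>] (0 : ℝ)) (F := a) (f := fun _ => 0) (fun k => (2⁻¹ : ENNReal) ^ k)
      (Eventually.of_forall fun _ => measurable_of_countable _) ?_ ?_ ?_
    · simpa [lintegral_count] using h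
    · filter_upwards [self_mem_nhdsWithin] with r hr
      refine Eventually.of_forall fun k => ?_
      have h0 : 0 < min (ρ k) r := lt_min (hρ k) hr
      rw [ha]
      dsimp only
      rw [ENNReal.div_le_iff (volume_ball_ne_zero x hr) (volume_ball_ne_top x r)]
      refine (hρB k _ h0 (min_le_left _ _)).trans ?_
      gcongr
      exact min_le_right _ _
    · rw [lintegral_count, ENNReal.tsum_geometric]
      simp
    · refine Eventually.of_forall fun k => ?_
      refine tendsto_of_tendsto_of_tendsto_of_le_of_le tendsto_const_nhds
        (mem_densityFilter_iff.1 (hS k)) (fun _ => zero_le) fun r => ?_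
      rw [ha]
      dsimp only
      rw [← hBv]
      gcongr
      exact min_le_right _ _
  refine ⟨Nᶜ, hNm.compl, fun h => h.2 rfl, ?_, fun k => ?_⟩
  · rw [hasDensityOne_iff hNm.compl, mem_densityFilter_iff, compl_compl]
    exact tendsto_of_tendsto_of_tendsto_of_le_of_le tendsto_const_nhds hlim
      (fun _ => zero_le) hNv
  · filter_upwards [self_mem_nhdsWithin,
      mem_nhdsWithin_of_mem_nhds (Metric.ball_mem_nhds x (hρ k))] with y hy hyρ
    by_contra hyS
    have hyx : y ≠ x := fun h => hyS (h ▸ hx k)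
    exact hy ⟨mem_iUnion.2 ⟨k, hSB k hyS, hyρ⟩, hyx⟩

/-- Passes from the density filter back to the single measurable set demanded by `HasApproxJet`,
using the countably many tolerances `1 / (k + 1)`. The value `F x = 0` puts `x` in every tolerance
set. -/
theorem exists_hasDensityOne_isLittleO {x : Eu n} {F : Eu n → ℝ} (hF : F x = 0)
    (h : F =o[densityFilter x] fun y => ‖y - x‖) :
    ∃ A, MeasurableSet A ∧ x ∈ A ∧ HasDensityOne A x ∧ F =o[𝓝[A] x] fun y => ‖y - x‖ := by
  obtain ⟨A, hA, hxA, hAd, hAS⟩ := exists_hasDensityOne_forall_eventually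
    (x := x) (fun k : ℕ => {y | ‖F y‖ ≤ (1 / ((k : ℝ) + 1)) * ‖‖y - x‖‖})
    (fun k => h.def (by positivity)) (fun k => by simp [hF])
  refine ⟨A, hA, hxA, hAd, Asymptotics.isLittleO_iff.2 fun c hc => ?_⟩
  obtain ⟨k, hk⟩ := exists_nat_one_div_lt hc
  filter_upwards [hAS k] with y hy
  exact le_trans hy (by gcongr)

/-- A nonzero linear map satisfies `‖T h‖ > c ‖h‖` on an open cone, and a cone fills a fixed
fraction of every ball centred at its vertex. This gives the uniqueness of approximate
differentials. -/
theorem eq_zero_of_isLittleO_densityFilter {F : Type*} [NormedAddCommGroup F] [NormedSpace ℝ F]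
    {x : Eu n} {T : Eu n →L[ℝ] F}
    (h : (fun y => T (y - x)) =o[densityFilter x] fun y => y - x) : T = 0 := by
  by_contra hT
  obtain ⟨v, hv⟩ : ∃ v, T v ≠ 0 := by
    by_contra! hc
    exact hT (ContinuousLinearMap.ext hc)
  have hv0 : v ≠ 0 := fun h0 => hv (by rw [h0, map_zero])
  have hvn : 0 < ‖v‖ := norm_pos_iff.2 hv0
  -- The norm `1 / 2` serves twice: a neighbourhood of `z` stays in the unit ball, and `‖T z‖ * ‖z‖
  -- < ‖T z‖` is strict, so that the constant `c = ‖T z‖` works near `z`.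
  obtain ⟨z, hz⟩ : ∃ z : Eu n, z = (2 * ‖v‖)⁻¹ • v := ⟨_, rfl⟩
  have hzn : ‖z‖ = 1 / 2 := by
    rw [hz, norm_smul, Real.norm_of_nonneg (by positivity)]
    field_simp
  have hTz : 0 < ‖T z‖ := by
    rw [hz, map_smul, norm_smul, Real.norm_of_nonneg (by positivity)]
    have := norm_pos_iff.2 hv
    positivity
  have hopen : IsOpen {y : Eu n | ‖T z‖ * ‖y‖ < ‖T y‖ ∧ ‖y‖ < 1} :=
    (isOpen_lt (continuous_const.mul continuous_norm) T.continuous.norm).inter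
      (isOpen_lt continuous_norm continuous_const)
  obtain ⟨κ, hκ, hκb⟩ := Metric.isOpen_iff.1 hopen z ⟨by rw [hzn]; linarith, by rw [hzn]; norm_num⟩
  have hset := mem_densityFilter_iff.1 (h.def hTz)
  have hle : ∀ᶠ r in 𝓝[>] (0 : ℝ), ENNReal.ofReal (κ ^ Module.finrank ℝ (Eu n)) ≤
      volume ({y | ‖T (y - x)‖ ≤ ‖T z‖ * ‖y - x‖}ᶜ ∩ Metric.ball x r) /
        volume (Metric.ball x r) := by
    filter_upwards [self_mem_nhdsWithin] with r hr
    have hr : 0 < r := hr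
    rw [ENNReal.le_div_iff_mul_le (Or.inl (volume_ball_ne_zero x hr))
      (Or.inl (volume_ball_ne_top x r))]
    have hsub : Metric.ball (x + r • z) (κ * r) ⊆
        {y | ‖T (y - x)‖ ≤ ‖T z‖ * ‖y - x‖}ᶜ ∩ Metric.ball x r := by
      intro y hy
      have hy' : r⁻¹ • (y - x) ∈ Metric.ball z κ := by
        rw [mem_ball_iff_norm] at hy ⊢
        have : r⁻¹ • (y - x) - z = r⁻¹ • (y - (x + r • z)) := by
          rw [← sub_sub, smul_sub _ (y - x), inv_smul_smul₀ hr.ne']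
        rw [this, norm_smul, norm_inv, Real.norm_of_nonneg hr.le, inv_mul_lt_iff₀ hr]
        linarith
      obtain ⟨h1, h2⟩ := hκb hy'
      rw [map_smul, norm_smul, norm_smul, norm_inv, Real.norm_of_nonneg hr.le] at h1
      rw [norm_smul, norm_inv, Real.norm_of_nonneg hr.le, inv_mul_lt_iff₀ hr, mul_one] at h2
      refine ⟨?_, by rwa [mem_ball_iff_norm]⟩
      simp only [mem_compl_iff, mem_ofPred_eq, not_le]
      have h3 := mul_lt_mul_of_pos_left h1 hr
      field_simp at h3
      linarith
    refine le_trans (le_of_eq ?_) (measure_mono hsub)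
    rw [Measure.addHaar_ball_mul_of_pos _ _ hκ, Measure.addHaar_ball_center]
  have := le_of_tendsto_of_tendsto tendsto_const_nhds hset hle
  simp only [nonpos_iff_eq_zero, ENNReal.ofReal_eq_zero] at this
  exact absurd this (not_le.2 (by positivity))

/-- Approximate differentiability with respect to the density filter. -/
def HasApproxFDerivAt {F : Type*} [NormedAddCommGroup F] [NormedSpace ℝ F]
    (u : Eu n → F) (T : Eu n →L[ℝ] F) (x : Eu n) : Prop :=
  HasFDerivAtFilter u T (densityFilter x ×ˢ pure x)

section Calculus

variable {F : Type*} [NormedAddCommGroup F] [NormedSpace ℝ F]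

theorem hasApproxFDerivAt_iff {u : Eu n → F} {T : Eu n →L[ℝ] F} {x : Eu n} :
    HasApproxFDerivAt u T x ↔
      (fun y => u y - u x - T (y - x)) =o[densityFilter x] fun y => y - x := by
  unfold HasApproxFDerivAt
  rw [hasFDerivAtFilter_iff_isLittleO, prod_pure, Asymptotics.isLittleO_map]
  rfl

theorem HasApproxFDerivAt.unique {u : Eu n → F} {S T : Eu n →L[ℝ] F} {x : Eu n}
    (hS : HasApproxFDerivAt u S x) (hT : HasApproxFDerivAt u T x) : S = T := by
  rw [hasApproxFDerivAt_iff] at hS hT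
  rw [← sub_eq_zero]
  apply eq_zero_of_isLittleO_densityFilter (x := x)
  refine (hT.sub hS).congr_left fun y => ?_
  simp

theorem HasApproxFDerivAt.congr {u v : Eu n → F} {T : Eu n →L[ℝ] F} {x : Eu n}
    (h : HasApproxFDerivAt u T x) (huv : u =ᶠ[densityFilter x] v) (hx : u x = v x) :
    HasApproxFDerivAt v T x := by
  rw [hasApproxFDerivAt_iff] at h ⊢
  refine h.congr' ?_ EventuallyEq.rfl
  filter_upwards [huv] with y hy
  rw [hy, hx]

theorem HasApproxFDerivAt.sq {u : Eu n → ℝ} {T : Eu n →L[ℝ] ℝ} {x : Eu n}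
    (h : HasApproxFDerivAt u T x) : HasApproxFDerivAt (fun y => u y ^ 2) ((2 * u x) • T) x := by
  have hsq : HasFDerivAt (fun t : ℝ => t ^ 2)
      (ContinuousLinearMap.toSpanSingleton ℝ (2 * u x)) (u x) := by
    have := (hasDerivAt_pow 2 (u x)).hasFDerivAt
    simpa using this
  have hc : HasFDerivAtFilter ((fun t : ℝ => t ^ 2) ∘ u) _ (densityFilter x ×ˢ pure x) :=
    HasFDerivAtFilter.comp hsq h
      (by
        refine Tendsto.prodMap ?_ (tendsto_pure_pure _ _)
        exact HasFDerivAtFilter.tendsto_nhds (densityFilter_le_nhds x) h)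
  have hT : (2 * u x) • T = ContinuousLinearMap.toSpanSingleton ℝ (2 * u x) ∘SL T := by
    ext v
    simp [mul_comm]
  rw [hT]
  exact hc

end Calculus

end Density

/-! ### Weak derivatives and integrals along segments. -/

section Sobolev

variable {n : ℕ}

/-- By translation invariance the inner `L¹` norm does not depend on `t`. This justifies the later
exchanges of integrals along segments. -/
theorem integrable_comp_add_smul {V : Eu n → ℝ} (hVm : Measurable V) (hV : Integrable V)
    (h : Eu n) (a b : ℝ) :
    Integrable (fun z : Eu n × ℝ => V (z.1 + z.2 • h))
      (volume.prod (volume.restrict (Ioc a b))) := by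
  rw [integrable_prod_iff']
  · refine ⟨Eventually.of_forall fun t => hV.comp_add_right (t • h), ?_⟩
    have : (fun t : ℝ => ∫ x, ‖V (x + t • h)‖) = fun _ => ∫ x, ‖V x‖ := by
      funext t
      exact integral_add_right_eq_self (fun x => ‖V x‖) (t • h)
    simp only [this]
    exact integrable_const _
  · exact (hVm.comp (by fun_prop)).aestronglyMeasurable

theorem tsupport_comp_sub_subset (η : Eu n → ℝ) (h : Eu n) :
    tsupport (fun x => η (x - h)) ⊆ (fun x => x - h) ⁻¹' tsupport η :=
  closure_minimal (fun _ hx => subset_tsupport _ hx)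
    ((isClosed_tsupport η).preimage (by fun_prop))

theorem sub_eq_neg_integral_fderiv {η : Eu n → ℝ} (hη : ContDiff ℝ ∞ η) (x h : Eu n) :
    η (x - h) - η x = - ∫ t in (0 : ℝ)..1, fderiv ℝ η (x - t • h) h := by
  have hd : ∀ t ∈ uIcc (0 : ℝ) 1,
      HasDerivAt (fun t : ℝ => η (x - t • h)) (-(fderiv ℝ η (x - t • h) h)) t := by
    intro t _
    have h1 : HasDerivAt (fun t : ℝ => x - t • h) (-h) t := by
      simpa using ((hasDerivAt_id t).smul_const h).const_sub x
    have h2 := ((hη.differentiable (by simp)) (x - t • h)).hasFDerivAt.comp_hasDerivAt t h1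
    rw [map_neg] at h2
    exact h2
  have hc : Continuous fun t : ℝ => -(fderiv ℝ η (x - t • h) h) :=
    (((hη.continuous_fderiv (by simp)).comp (by fun_prop)).clm_apply continuous_const).neg
  have := intervalIntegral.integral_eq_sub_of_hasDerivAt hd (hc.intervalIntegrable _ _)
  rw [intervalIntegral.integral_neg] at this
  simpa using this.symm

/-- A function with weak directional derivative `V` along `h` satisfies
`u (x + h) - u x = ∫₀¹ V (x + t h) dt` for almost every `x`. -/
theorem ae_add_sub_eq_integral {u V : Eu n → ℝ} {Ω U : Set (Eu n)} {h : Eu n}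
    (hu : Integrable u) (hVm : Measurable V) (hV : Integrable V)
    (hweak : ∀ η : Eu n → ℝ, ContDiff ℝ ∞ η → HasCompactSupport η → tsupport η ⊆ Ω →
      ∫ x, u x * fderiv ℝ η x h = - ∫ x, V x * η x)
    (hU : IsOpen U) (hUΩ : ∀ x ∈ U, ∀ t ∈ Icc (0 : ℝ) 1, x + t • h ∈ Ω) :
    ∀ᵐ x, x ∈ U → u (x + h) - u x = ∫ t in (0 : ℝ)..1, V (x + t • h) := by
  have hP := integrable_comp_add_smul hVm hV h 0 1
  have hI : Integrable fun x => ∫ t in (0 : ℝ)..1, V (x + t • h) := by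
    simp only [intervalIntegral.integral_of_le zero_le_one]
    exact hP.integral_prod_left
  have hF : Integrable fun x => u (x + h) - u x - ∫ t in (0 : ℝ)..1, V (x + t • h) :=
    ((hu.comp_add_right h).sub hu).sub hI
  -- It suffices to test with smooth `η` supported in `U`; all translations can then be moved from
  -- `u` and `V` onto `η`.
  have key := hU.ae_eq_zero_of_integral_contDiff_smul_eq_zero
    (μ := volume) (f := fun x => u (x + h) - u x - ∫ t in (0 : ℝ)..1, V (x + t • h))
    (hF.locallyIntegrable.locallyIntegrableOn U) ?_
  · filter_upwards [key] with x hx hxU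
    exact sub_eq_zero.1 (hx hxU)
  intro η hη hηc hηU
  obtain ⟨C, hC⟩ := hηc.exists_bound_of_continuous hη.continuous
  obtain ⟨C', hC'⟩ := (hηc.fderiv ℝ).exists_bound_of_continuous
    (hη.continuous_fderiv (by simp))
  have hbdd : ∀ {w : Eu n → ℝ} (_ : Integrable w) (k : Eu n),
      Integrable fun x => η (x - k) * w x := by
    intro w hw k
    exact hw.bdd_mul (hη.continuous.comp (by fun_prop)).aestronglyMeasurable
      (Eventually.of_forall fun x => hC _)
  have hbdd0 : ∀ {w : Eu n → ℝ} (_ : Integrable w), Integrable fun x => η x * w x := by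
    intro w hw
    simpa using hbdd hw 0
  have e1 : ∫ x, η x * u (x + h) = ∫ x, η (x - h) * u x := by
    rw [← integral_add_right_eq_self (fun x => η (x - h) * u x) h]
    simp
  have e2 : ∫ x, η x * (∫ t in (0 : ℝ)..1, V (x + t • h)) =
      ∫ t in (0 : ℝ)..1, ∫ x, η (x - t • h) * V x := by
    simp only [intervalIntegral.integral_of_le zero_le_one, ← integral_const_mul]
    rw [integral_integral_swap]
    · refine integral_congr_ae (Eventually.of_forall fun t => ?_)
      dsimp only
      rw [← integral_add_right_eq_self (fun x => η (x - t • h) * V x) (t • h)]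
      simp
    · exact hP.bdd_mul (c := C) (hη.continuous.comp continuous_fst).aestronglyMeasurable
        (Eventually.of_forall fun z => hC _)
  -- The translate `η (· - t h)` is still an admissible test function because segments issuing from
  -- `U` stay in `Ω`.
  have e3 : ∀ t ∈ Icc (0 : ℝ) 1, ∫ x, η (x - t • h) * V x =
      - ∫ x, u x * fderiv ℝ η (x - t • h) h := by
    intro t ht
    have h1 := hweak (fun x => η (x - t • h)) (hη.comp (contDiff_id.sub contDiff_const))
      (hηc.comp_homeomorph (Homeomorph.subRight (t • h))) ?_
    · simp only [fderiv_comp_sub] at h1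
      rw [h1, neg_neg]
      simp only [mul_comm]
    · intro x hx
      have h2 := hηU (tsupport_comp_sub_subset η (t • h) hx)
      simpa using hUΩ _ h2 t ht
  have e4 : ∫ t in (0 : ℝ)..1, ∫ x, η (x - t • h) * V x =
      ∫ x, u x * (η (x - h) - η x) := by
    have h1 : ∫ t in (0 : ℝ)..1, ∫ x, η (x - t • h) * V x =
        ∫ t in (0 : ℝ)..1, - ∫ x, u x * fderiv ℝ η (x - t • h) h := by
      refine intervalIntegral.integral_congr fun t ht => ?_
      rw [uIcc_of_le zero_le_one] at ht
      exact e3 t ht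
    rw [h1, intervalIntegral.integral_neg]
    simp only [sub_eq_neg_integral_fderiv hη, mul_neg, integral_neg,
      intervalIntegral.integral_of_le zero_le_one, ← integral_const_mul]
    congr 1
    rw [integral_integral_swap]
    have hc : Continuous fun z : ℝ × Eu n => fderiv ℝ η (z.2 - z.1 • h) h :=
      ((hη.continuous_fderiv (by simp)).comp (by fun_prop)).clm_apply continuous_const
    refine Integrable.mul_bdd (c := C' * ‖h‖) (hu.comp_snd _) hc.aestronglyMeasurable
      (Eventually.of_forall fun z => ?_)
    exact (ContinuousLinearMap.le_opNorm _ _).trans (by gcongr; exact hC' _)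
  simp only [smul_eq_mul, mul_sub]
  rw [integral_sub, integral_sub, e1, e2, e4]
  · simp only [mul_sub]
    rw [integral_sub]
    · simp only [mul_comm, sub_self]
    · simpa only [mul_comm] using hbdd hu h
    · simpa only [mul_comm] using hbdd0 hu
  · exact hbdd0 (hu.comp_add_right h)
  · exact hbdd0 hu
  · exact (hbdd0 (hu.comp_add_right h)).sub (hbdd0 hu)
  · exact hbdd0 hI

end Sobolev

/-! ### Approximate differentiability at Lebesgue points. -/

section Gradient

variable {n : ℕ}

/-- The linear form with coefficients `c`. -/
def gradMap (c : Fin n → ℝ) : Eu n →L[ℝ] ℝ := ∑ j, c j • EuclideanSpace.proj j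

theorem gradMap_apply (c : Fin n → ℝ) (h : Eu n) : gradMap c h = ∑ j, c j * h j := by
  simp [gradMap]

theorem sum_smul_stdVec (h : Eu n) : ∑ j, h j • (stdVec j : Eu n) = h := by
  ext k
  simp [stdVec, Finset.sum_apply, Pi.single_apply]

theorem gradMap_stdVec (c : Fin n → ℝ) (j : Fin n) : gradMap c (stdVec j) = c j := by
  simp [gradMap_apply, stdVec]

theorem setLIntegral_ball_comp_smul (Φ : Eu n → ENNReal) (hΦ : Measurable Φ) {t r : ℝ}
    (ht : 0 < t) :
    ∫⁻ h in Metric.ball 0 r, Φ (t • h) =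
      ENNReal.ofReal ((t ^ n)⁻¹) * ∫⁻ h in Metric.ball 0 (t * r), Φ h := by
  have hmap := Measure.map_addHaar_smul (volume : Measure (Eu n)) ht.ne'
  have hm : Measurable fun h : Eu n => t • h := by fun_prop
  have hpre : (fun h : Eu n => t • h) ⁻¹' Metric.ball 0 (t * r) = Metric.ball 0 r := by
    ext h
    simp [norm_smul, abs_of_pos ht, ht]
  have h1 := setLIntegral_map (μ := volume) (s := Metric.ball (0 : Eu n) (t * r))
    measurableSet_ball hΦ hm
  rw [hpre] at h1
  rw [← h1, hmap, Measure.restrict_smul, lintegral_smul_measure, smul_eq_mul,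
    abs_of_pos (by positivity)]
  simp

/-- A function that is the integral of `v` along almost every segment issuing from a Lebesgue
point `x` of `v` is approximately differentiable at `x`. -/
theorem hasApproxFDerivAt_of_lebesgue_point {u : Eu n → ℝ} {v : Fin n → Eu n → ℝ} {x : Eu n}
    {δ : ℝ} (hδ : 0 < δ) (hv : ∀ j, Measurable (v j))
    (hu : ∀ᵐ h ∂volume.restrict (Metric.ball (0 : Eu n) δ),
      u (x + h) - u x = ∫ t in (0 : ℝ)..1, ∑ j, h j * v j (x + t • h))
    (hx : ∀ j, Tendsto (fun r : ℝ => (∫⁻ y in Metric.closedBall x r, ‖v j y - v j x‖ₑ) /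
      volume (Metric.closedBall x r)) (𝓝[>] 0) (𝓝 0)) :
    HasApproxFDerivAt u (gradMap fun j => v j x) x := by
  set Φ : Eu n → ENNReal := fun k => ∑ j, ‖v j (x + k) - v j x‖ₑ with hΦ
  have hΦm : Measurable Φ := by
    refine Finset.measurable_sum _ fun j _ => ?_
    exact (((hv j).comp (measurable_const_add x)).sub_const _).enorm
  have hav : ∀ c : ENNReal, 0 < c → ∀ᶠ r in 𝓝[>] (0 : ℝ),
      ∫⁻ k in Metric.ball 0 r, Φ k ≤ c * volume (Metric.ball (0 : Eu n) r) := by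
    intro c hc
    have hsum := tendsto_finsetSum Finset.univ fun j _ => hx j
    simp only [Finset.sum_const_zero] at hsum
    filter_upwards [ENNReal.tendsto_nhds_zero.1 hsum c hc, self_mem_nhdsWithin] with r hr h0
    have h0 : 0 < r := h0
    have hvol : volume (Metric.closedBall x r) = volume (Metric.ball (0 : Eu n) r) := by
      rw [Measure.addHaar_closedBall _ _ h0.le, Measure.addHaar_ball_of_pos _ _ h0]
    simp only [hvol, ENNReal.div_eq_inv_mul] at hr
    rw [← Finset.mul_sum, mul_comm, ← ENNReal.div_eq_inv_mul.trans (mul_comm _ _),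
      ENNReal.div_le_iff (volume_ball_ne_zero _ h0) (volume_ball_ne_top _ _)] at hr
    refine le_trans ?_ hr
    rw [hΦ, lintegral_finsetSum]
    · refine Finset.sum_le_sum fun j _ => ?_
      have hpre : (fun k : Eu n => x + k) ⁻¹' Metric.ball x r = Metric.ball 0 r := by
        ext k
        simp
      have h1 := (measurePreserving_add_left (volume : Measure (Eu n)) x).setLIntegral_comp_preimage
        (s := Metric.ball x r) measurableSet_ball (f := fun y => ‖v j y - v j x‖ₑ)
        (((hv j).sub_const _).enorm)
      rw [hpre] at h1
      rw [h1]
      exact lintegral_mono_set Metric.ball_subset_closedBall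
    · intro j _
      exact (((hv j).comp (measurable_const_add x)).sub_const _).enorm
  -- Replacing `v` by its value at `x` along the segment costs at most `‖h‖` times the mean of the
  -- oscillation `Φ` on that segment.
  have hseg : ∀ᵐ h ∂volume.restrict (Metric.ball (0 : Eu n) δ),
      ‖u (x + h) - u x - gradMap (fun j => v j x) h‖ₑ ≤
        ‖h‖ₑ * ∫⁻ t in Ioc (0 : ℝ) 1, Φ (t • h) := by
    filter_upwards [hu] with h hh
    have hVm : Measurable fun t : ℝ => ∑ j, h j * (v j (x + t • h) - v j x) := by
      refine Finset.measurable_sum _ fun j _ => ?_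
      exact (((hv j).comp (by fun_prop)).sub_const _).const_mul _
    have hpt : ∀ t : ℝ, ‖∑ j, h j * (v j (x + t • h) - v j x)‖ₑ ≤ ‖h‖ₑ * Φ (t • h) := by
      intro t
      refine (enorm_sum_le _ _).trans ?_
      rw [hΦ, Finset.mul_sum]
      refine Finset.sum_le_sum fun j _ => ?_
      rw [enorm_mul]
      gcongr
      rw [← ofReal_norm, ← ofReal_norm]
      exact ENNReal.ofReal_le_ofReal (PiLp.norm_apply_le h j)
    have hle : ∫⁻ t in Ioc (0 : ℝ) 1, ‖∑ j, h j * (v j (x + t • h) - v j x)‖ₑ ≤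
        ‖h‖ₑ * ∫⁻ t in Ioc (0 : ℝ) 1, Φ (t • h) := by
      have hm : Measurable fun t : ℝ => Φ (t • h) := hΦm.comp (by fun_prop)
      rw [← lintegral_const_mul _ hm]
      exact lintegral_mono fun t => hpt t
    refine le_trans ?_ hle
    -- Integrability along a particular segment is not known. If it fails, the right-hand side is
    -- infinite and nothing has to be shown.
    by_cases hfin : ∫⁻ t in Ioc (0 : ℝ) 1, ‖∑ j, h j * (v j (x + t • h) - v j x)‖ₑ = ⊤
    · rw [hfin]; exact le_top
    have hint : Integrable (fun t : ℝ => ∑ j, h j * (v j (x + t • h) - v j x))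
        (volume.restrict (Ioc 0 1)) :=
      ⟨hVm.aestronglyMeasurable, lt_top_iff_ne_top.2 hfin⟩
    refine le_trans (le_of_eq ?_) (enorm_integral_le_lintegral_enorm _)
    congr 1
    have h2 : (fun t : ℝ => ∑ j, h j * v j (x + t • h)) = fun t : ℝ =>
        (∑ j, h j * (v j (x + t • h) - v j x)) + gradMap (fun j => v j x) h := by
      funext t
      rw [gradMap_apply, ← Finset.sum_add_distrib]
      exact Finset.sum_congr rfl fun j _ => by ring
    rw [hh, h2, intervalIntegral.integral_of_le zero_le_one,
      integral_add hint (integrable_const _)]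
    simp
  rw [hasApproxFDerivAt_iff, Asymptotics.isLittleO_iff]
  intro ε hε
  change _ ∈ densityFilter x
  rw [mem_densityFilter_iff, ENNReal.tendsto_nhds_zero]
  intro c hc
  have hε' : ENNReal.ofReal ε ≠ 0 := by simpa using hε
  obtain ⟨r₀, hr₀, hr₀'⟩ := mem_nhdsGT_iff_exists_Ioo_subset.1
    (hav (ENNReal.ofReal ε * c) (by
      rw [pos_iff_ne_zero]; exact mul_ne_zero hε' hc.ne'))
  filter_upwards [Ioo_mem_nhdsGT (lt_min hr₀ hδ)] with r hr
  have hr1 : 0 < r := hr.1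
  have hrr : r < r₀ := hr.2.trans_le (min_le_left _ _)
  have hrδ : r < δ := hr.2.trans_le (min_le_right _ _)
  rw [ENNReal.div_le_iff (volume_ball_ne_zero _ hr1) (volume_ball_ne_top _ _)]
  -- Tonelli, then the dilation by `t`: its Jacobian `t⁻ⁿ` cancels against the volume of the ball of
  -- radius `t r`, on which the Lebesgue point property applies. Markov's inequality then bounds the
  -- set where the mean oscillation is at least `ε`.
  have hdouble : ∫⁻ h in Metric.ball (0 : Eu n) r, ∫⁻ t in Ioc (0 : ℝ) 1, Φ (t • h) ≤
      ENNReal.ofReal ε * c * volume (Metric.ball (0 : Eu n) r) := by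
    rw [lintegral_lintegral_swap]
    · calc ∫⁻ t in Ioc (0 : ℝ) 1, ∫⁻ h in Metric.ball (0 : Eu n) r, Φ (t • h)
          ≤ ∫⁻ t in Ioc (0 : ℝ) 1, ENNReal.ofReal ε * c * volume (Metric.ball (0 : Eu n) r) := by
            refine setLIntegral_mono measurable_const fun t ht => ?_
            rw [setLIntegral_ball_comp_smul Φ hΦm ht.1]
            have htr : t * r ∈ Ioo 0 r₀ := ⟨mul_pos ht.1 hr1, by nlinarith [ht.1, ht.2]⟩
            have h3 : ∫⁻ k in Metric.ball 0 (t * r), Φ k ≤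
                ENNReal.ofReal ε * c * volume (Metric.ball (0 : Eu n) (t * r)) := hr₀' htr
            rw [Measure.addHaar_ball_mul_of_pos _ _ ht.1, finrank_euclideanSpace_fin] at h3
            refine (mul_le_mul_right h3 _).trans (le_of_eq ?_)
            have h4 : ENNReal.ofReal ((t ^ n)⁻¹) * ENNReal.ofReal (t ^ n) = 1 := by
              have : 0 < t ^ n := pow_pos ht.1 n
              rw [← ENNReal.ofReal_mul (by positivity), inv_mul_cancel₀ this.ne']
              simp
            calc _ = (ENNReal.ofReal ((t ^ n)⁻¹) * ENNReal.ofReal (t ^ n)) *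
                  (ENNReal.ofReal ε * c * volume (Metric.ball (0 : Eu n) r)) := by ring
              _ = _ := by rw [h4, one_mul]
        _ = _ := by simp
    · exact (hΦm.comp (by fun_prop)).aemeasurable
  have hI : Measurable fun h : Eu n => ∫⁻ t in Ioc (0 : ℝ) 1, Φ (t • h) :=
    Measurable.lintegral_prod_right' (f := fun z : Eu n × ℝ => Φ (z.2 • z.1))
      (hΦm.comp (by fun_prop))
  have hmarkov := mul_meas_ge_le_lintegral (μ := volume.restrict (Metric.ball (0 : Eu n) r))
    hI (ENNReal.ofReal ε)
  have hpre : (fun h : Eu n => x + h) ⁻¹'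
      ({y | ‖u y - u x - gradMap (fun j => v j x) (y - x)‖ ≤ ε * ‖y - x‖}ᶜ ∩ Metric.ball x r) =
      {h | ε * ‖h‖ < ‖u (x + h) - u x - gradMap (fun j => v j x) h‖} ∩ Metric.ball 0 r := by
    ext h
    simp
  change volume ({y | ‖u y - u x - gradMap (fun j => v j x) (y - x)‖ ≤ ε * ‖y - x‖}ᶜ ∩
    Metric.ball x r) ≤ _
  rw [← measure_preimage_add volume x, hpre, ← Measure.restrict_apply' measurableSet_ball]
  have hsub : volume.restrict (Metric.ball 0 r)
      {h | ε * ‖h‖ < ‖u (x + h) - u x - gradMap (fun j => v j x) h‖} ≤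
      volume.restrict (Metric.ball 0 r)
        {h | ENNReal.ofReal ε ≤ ∫⁻ t in Ioc (0 : ℝ) 1, Φ (t • h)} := by
    refine measure_mono_ae ?_
    have hres : volume.restrict (Metric.ball (0 : Eu n) r) ≤
        volume.restrict (Metric.ball (0 : Eu n) δ) :=
      Measure.restrict_mono (Metric.ball_subset_ball hrδ.le) le_rfl
    filter_upwards [ae_mono hres hseg] with h hh hlt
    have hlt : ε * ‖h‖ < ‖u (x + h) - u x - gradMap (fun j => v j x) h‖ := hlt
    change ENNReal.ofReal ε ≤ ∫⁻ t in Ioc (0 : ℝ) 1, Φ (t • h)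
    by_contra! hcon
    have h5 : ‖u (x + h) - u x - gradMap (fun j => v j x) h‖ₑ ≤ ‖h‖ₑ * ENNReal.ofReal ε :=
      hh.trans (by gcongr)
    rw [← ofReal_norm, ← ofReal_norm, ← ENNReal.ofReal_mul (norm_nonneg _),
      ENNReal.ofReal_le_ofReal_iff (by positivity)] at h5
    linarith
  refine hsub.trans ?_
  have h6 := hmarkov.trans hdouble
  rw [mul_assoc] at h6
  have h7 := (ENNReal.mul_le_mul_iff_right hε' ENNReal.ofReal_ne_top).1 h6
  refine h7.trans (le_of_eq ?_)
  rw [Measure.addHaar_ball_center volume x]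

end Gradient

/-! ### Approximate differentiability of Sobolev functions. -/

section WeakDerivative

variable {n : ℕ}

/-- Extension by zero to the whole space makes translations and Fubini available without reference
to `Ω`. -/
theorem exists_measurable_representative {p : ENNReal} {Ω : Set (Eu n)} (hΩ : MeasurableSet Ω)
    {u : Eu n → ℝ} (hu : MemLp u p (volume.restrict Ω)) :
    ∃ u' : Eu n → ℝ, Measurable u' ∧ MemLp u' p ∧ u' =ᵐ[volume.restrict Ω] u ∧
      ∀ x ∉ Ω, u' x = 0 := by
  have hm := hu.aestronglyMeasurable
  have hae : Ω.indicator (hm.mk u) =ᵐ[volume.restrict Ω] u :=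
    (indicator_ae_eq_restrict hΩ).trans hm.ae_eq_mk.symm
  refine ⟨Ω.indicator (hm.mk u), hm.stronglyMeasurable_mk.measurable.indicator hΩ, ?_, hae,
    fun x hx => indicator_of_notMem hx _⟩
  rw [memLp_indicator_iff_restrict hΩ]
  exact (memLp_congr_ae hm.ae_eq_mk).1 hu

theorem integral_mul_eq_setIntegral {Ω : Set (Eu n)} {u u' : Eu n → ℝ}
    (hae : u' =ᵐ[volume.restrict Ω] u) (h0 : ∀ x ∉ Ω, u' x = 0) (k : Eu n → ℝ) :
    ∫ x, u' x * k x = ∫ x in Ω, u x * k x := by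
  rw [← setIntegral_eq_integral_of_forall_compl_eq_zero (s := Ω)
    (fun x hx => by rw [h0 x hx, zero_mul])]
  refine integral_congr_ae ?_
  filter_upwards [hae] with x hx
  rw [hx]

theorem mem_densityFilter_of_ae {x : Eu n} {S : Set (Eu n)} (h : ∀ᵐ y, y ∈ S) :
    S ∈ densityFilter x := by
  rw [mem_densityFilter_iff]
  have h0 : volume Sᶜ = 0 := h
  have : ∀ r, volume (Sᶜ ∩ Metric.ball x r) = 0 := fun r => measure_mono_null inter_subset_left h0
  simp [this]

/-- A Sobolev function is approximately differentiable almost everywhere, and its approximate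
differential is its weak gradient. -/
theorem ae_hasApproxFDerivAt {u : Eu n → ℝ} {v : Fin n → Eu n → ℝ}
    (hu : IntegrableOn u (Metric.ball 0 1)) (hv : ∀ j, IntegrableOn (v j) (Metric.ball 0 1))
    (hw : ∀ j, IsWeakPartial (Metric.ball 0 1) j u (v j)) :
    ∀ᵐ x ∂volume.restrict (Metric.ball (0 : Eu n) 1),
      HasApproxFDerivAt u (gradMap fun j => v j x) x := by
  obtain ⟨u', hum, hui, hue, hu0⟩ := exists_measurable_representative (p := 1)
    (measurableSet_ball (x := (0 : Eu n)) (ε := 1)) (memLp_one_iff_integrable.2 hu)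
  have hex := fun j => exists_measurable_representative (p := 1)
    (measurableSet_ball (x := (0 : Eu n)) (ε := 1)) (memLp_one_iff_integrable.2 (hv j))
  choose v' hvm hvi hve hv0 using hex
  rw [memLp_one_iff_integrable] at hui
  simp only [memLp_one_iff_integrable] at hvi
  have hweak : ∀ h : Eu n, ∀ η : Eu n → ℝ, ContDiff ℝ ∞ η → HasCompactSupport η →
      tsupport η ⊆ Metric.ball 0 1 →
      ∫ x, u' x * fderiv ℝ η x h = - ∫ x, (∑ j, h j * v' j x) * η x := by
    intro h η hη hηc hηs
    obtain ⟨C, hC⟩ := hηc.exists_bound_of_continuous hη.continuous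
    obtain ⟨C', hC'⟩ := (hηc.fderiv ℝ).exists_bound_of_continuous
      (hη.continuous_fderiv (by simp))
    have h1 : ∀ x, u' x * fderiv ℝ η x h = ∑ j, h j * (u' x * fderiv ℝ η x (stdVec j)) := by
      intro x
      conv_lhs => rw [← sum_smul_stdVec h]
      simp only [map_sum, map_smul, smul_eq_mul, Finset.mul_sum]
      exact Finset.sum_congr rfl fun j _ => by ring
    have h2 : ∀ x, (∑ j, h j * v' j x) * η x = ∑ j, h j * (v' j x * η x) := by
      intro x
      rw [Finset.sum_mul]
      exact Finset.sum_congr rfl fun j _ => by ring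
    simp only [h1, h2]
    rw [integral_finsetSum, integral_finsetSum, ← Finset.sum_neg_distrib]
    · refine Finset.sum_congr rfl fun j _ => ?_
      rw [integral_const_mul, integral_const_mul, integral_mul_eq_setIntegral hue hu0,
        integral_mul_eq_setIntegral (hve j) (hv0 j), (hw j).2.2 η hη hηc hηs]
      ring
    · intro j _
      exact ((hvi j).mul_bdd hη.continuous.aestronglyMeasurable
        (Eventually.of_forall hC)).const_mul _
    · intro j _
      have hc : Continuous fun x => fderiv ℝ η x (stdVec j) :=
        (hη.continuous_fderiv (by simp)).clm_apply continuous_const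
      refine (hui.mul_bdd (c := C' * ‖(stdVec j : Eu n)‖) hc.aestronglyMeasurable
        (Eventually.of_forall fun x => ?_)).const_mul _
      exact (ContinuousLinearMap.le_opNorm _ _).trans (by gcongr; exact hC' _)
  have hleb : ∀ᵐ x : Eu n, ∀ j, Tendsto (fun r : ℝ =>
      (∫⁻ y in Metric.closedBall x r, ‖v' j y - v' j x‖ₑ) /
      volume (Metric.closedBall x r)) (𝓝[>] 0) (𝓝 0) := by
    rw [ae_all_iff]
    intro j
    filter_upwards [(Besicovitch.vitaliFamily (volume : Measure (Eu n))).ae_tendsto_lintegral_enorm_sub_div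
      (hvi j).locallyIntegrable] with x hx
    exact hx.comp (Besicovitch.tendsto_filterAt volume x)
  -- The radius `1 - 1 / (k + 1)` leaves room for segments shorter than `1 / (k + 1)`; these balls
  -- exhaust the unit ball.
  have hloc : ∀ k : ℕ, ∀ᵐ x : Eu n, x ∈ Metric.ball (0 : Eu n) (1 - 1 / ((k : ℝ) + 1)) →
      HasApproxFDerivAt u' (gradMap fun j => v' j x) x := by
    intro k
    have hδ : (0 : ℝ) < 1 / ((k : ℝ) + 1) := by positivity
    have hseg : ∀ᵐ h ∂volume.restrict (Metric.ball (0 : Eu n) (1 / ((k : ℝ) + 1))),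
        ∀ᵐ x ∂volume.restrict (Metric.ball (0 : Eu n) (1 - 1 / ((k : ℝ) + 1))),
          u' (x + h) - u' x = ∫ t in (0 : ℝ)..1, ∑ j, h j * v' j (x + t • h) := by
      filter_upwards [ae_restrict_mem measurableSet_ball] with h hh
      rw [ae_restrict_iff' measurableSet_ball]
      refine ae_add_sub_eq_integral (V := fun x => ∑ j, h j * v' j x) (Ω := Metric.ball 0 1)
        hui ?_ ?_ (hweak h) Metric.isOpen_ball ?_
      · exact Finset.measurable_sum _ fun j _ => (hvm j).const_mul _
      · exact integrable_finsetSum _ fun j _ => (hvi j).const_mul _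
      · intro x hx t ht
        rw [mem_ball_zero_iff] at hx hh ⊢
        have h1 : ‖t • h‖ ≤ ‖h‖ := by
          rw [norm_smul, Real.norm_of_nonneg ht.1]
          nlinarith [norm_nonneg h, ht.2]
        linarith [norm_add_le x (t • h)]
    have hmeas : MeasurableSet {z : Eu n × Eu n | u' (z.2 + z.1) - u' z.2 =
        ∫ t in (0 : ℝ)..1, ∑ j, z.1 j * v' j (z.2 + t • z.1)} := by
      refine measurableSet_eq_fun ?_ ?_
      · exact (hum.comp (by fun_prop)).sub (hum.comp measurable_snd)
      · simp only [intervalIntegral.integral_of_le zero_le_one]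
        have hsm : StronglyMeasurable fun w : (Eu n × Eu n) × ℝ =>
            ∑ j, w.1.1 j * v' j (w.1.2 + w.2 • w.1.1) := by
          refine Measurable.stronglyMeasurable (Finset.measurable_sum _ fun j _ => ?_)
          exact Measurable.mul (by fun_prop) ((hvm j).comp (by fun_prop))
        exact hsm.integral_prod_right.measurable
    -- The segment identity is known for each `h` and almost every `x`. Approximate
    -- differentiability at `x` needs almost every `h` for fixed `x`, and the exchange requires the
    -- joint measurability just shown.
    rw [Measure.ae_ae_comm (p := fun h x : Eu n => u' (x + h) - u' x =
      ∫ t in (0 : ℝ)..1, ∑ j, h j * v' j (x + t • h)) hmeas,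
      ae_restrict_iff' measurableSet_ball] at hseg
    filter_upwards [hseg, hleb] with x hx1 hx2 hxb
    exact hasApproxFDerivAt_of_lebesgue_point hδ hvm (hx1 hxb) hx2
  have hue' := (ae_restrict_iff' (measurableSet_ball (x := (0 : Eu n)) (ε := 1))).1 hue
  have hve' : ∀ᵐ x : Eu n, ∀ j, x ∈ Metric.ball (0 : Eu n) 1 → v' j x = v j x :=
    ae_all_iff.2 fun j => (ae_restrict_iff' measurableSet_ball).1 (hve j)
  rw [ae_restrict_iff' measurableSet_ball]
  filter_upwards [ae_all_iff.2 hloc, hue', hve'] with x hx hxu hxv hxb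
  have hx1 : ‖x‖ < 1 := by simpa using hxb
  obtain ⟨k, hk⟩ := exists_nat_one_div_lt (sub_pos.2 hx1)
  have h1 := hx k (by rw [mem_ball_zero_iff]; linarith)
  have h2 : (fun j => v' j x) = fun j => v j x := funext fun j => hxv j hxb
  rw [h2] at h1
  refine h1.congr ?_ (hxu hxb)
  filter_upwards [mem_densityFilter_of_ae hue',
    densityFilter_le_nhds x (Metric.isOpen_ball.mem_nhds hxb)] with y hy hyb
  exact hy hyb

end WeakDerivative

/-! ### The weak derivative of a square. -/

section WeakSquare

variable {n : ℕ}

/-- `w` agrees almost everywhere with an absolutely continuous function, whose product with itself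
obeys the fundamental theorem of calculus. This is the one-dimensional core of the chain rule for
`u²`. -/
theorem integral_two_mul_eq_sq_sub {a T : ℝ} {w z : ℝ → ℝ} (hT : 0 ≤ T)
    (hz : IntervalIntegrable z volume 0 T)
    (hw : ∀ᵐ τ ∂volume.restrict (Ioo 0 T), w τ = a + ∫ σ in (0 : ℝ)..τ, z σ) :
    ∀ t ∈ Ioo 0 T, ∫ τ in (0 : ℝ)..t, 2 * w τ * z τ = (a + ∫ σ in (0 : ℝ)..t, z σ) ^ 2 - a ^ 2 := by
  intro t ht
  have hzt : IntervalIntegrable z volume 0 t :=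
    hz.mono_set (by rw [uIcc_of_le ht.1.le, uIcc_of_le hT]; exact Icc_subset_Icc_right ht.2.le)
  have hac0 := hzt.absolutelyContinuousOnInterval_intervalIntegral (c := 0) (by simp)
  have hac : AbsolutelyContinuousOnInterval (fun τ => a + ∫ σ in (0 : ℝ)..τ, z σ) 0 t :=
    ((LipschitzWith.const a).lipschitzOnWith (s := uIcc 0 t)).absolutelyContinuousOnInterval.add hac0
  have h1 := hac.integral_deriv_mul_eq_sub hac
  have h2 : ∫ τ in (0 : ℝ)..t, 2 * w τ * z τ = ∫ τ in (0 : ℝ)..t,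
      (deriv (fun τ => a + ∫ σ in (0 : ℝ)..τ, z σ) τ * (a + ∫ σ in (0 : ℝ)..τ, z σ) +
      (a + ∫ σ in (0 : ℝ)..τ, z σ) * deriv (fun τ => a + ∫ σ in (0 : ℝ)..τ, z σ) τ) := by
    refine intervalIntegral.integral_congr_ae ?_
    rw [ae_restrict_iff' measurableSet_Ioo] at hw
    filter_upwards [hw, hzt.ae_hasDerivAt_integral] with τ h3 h4 hτ
    rw [uIoc_of_le ht.1.le] at hτ
    have h5 := h4 (by rw [uIcc_of_le ht.1.le]; exact ⟨hτ.1.le, hτ.2⟩) 0 (by simp)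
    rw [(h5.const_add a).deriv, h3 ⟨hτ.1, hτ.2.trans_lt ht.2⟩]
    ring
  rw [h2, h1]
  simp
  ring

theorem hasDerivAt_integral_mul_comp_sub {w η : Eu n → ℝ} (hw : Integrable w)
    (hη : ContDiff ℝ ∞ η) (hηc : HasCompactSupport η) (e : Eu n) (t : ℝ) :
    HasDerivAt (fun t : ℝ => ∫ x, w x * η (x - t • e))
      (∫ x, w x * -(fderiv ℝ η (x - t • e) e)) t := by
  obtain ⟨C, hC⟩ := hηc.exists_bound_of_continuous hη.continuous
  obtain ⟨C', hC'⟩ := (hηc.fderiv ℝ).exists_bound_of_continuous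
    (hη.continuous_fderiv (by simp))
  have hc : ∀ t : ℝ, Continuous fun x => η (x - t • e) := fun t => hη.continuous.comp (by fun_prop)
  have hc' : ∀ t : ℝ, Continuous fun x => -(fderiv ℝ η (x - t • e) e) := fun t =>
    (((hη.continuous_fderiv (by simp)).comp (by fun_prop)).clm_apply continuous_const).neg
  refine (hasDerivAt_integral_of_dominated_loc_of_deriv_le (𝕜 := ℝ) (s := univ)
    (F := fun t x => w x * η (x - t • e)) (F' := fun t x => w x * -(fderiv ℝ η (x - t • e) e))
    (bound := fun x => ‖w x‖ * (C' * ‖e‖)) univ_mem ?_ ?_ ?_ ?_ ?_ ?_).2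
  · exact Eventually.of_forall fun t =>
      hw.aestronglyMeasurable.mul (hc t).aestronglyMeasurable
  · exact hw.mul_bdd (hc t).aestronglyMeasurable (Eventually.of_forall fun x => hC _)
  · exact hw.aestronglyMeasurable.mul (hc' t).aestronglyMeasurable
  · refine Eventually.of_forall fun x t _ => ?_
    rw [norm_mul, norm_neg]
    gcongr
    exact (ContinuousLinearMap.le_opNorm _ _).trans (by gcongr; exact hC' _)
  · exact hw.norm.mul_const _
  · refine Eventually.of_forall fun x t _ => ?_
    have h1 : HasDerivAt (fun t : ℝ => x - t • e) (-e) t := by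
      simpa using ((hasDerivAt_id t).smul_const e).const_sub x
    have h2 := ((hη.differentiable (by simp)) (x - t • e)).hasFDerivAt.comp_hasDerivAt t h1
    rw [map_neg] at h2
    exact h2.const_mul (w x)

/-- If `w` is the integral of `z` along almost every short segment of direction `e`, then `z` is
the weak derivative of `w` along `e`. -/
theorem integral_mul_fderiv_of_segments {w z η : Eu n → ℝ} {e : Eu n} {δ : ℝ} (hδ : 0 < δ)
    (hw : Integrable w) (hzm : Measurable z) (hz : Integrable z)
    (hη : ContDiff ℝ ∞ η) (hηc : HasCompactSupport η)
    (hseg : ∀ᵐ t ∂volume.restrict (Ioo 0 δ), ∀ᵐ x, x ∈ tsupport η →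
      w (x + t • e) - w x = ∫ τ in (0 : ℝ)..t, z (x + τ • e)) :
    ∫ x, w x * fderiv ℝ η x e = - ∫ x, z x * η x := by
  obtain ⟨C, hC⟩ := hηc.exists_bound_of_continuous hη.continuous
  set Θ : ℝ → ℝ := fun t => ∫ x, w x * η (x - t • e) with hΘ
  set Ψ : ℝ → ℝ := fun t => ∫ x, z x * η (x - t • e) with hΨ
  have hΘd := hasDerivAt_integral_mul_comp_sub hw hη hηc e
  have hΨd := hasDerivAt_integral_mul_comp_sub hz hη hηc e
  have hΘc : Continuous Θ := continuous_iff_continuousAt.2 fun t => (hΘd t).continuousAt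
  have hΨc : Continuous Ψ := continuous_iff_continuousAt.2 fun t => (hΨd t).continuousAt
  have hcomp : ∀ {y : Eu n → ℝ} (_ : Integrable y), Integrable fun x => y x * η x := fun hy =>
    hy.mul_bdd hη.continuous.aestronglyMeasurable (Eventually.of_forall hC)
  -- Shifting the variable in both integrals turns the segment identity into `Θ(t) - Θ(0) = ∫₀ᵗ Ψ`,
  -- at first for almost every small `t`. Continuity gives it for every small `t > 0`, and the right
  -- derivative at `0` is the claim.
  have hae : (fun t => Θ t - Θ 0) =ᵐ[volume.restrict (Ioo 0 δ)]
      fun t => ∫ τ in (0 : ℝ)..t, Ψ τ := by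
    filter_upwards [hseg, ae_restrict_mem measurableSet_Ioo] with t ht htδ
    have h1 : Θ t - Θ 0 = ∫ x, (w (x + t • e) - w x) * η x := by
      simp only [sub_mul]
      rw [integral_sub (hcomp (hw.comp_add_right _)) (hcomp hw)]
      simp only [hΘ, zero_smul, sub_zero]
      rw [← integral_add_right_eq_self (fun x => w x * η (x - t • e)) (t • e)]
      simp
    have h2 : ∫ x, (w (x + t • e) - w x) * η x =
        ∫ x, (∫ τ in (0 : ℝ)..t, z (x + τ • e)) * η x := by
      refine integral_congr_ae ?_
      filter_upwards [ht] with x hx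
      by_cases hxs : x ∈ tsupport η
      · rw [hx hxs]
      · rw [image_eq_zero_of_notMem_tsupport hxs, mul_zero, mul_zero]
    rw [h1, h2]
    simp only [intervalIntegral.integral_of_le htδ.1.le, ← integral_mul_const]
    rw [integral_integral_swap]
    · refine integral_congr_ae (Eventually.of_forall fun τ => ?_)
      simp only [hΨ]
      rw [← integral_add_right_eq_self (fun x => z x * η (x - τ • e)) (τ • e)]
      simp
    · exact (integrable_comp_add_smul hzm hz e 0 t).mul_bdd (c := C)
        (hη.continuous.comp continuous_fst).aestronglyMeasurable
        (Eventually.of_forall fun x => hC _)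
  have hId : ∀ t, HasDerivAt (fun t => ∫ τ in (0 : ℝ)..t, Ψ τ) (Ψ t) t := fun t =>
    intervalIntegral.integral_hasDerivAt_right (hΨc.intervalIntegrable _ _)
      (hΨc.stronglyMeasurableAtFilter _ _) hΨc.continuousAt
  have heq : EqOn (fun t => Θ t - Θ 0) (fun t => ∫ τ in (0 : ℝ)..t, Ψ τ) (Ioo 0 δ) :=
    Measure.eqOn_open_of_ae_eq hae isOpen_Ioo (hΘc.sub continuous_const).continuousOn
      (fun t _ => (hId t).continuousAt.continuousWithinAt)
  have hd1 : HasDerivWithinAt (fun t => Θ t - Θ 0) _ (Ici 0) 0 :=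
    ((hΘd 0).sub_const (Θ 0)).hasDerivWithinAt
  have hd2 : HasDerivWithinAt (fun t => Θ t - Θ 0) (Ψ 0) (Ici 0) 0 := by
    refine (hId 0).hasDerivWithinAt.congr_of_eventuallyEq ?_ (by simp)
    filter_upwards [Ico_mem_nhdsGE hδ] with t ht
    rcases ht.1.eq_or_lt with h0 | h0
    · simp [← h0]
    · exact heq ⟨h0, ht.2⟩
  have := (uniqueDiffWithinAt_Ici (0 : ℝ)).eq_deriv _ hd1 hd2
  simp only [hΨ, zero_smul, sub_zero, mul_neg, integral_neg] at this
  rw [← this, neg_neg]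

/-- The chain rule for the square of a Sobolev function. -/
theorem integral_sq_mul_fderiv {u v η : Eu n → ℝ} {j : Fin n} {Ω : Set (Eu n)} (hΩ : IsOpen Ω)
    (hΩv : volume Ω ≠ ⊤)
    (hu : MemLp u 2 (volume.restrict Ω)) (hv : MemLp v 2 (volume.restrict Ω))
    (hw : IsWeakPartial Ω j u v)
    (hη : ContDiff ℝ ∞ η) (hηc : HasCompactSupport η) (hηs : tsupport η ⊆ Ω) :
    ∫ x in Ω, u x ^ 2 * fderiv ℝ η x (stdVec j) =
      - ∫ x in Ω, (2 * u x * v x) * η x := by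
  have hfin : IsFiniteMeasure (volume.restrict Ω) := ⟨by simpa using hΩv.lt_top⟩
  obtain ⟨u', hum, hui, hue, hu0⟩ := exists_measurable_representative hΩ.measurableSet hu
  obtain ⟨v', hvm, hvi, hve, hv0⟩ := exists_measurable_representative hΩ.measurableSet hv
  have hint : ∀ {y y' : Eu n → ℝ}, MemLp y 2 (volume.restrict Ω) →
      y' =ᵐ[volume.restrict Ω] y → (∀ x ∉ Ω, y' x = 0) → Integrable y' := by
    intro y y' hy he h0
    have h1 : IntegrableOn y' Ω := (hy.integrable one_le_two).congr he.symm
    exact h1.integrable_of_forall_notMem_eq_zero h0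
  have hu1 := hint hu hue hu0
  have hv1 := hint hv hve hv0
  obtain ⟨δ, hδ, hδΩ⟩ := IsCompact.exists_thickening_subset_open hηc hΩ hηs
  set e : Eu n := stdVec j with he
  have hen : ‖e‖ = 1 := by simp [he, stdVec]
  set U : Set (Eu n) := Metric.thickening (δ / 2) (tsupport η) with hU
  have hUo : IsOpen U := Metric.isOpen_thickening
  -- The weak derivative along `τ e` is `τ v'`; rescaling the parameter to `[0, τ]` absorbs the
  -- factor. Shifts shorter than `δ / 2` starting in the `δ / 2`-thickening remain in `Ω`.
  have hsegu : ∀ᵐ τ ∂volume.restrict (Ioo 0 (δ / 2)), ∀ᵐ x ∂volume.restrict U,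
      u' (x + τ • e) = u' x + ∫ σ in (0 : ℝ)..τ, v' (x + σ • e) := by
    filter_upwards [ae_restrict_mem measurableSet_Ioo] with τ hτ
    rw [ae_restrict_iff' hUo.measurableSet]
    have h1 := ae_add_sub_eq_integral (u := u') (V := fun x => τ * v' x) (Ω := Ω) (U := U)
      (h := τ • e) hu1 (hvm.const_mul _) (hv1.const_mul _) ?_ hUo ?_
    · filter_upwards [h1] with x hx hxU
      have h2 := hx hxU
      rw [intervalIntegral.integral_const_mul] at h2
      have h3 := intervalIntegral.mul_integral_comp_mul_left (a := 0) (b := 1)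
        (f := fun σ => v' (x + σ • e)) τ
      simp only [mul_zero, mul_one] at h3
      rw [← h3, ← sub_eq_iff_eq_add', h2]
      simp only [smul_smul, mul_comm]
    · intro θ hθ hθc hθs
      have h2 := hw.2.2 θ hθ hθc hθs
      rw [← integral_mul_eq_setIntegral hue hu0, ← integral_mul_eq_setIntegral hve hv0] at h2
      simp only [map_smul, smul_eq_mul, mul_assoc, mul_left_comm _ τ]
      rw [integral_const_mul, integral_const_mul, h2]
      ring
    · intro x hx t ht
      apply hδΩ
      obtain ⟨y, hy, hxy⟩ := Metric.mem_thickening_iff.1 hx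
      refine Metric.mem_thickening_iff.2 ⟨y, hy, ?_⟩
      have h4 : dist (x + t • τ • e) x ≤ τ := by
        rw [dist_eq_norm, add_sub_cancel_left, norm_smul, norm_smul, hen,
          Real.norm_of_nonneg ht.1, Real.norm_of_nonneg hτ.1.le]
        nlinarith [ht.2, hτ.1]
      linarith [dist_triangle (x + t • τ • e) x y, hτ.2]
  have hmeasI : ∀ {y : Eu n → ℝ}, Measurable y →
      Measurable fun z : ℝ × Eu n => ∫ σ in (0 : ℝ)..z.1, y (z.2 + σ • e) := by
    intro y hy
    -- Rescaling to the fixed interval `(0, 1]` makes the integral with variable endpoint a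
    -- parametric integral, measurable by Fubini.
    have h1 : (fun z : ℝ × Eu n => ∫ σ in (0 : ℝ)..z.1, y (z.2 + σ • e)) =
        fun z : ℝ × Eu n => z.1 * ∫ t in Ioc (0 : ℝ) 1, y (z.2 + (z.1 * t) • e) := by
      funext z
      rw [← intervalIntegral.integral_of_le zero_le_one]
      have h3 := intervalIntegral.mul_integral_comp_mul_left (a := 0) (b := 1)
        (f := fun σ => y (z.2 + σ • e)) z.1
      simp only [mul_zero, mul_one] at h3
      exact h3.symm
    rw [h1]
    have hsm : StronglyMeasurable fun w : (ℝ × Eu n) × ℝ => y (w.1.2 + (w.1.1 * w.2) • e) :=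
      (hy.comp (by fun_prop)).stronglyMeasurable
    exact measurable_fst.mul hsm.integral_prod_right.measurable
  have hmeas1 : MeasurableSet {z : ℝ × Eu n |
      u' (z.2 + z.1 • e) = u' z.2 + ∫ σ in (0 : ℝ)..z.1, v' (z.2 + σ • e)} :=
    measurableSet_eq_fun (hum.comp (by fun_prop)) ((hum.comp measurable_snd).add (hmeasI hvm))
  have huvm : Measurable fun x => 2 * u' x * v' x := (hum.const_mul 2).mul hvm
  have hmeas2 : MeasurableSet {z : ℝ × Eu n | u' (z.2 + z.1 • e) ^ 2 - u' z.2 ^ 2 =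
      ∫ σ in (0 : ℝ)..z.1, 2 * u' (z.2 + σ • e) * v' (z.2 + σ • e)} :=
    measurableSet_eq_fun (((hum.comp (by fun_prop)).pow_const 2).sub
      ((hum.comp measurable_snd).pow_const 2)) (hmeasI huvm)
  rw [Measure.ae_ae_comm (p := fun τ x => u' (x + τ • e) =
    u' x + ∫ σ in (0 : ℝ)..τ, v' (x + σ • e)) hmeas1] at hsegu
  have hvint : ∀ᵐ x : Eu n, IntervalIntegrable (fun σ : ℝ => v' (x + σ • e)) volume 0 (δ / 2) := by
    filter_upwards [(integrable_comp_add_smul hvm hv1 e 0 (δ / 2)).prod_right_ae] with x hx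
    exact (intervalIntegrable_iff_integrableOn_Ioc_of_le (by positivity)).2 hx
  have hsegsq : ∀ᵐ x ∂volume.restrict U, ∀ᵐ τ ∂volume.restrict (Ioo 0 (δ / 2)),
      u' (x + τ • e) ^ 2 - u' x ^ 2 =
        ∫ σ in (0 : ℝ)..τ, 2 * u' (x + σ • e) * v' (x + σ • e) := by
    filter_upwards [hsegu, ae_restrict_of_ae hvint] with x hx hxi
    filter_upwards [hx, ae_restrict_mem measurableSet_Ioo] with τ hτ hτI
    rw [integral_two_mul_eq_sq_sub (w := fun σ => u' (x + σ • e)) (by positivity) hxi hx τ hτI, hτ]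
  rw [← Measure.ae_ae_comm (p := fun (τ : ℝ) x => u' (x + τ • e) ^ 2 - u' x ^ 2 =
    ∫ σ in (0 : ℝ)..τ, 2 * u' (x + σ • e) * v' (x + σ • e)) hmeas2] at hsegsq
  have hfinal := integral_mul_fderiv_of_segments (w := fun x => u' x ^ 2)
    (z := fun x => 2 * u' x * v' x) (η := η) (e := e) (δ := δ / 2) (by positivity)
    hui.integrable_sq huvm ?_ hη hηc ?_
  · rw [integral_mul_eq_setIntegral (u := fun x => u x ^ 2) (u' := fun x => u' x ^ 2),
      integral_mul_eq_setIntegral (u := fun x => 2 * u x * v x)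
      (u' := fun x => 2 * u' x * v' x)] at hfinal
    · exact hfinal
    · filter_upwards [hue, hve] with x h1 h2
      rw [h1, h2]
    · intro x hx
      simp [hu0 x hx]
    · filter_upwards [hue] with x h1
      rw [h1]
    · intro x hx
      simp [hu0 x hx]
  · have := (hui.integrable_mul hvi).const_mul 2
    simpa only [Pi.mul_apply, mul_assoc] using this
  · filter_upwards [hsegsq] with τ hτ
    rw [ae_restrict_iff' hUo.measurableSet] at hτ
    filter_upwards [hτ] with x hx hxs
    exact hx (Metric.self_subset_thickening (by positivity) _ hxs)

end WeakSquare

/-! ### Branches near separated centres. -/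

section Clusters

variable {n m Q : ℕ}

/-- The distinct points of `p` have mutual distances at least `8 δ`. -/
def Separated (p : Fin Q → Eu m) (δ : ℝ) : Prop := ∀ i k, p i ≠ p k → 8 * δ ≤ ‖p i - p k‖

open Classical in
/-- The indices of the points of `p` that coincide with `p i`. -/
def cluster (p : Fin Q → Eu m) (i : Fin Q) : Finset (Fin Q) := {k | p k = p i}

open Classical in
/-- The tuple `p` with the cluster of `p i` moved by `δ` in the `a`-th coordinate direction. -/
def clusterShift (p : Fin Q → Eu m) (δ : ℝ) (i : Fin Q) (a : Fin m) : Fin Q → Eu m :=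
  fun k => if p k = p i then p k + δ • stdVec a else p k

/-- The `a`-th coordinate of the mean of the points of `S` near `p i`, expressed through the
distances of `S` to two fixed `Q`-points. -/
def clusterMean (p : Fin Q → Eu m) (δ : ℝ) (i : Fin Q) (a : Fin m) (S : AQ Q m) : ℝ :=
  p i a + δ / 2 - (2 * δ * (cluster p i).card)⁻¹ *
    (dG S (ofPoints (clusterShift p δ i a)) ^ 2 - dG S (ofPoints p) ^ 2)

theorem mem_cluster {p : Fin Q → Eu m} {i k : Fin Q} : k ∈ cluster p i ↔ p k = p i := by
  simp [cluster]

theorem cluster_card_pos (p : Fin Q → Eu m) (i : Fin Q) : 0 < ((cluster p i).card : ℝ) :=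
  Nat.cast_pos.2 (Finset.card_pos.2 ⟨i, mem_cluster.2 rfl⟩)

theorem clusterShift_congr {p : Fin Q → Eu m} {i k : Fin Q} (h : p i = p k) (δ : ℝ) (a : Fin m) :
    clusterShift p δ i a = clusterShift p δ k a := by
  unfold clusterShift
  rw [h]

theorem cluster_congr {p : Fin Q → Eu m} {i k : Fin Q} (h : p i = p k) :
    cluster p i = cluster p k := by
  unfold cluster
  rw [h]

theorem clusterMean_congr {p : Fin Q → Eu m} {i k : Fin Q} (h : p i = p k) (δ : ℝ) (a : Fin m) :
    clusterMean p δ i a = clusterMean p δ k a := by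
  funext S
  rw [clusterMean, clusterMean, clusterShift_congr h, cluster_congr h, h]

theorem norm_stdVec (a : Fin m) : ‖(stdVec a : Eu m)‖ = 1 := by simp [stdVec]

theorem norm_clusterShift_sub_le (p : Fin Q → Eu m) {δ : ℝ} (hδ : 0 ≤ δ) (i : Fin Q) (a : Fin m)
    (k : Fin Q) : ‖clusterShift p δ i a k - p k‖ ≤ δ := by
  unfold clusterShift
  split_ifs
  · rw [add_sub_cancel_left, norm_smul, norm_stdVec, mul_one, Real.norm_of_nonneg hδ]
  · simpa using hδ

/-- Both squared distances are attained by the identity matching. They differ only on the cluster of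
`i`, where `‖y - δ e_a‖² - ‖y‖² = δ² - 2 δ y_a` for `y = s i - p i`. The definition of `clusterMean`
solves the resulting equation for `s i a`. -/
theorem clusterMean_ofPoints {p s : Fin Q → Eu m} {δ : ℝ} (hδ : 0 < δ) (hp : Separated p δ)
    (hs : ∀ k, ‖s k - p k‖ ≤ 2 * δ) (i : Fin Q) (a : Fin m)
    (hc : ∀ k, p k = p i → s k = s i) :
    clusterMean p δ i a (ofPoints s) = s i a := by
  have h1 : dG (ofPoints s) (ofPoints (clusterShift p δ i a)) ^ 2 =
      ∑ k, ‖s k - clusterShift p δ i a k‖ ^ 2 := by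
    refine dG_sq_of_clusters hp hs (norm_clusterShift_sub_le p hδ.le i a) fun k l hkl => ?_
    simp only [clusterShift, hkl]
  have h2 : dG (ofPoints s) (ofPoints p) ^ 2 = ∑ k, ‖s k - p k‖ ^ 2 :=
    dG_sq_of_clusters hp hs (fun _ => by simpa using hδ.le) fun k l hkl => hkl
  have h3 : ∑ k, ‖s k - clusterShift p δ i a k‖ ^ 2 - ∑ k, ‖s k - p k‖ ^ 2 =
      ∑ k ∈ cluster p i, (δ ^ 2 - 2 * δ * (s i a - p i a)) := by
    classical
    rw [← Finset.sum_sub_distrib, cluster, Finset.sum_filter]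
    refine Finset.sum_congr rfl fun k _ => ?_
    unfold clusterShift
    split_ifs with h
    · rw [← sub_sub, norm_sub_sq_real, norm_smul, norm_stdVec, inner_smul_right, hc k h, h]
      have : inner ℝ (s i - p i) (stdVec a) = s i a - p i a := by
        rw [stdVec, EuclideanSpace.inner_single_right]
        simp
      rw [this, Real.norm_of_nonneg hδ.le]
      ring
    · simp
  have hκ := cluster_card_pos p i
  rw [clusterMean, h1, h2, h3, Finset.sum_const, nsmul_eq_mul]
  field_simp
  ring

/-- The branch of `f` near `p i`. -/
def branch (f : Eu n → AQ Q m) (p : Fin Q → Eu m) (δ : ℝ) (i : Fin Q) (x : Eu n) : Eu m :=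
  WithLp.toLp 2 fun a => clusterMean p δ i a (f x)

theorem branch_congr (f : Eu n → AQ Q m) {p : Fin Q → Eu m} {i k : Fin Q} (h : p i = p k)
    (δ : ℝ) : branch f p δ i = branch f p δ k := by
  funext x
  simp only [branch, clusterMean_congr h]

theorem branch_eq {f : Eu n → AQ Q m} {p s : Fin Q → Eu m} {δ : ℝ} (hδ : 0 < δ)
    (hp : Separated p δ) {x : Eu n} (hx : f x = ofPoints s) (hs : ∀ k, ‖s k - p k‖ ≤ 2 * δ)
    (hc : ∀ i k, p k = p i → s k = s i) (i : Fin Q) : branch f p δ i x = s i := by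
  ext a
  change clusterMean p δ i a (f x) = s i a
  rw [hx, clusterMean_ofPoints hδ hp hs i a (hc i)]

/-- The points of the unit ball where `f` is the sum of its branches near `p`. -/
def piece (f : Eu n → AQ Q m) (p : Fin Q → Eu m) (δ : ℝ) : Set (Eu n) :=
  {x | x ∈ Metric.ball 0 1 ∧ f x = ofPoints (fun i => branch f p δ i x) ∧
    ∀ i, ‖branch f p δ i x - p i‖ ≤ δ}

theorem piece_subset (f : Eu n → AQ Q m) (p : Fin Q → Eu m) (δ : ℝ) :
    piece f p δ ⊆ Metric.ball 0 1 := fun _ hx => hx.1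

/-- Centres in a countable dense set and radii `1 / (N + 1)` suffice. The distinct points of `f x`
are `10 δ` apart for a small such `δ`, and moving each by less than `δ` to a centre, the same for
equal points, leaves separation `8 δ`. -/
theorem exists_mem_piece (f : Eu n → AQ Q m) {x : Eu n} (hx : x ∈ Metric.ball (0 : Eu n) 1) :
    ∃ (c : Fin Q → ℕ) (N : ℕ), Separated (fun i => TopologicalSpace.denseSeq (Eu m) (c i))
      (1 / ((N : ℝ) + 1)) ∧
      x ∈ piece f (fun i => TopologicalSpace.denseSeq (Eu m) (c i)) (1 / ((N : ℝ) + 1)) := by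
  obtain ⟨q, hq⟩ := exists_ofPoints_eq (f x)
  have hsep : ∃ N : ℕ, ∀ i k, q i ≠ q k → 10 * (1 / ((N : ℝ) + 1)) ≤ ‖q i - q k‖ := by
    have h1 : ∀ z : Fin Q × Fin Q, ∀ᶠ N : ℕ in atTop,
        q z.1 ≠ q z.2 → 10 * (1 / ((N : ℝ) + 1)) ≤ ‖q z.1 - q z.2‖ := by
      intro z
      by_cases hz : q z.1 = q z.2
      · exact Eventually.of_forall fun N h => absurd hz h
      · have h2 : Tendsto (fun N : ℕ => 10 * (1 / ((N : ℝ) + 1))) atTop (𝓝 (10 * 0)) :=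
          tendsto_one_div_add_atTop_nhds_zero_nat.const_mul 10
        rw [mul_zero] at h2
        filter_upwards [h2.eventually_le_const (norm_pos_iff.2 (sub_ne_zero.2 hz))] with N hN _
        exact hN
    obtain ⟨N, hN⟩ := (eventually_all.2 h1).exists
    exact ⟨N, fun i k => hN (i, k)⟩
  obtain ⟨N, hN⟩ := hsep
  obtain ⟨δ, hδe⟩ : ∃ δ : ℝ, δ = 1 / ((N : ℝ) + 1) := ⟨_, rfl⟩
  have hδ : 0 < δ := by rw [hδe]; positivity
  rw [← hδe] at hN
  have hd : ∀ y : Eu m, ∃ k : ℕ, dist y (TopologicalSpace.denseSeq (Eu m) k) < δ := fun y =>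
    (TopologicalSpace.denseRange_denseSeq (Eu m)).exists_dist_lt y hδ
  choose d hd using hd
  refine ⟨fun i => d (q i), N, ?_⟩
  rw [← hδe]
  obtain ⟨p, hpe⟩ : ∃ p : Fin Q → Eu m, p = fun i => TopologicalSpace.denseSeq (Eu m) (d (q i)) :=
    ⟨_, rfl⟩
  rw [← hpe]
  have hqp : ∀ i, ‖q i - p i‖ < δ := fun i => by
    rw [← dist_eq_norm, hpe]
    exact hd (q i)
  have hpq : ∀ i k, q i = q k → p i = p k := fun i k h => by
    rw [hpe]
    simp only [h]
  have hsep : Separated p δ := by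
    intro i k hik
    have h1 := hN i k fun h => hik (hpq i k h)
    have h2 : ‖q i - q k‖ ≤ ‖q i - p i‖ + ‖p i - p k‖ + ‖q k - p k‖ := by
      calc ‖q i - q k‖ = ‖(q i - p i) + (p i - p k) - (q k - p k)‖ := by congr 1; abel
        _ ≤ ‖(q i - p i) + (p i - p k)‖ + ‖q k - p k‖ := norm_sub_le _ _
        _ ≤ _ := by gcongr; exact norm_add_le _ _
    linarith [hqp i, hqp k]
  have hconst : ∀ i k, p k = p i → q k = q i := by
    intro i k hik
    by_contra hne
    have h1 := hN k i hne
    have h2 : ‖q k - q i‖ ≤ ‖q k - p k‖ + ‖q i - p i‖ := by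
      calc ‖q k - q i‖ = ‖(q k - p k) - (q i - p i)‖ := by rw [hik]; congr 1; abel
        _ ≤ _ := norm_sub_le _ _
    linarith [hqp i, hqp k]
  have hb : ∀ i, branch f p δ i x = q i :=
    branch_eq hδ hsep hq.symm (fun k => by linarith [hqp k]) hconst
  refine ⟨hsep, hx, ?_, fun i => ?_⟩
  · simp only [hb, hq]
  · rw [hb]
    exact (hqp i).le

/-- At the points of a piece, coincident branches have coincident centres. -/
theorem eq_of_branch_eq {f : Eu n → AQ Q m} {p : Fin Q → Eu m} {δ : ℝ} (hδ : 0 < δ)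
    (hp : Separated p δ) {x : Eu n} (hx : x ∈ piece f p δ) {i k : Fin Q}
    (h : branch f p δ i x = branch f p δ k x) : p i = p k := by
  by_contra hne
  have h1 := hp i k hne
  have h2 : ‖p i - p k‖ ≤ ‖branch f p δ k x - p k‖ + ‖branch f p δ i x - p i‖ := by
    calc ‖p i - p k‖ = ‖(branch f p δ k x - p k) - (branch f p δ i x - p i)‖ := by
          rw [h]; congr 1; abel
      _ ≤ _ := norm_sub_le _ _
  linarith [hx.2.2 i, hx.2.2 k]

/-- Only distances of `f` to fixed Q-points are known to be measurable, while the Q-point of the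
branches varies with `x`. The two coincide exactly when some Q-point from a countable dense family
is arbitrarily close to both. -/
theorem nullMeasurableSet_piece {f : Eu n → AQ Q m}
    (hf : ∀ T, AEMeasurable (fun x => dG (f x) T) (volume.restrict (Metric.ball 0 1)))
    (p : Fin Q → Eu m) (δ : ℝ) : NullMeasurableSet (piece f p δ) := by
  set μ := volume.restrict (Metric.ball (0 : Eu n) 1) with hμ
  have hg : ∀ i, AEMeasurable (branch f p δ i) μ := by
    intro i
    refine (WithLp.measurable_toLp 2 _).comp_aemeasurable (aemeasurable_pi_lambda _ fun a => ?_)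
    unfold clusterMean
    exact ((((hf _).pow_const 2).sub ((hf _).pow_const 2)).const_mul _).const_sub _
  set s : ℕ → Fin Q → Eu m := TopologicalSpace.denseSeq (Fin Q → Eu m) with hs
  have hset : piece f p δ = ((⋂ l : ℕ, ⋃ k : ℕ, {x | dG (f x) (ofPoints (s k)) +
      Real.sqrt (∑ i, ‖s k i - branch f p δ i x‖ ^ 2) < 1 / ((l : ℝ) + 1)}) ∩
      ⋂ i, {x | ‖branch f p δ i x - p i‖ ≤ δ}) ∩ Metric.ball 0 1 := by
    ext x
    simp only [piece, mem_inter_iff, mem_iInter, mem_iUnion]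
    constructor
    · rintro ⟨hx, hfx, hb⟩
      refine ⟨⟨fun l => ?_, hb⟩, hx⟩
      have hcont : Continuous fun t : Fin Q → Eu m =>
          2 * Real.sqrt (∑ i, ‖t i - branch f p δ i x‖ ^ 2) := by fun_prop
      have hopen := (isOpen_Iio (a := 1 / ((l : ℝ) + 1))).preimage hcont
      obtain ⟨k, hk⟩ := (TopologicalSpace.denseRange_denseSeq (Fin Q → Eu m)).exists_mem_open
        hopen ⟨fun i => branch f p δ i x, by simp; positivity⟩
      refine ⟨k, ?_⟩
      have hk : 2 * Real.sqrt (∑ i, ‖s k i - branch f p δ i x‖ ^ 2) < 1 / ((l : ℝ) + 1) := hk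
      change dG (f x) (ofPoints (s k)) + _ < _
      rw [hfx, dG_comm]
      linarith [dG_ofPoints_le (s k) fun i => branch f p δ i x]
    · rintro ⟨⟨h1, hb⟩, hx⟩
      refine ⟨hx, eq_of_dG_eq_zero (le_antisymm ?_ (dG_nonneg _ _)), hb⟩
      refine le_of_forall_pos_lt_add fun ε hε => ?_
      obtain ⟨l, hl⟩ := exists_nat_one_div_lt hε
      obtain ⟨k, hk⟩ := h1 l
      have hk : dG (f x) (ofPoints (s k)) +
        Real.sqrt (∑ i, ‖s k i - branch f p δ i x‖ ^ 2) < 1 / ((l : ℝ) + 1) := hk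
      linarith [dG_ofPoints_le (s k) fun i => branch f p δ i x,
        dG_triangle (f x) (ofPoints (s k)) (ofPoints fun i => branch f p δ i x)]
  rw [hset, ← nullMeasurableSet_restrict measurableSet_ball.nullMeasurableSet]
  refine NullMeasurableSet.inter (NullMeasurableSet.iInter fun l => NullMeasurableSet.iUnion
    fun k => ?_) (NullMeasurableSet.iInter fun i => ?_)
  · refine nullMeasurableSet_lt ((hf _).add ?_) aemeasurable_const
    refine Real.continuous_sqrt.measurable.comp_aemeasurable (Finset.aemeasurable_fun_sum _ fun i _ => ?_)
    exact ((hg i).const_sub _).norm.pow_const 2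
  · exact nullMeasurableSet_le ((hg i).sub_const _).norm aemeasurable_const

end Clusters

/-! ### Existence and uniqueness of the jet almost everywhere. -/

section Jets

variable {n m Q : ℕ}

theorem HasApproxJet.comp_perm {f : Eu n → AQ Q m} {x : Eu n}
    {J : Fin Q → Eu m × (Eu n →L[ℝ] Eu m)} (h : HasApproxJet f x J) (σ : Equiv.Perm (Fin Q)) :
    HasApproxJet f x (J ∘ σ) := by
  obtain ⟨h1, h2, A, hA, hxA, hAd, ho⟩ := h
  refine ⟨?_, fun i k => h2 (σ i) (σ k), A, hA, hxA, hAd, ?_⟩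
  · rw [h1]
    exact (ofPoints_comp_perm (fun i => (J i).1) σ).symm
  · refine ho.congr_left fun y => ?_
    exact congrArg (dG (f y)) (ofPoints_comp_perm (fun i => (J i).1 + (J i).2 (y - x)) σ).symm

theorem hasApproxFDerivAt_euclidean {g : Eu n → Eu m} {T : Eu n →L[ℝ] Eu m} {x : Eu n}
    (h : ∀ a, HasApproxFDerivAt (fun y => g y a) ((EuclideanSpace.proj a).comp T) x) :
    HasApproxFDerivAt g T x := by
  simp only [hasApproxFDerivAt_iff] at h ⊢
  rw [← Asymptotics.isLittleO_norm_left]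
  have h1 : (fun y => ∑ a, ‖g y a - g x a - (EuclideanSpace.proj a).comp T (y - x)‖)
      =o[densityFilter x] fun y => y - x :=
    Asymptotics.IsLittleO.fun_sum fun a _ => (h a).norm_left
  refine (Asymptotics.IsBigO.of_bound 1 (Eventually.of_forall fun y => ?_)).trans_isLittleO h1
  rw [norm_norm, one_mul, EuclideanSpace.norm_eq, Real.norm_of_nonneg (by positivity)]
  refine (Real.sqrt_le_sqrt (Finset.sum_sq_le_sq_sum_of_nonneg fun a _ => norm_nonneg _)).trans ?_
  rw [Real.sqrt_sq (by positivity)]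
  simp

/-- Existence of the jet at density points of a piece. -/
theorem hasApproxJet_branch {f : Eu n → AQ Q m} {p : Fin Q → Eu m} {δ : ℝ} (hδ : 0 < δ)
    (hp : Separated p δ) {x : Eu n} (hx : x ∈ piece f p δ) (hd : piece f p δ ∈ densityFilter x)
    {L : Fin Q → Eu n →L[ℝ] Eu m} (hL : ∀ i, HasApproxFDerivAt (branch f p δ i) (L i) x) :
    HasApproxJet f x fun i => (branch f p δ i x, L i) := by
  refine ⟨hx.2.1, fun i k hik => ?_, exists_hasDensityOne_isLittleO ?_ ?_⟩
  · have h1 := hL k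
    rw [← branch_congr f (eq_of_branch_eq hδ hp hx hik) δ] at h1
    -- Branches that meet at a point of the piece have the same centre, so they are the same
    -- function and have the same differential.
    exact (hL i).unique h1
  · simp only [sub_self, map_zero, add_zero]
    rw [← hx.2.1, dG_self]
  · rw [Asymptotics.isLittleO_norm_right]
    have h1 : (fun y => ∑ i, ‖branch f p δ i y - branch f p δ i x - L i (y - x)‖)
        =o[densityFilter x] fun y => y - x :=
      Asymptotics.IsLittleO.fun_sum fun i _ => (hasApproxFDerivAt_iff.1 (hL i)).norm_left
    refine (Asymptotics.IsBigO.of_bound 1 ?_).trans_isLittleO h1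
    filter_upwards [hd] with y hy
    rw [Real.norm_of_nonneg (dG_nonneg _ _), Real.norm_of_nonneg (by positivity), one_mul, hy.2.1]
    refine (dG_ofPoints_le _ _).trans ?_
    refine (Real.sqrt_le_sqrt
      (Finset.sum_sq_le_sq_sum_of_nonneg fun i _ => norm_nonneg _)).trans ?_
    rw [Real.sqrt_sq (by positivity)]
    simp only [sub_sub, le_refl]

theorem densityFilter_le_nhdsWithin {x : Eu n} {A : Set (Eu n)} (hA : MeasurableSet A)
    (hd : HasDensityOne A x) : densityFilter x ≤ 𝓝[A] x :=
  le_inf (densityFilter_le_nhds x) (le_principal_iff.2 ((hasDensityOne_iff hA x).1 hd))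

/-- The difference of squares is a bounded sum times a difference, and the difference is at most the
distance of `f y` to its affine approximation, by the triangle inequality. -/
theorem dG_sq_sub_isLittleO {f : Eu n → AQ Q m} {x : Eu n}
    {J : Fin Q → Eu m × (Eu n →L[ℝ] Eu m)} (h : HasApproxJet f x J) (T : AQ Q m) :
    (fun y => dG (f y) T ^ 2 - dG (ofPoints fun i => (J i).1 + (J i).2 (y - x)) T ^ 2)
      =o[densityFilter x] fun y => y - x := by
  obtain ⟨h1, -, A, hA, hxA, hAd, ho⟩ := h
  have ho' := (ho.mono (densityFilter_le_nhdsWithin hA hAd))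
  rw [Asymptotics.isLittleO_norm_right] at ho'
  have hdiff : (fun y => dG (f y) T - dG (ofPoints fun i => (J i).1 + (J i).2 (y - x)) T)
      =o[densityFilter x] fun y => y - x := by
    refine (Asymptotics.IsBigO.of_bound 1 (Eventually.of_forall fun y => ?_)).trans_isLittleO ho'
    rw [one_mul, Real.norm_of_nonneg (dG_nonneg _ _)]
    exact abs_dG_sub_dG_le _ _ _
  have hsum : (fun y => dG (f y) T + dG (ofPoints fun i => (J i).1 + (J i).2 (y - x)) T)
      =O[densityFilter x] fun _ => (1 : ℝ) := by
    have hcont : Continuous fun y => Real.sqrt (∑ i, ‖(J i).2 (y - x)‖ ^ 2) := by fun_prop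
    have hnear : ∀ᶠ y in densityFilter x, Real.sqrt (∑ i, ‖(J i).2 (y - x)‖ ^ 2) < 1 := by
      refine densityFilter_le_nhds x ?_
      exact hcont.continuousAt.eventually_lt continuousAt_const (by simp)
    have hnear2 : ∀ᶠ y in densityFilter x, ‖y - x‖ < 1 := by
      refine densityFilter_le_nhds x ?_
      have : Continuous fun y : Eu n => ‖y - x‖ := by fun_prop
      exact this.continuousAt.eventually_lt continuousAt_const (by simp)
    refine Asymptotics.IsBigO.of_bound (2 * (1 + dG (f x) T) + 1) ?_
    filter_upwards [hnear, hnear2, hdiff.def one_pos] with y hy hy2 hy3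
    have h4 : dG (ofPoints fun i => (J i).1 + (J i).2 (y - x)) T ≤ 1 + dG (f x) T := by
      refine (dG_triangle _ (f x) _).trans ?_
      gcongr
      rw [h1]
      refine (dG_ofPoints_le _ _).trans ?_
      simpa using hy.le
    rw [one_mul] at hy3
    have h5 := (abs_le.1 (hy3.trans hy2.le)).2
    have h6 : 0 ≤ dG (f y) T + dG (ofPoints fun i => (J i).1 + (J i).2 (y - x)) T :=
      add_nonneg (dG_nonneg _ _) (dG_nonneg _ _)
    rw [Real.norm_of_nonneg h6, norm_one, mul_one]
    linarith
  have hmul := hsum.mul_isLittleO hdiff.norm_right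
  simp only [one_mul] at hmul
  rw [Asymptotics.isLittleO_norm_right] at hmul
  exact hmul.congr_left fun y => by ring

/-- Uniqueness of the jet at the points of a piece where the branches are approximately
differentiable. -/
theorem HasApproxJet.snd_eq {f : Eu n → AQ Q m} {p : Fin Q → Eu m} {δ : ℝ} (hδ : 0 < δ)
    (hp : Separated p δ) {x : Eu n} (hx : x ∈ piece f p δ)
    {L : Fin Q → Eu n →L[ℝ] Eu m} (hL : ∀ i, HasApproxFDerivAt (branch f p δ i) (L i) x)
    {J : Fin Q → Eu m × (Eu n →L[ℝ] Eu m)} (hJ : HasApproxJet f x J)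
    (hJ1 : ∀ i, (J i).1 = branch f p δ i x) (i : Fin Q) : (J i).2 = L i := by
  refine HasApproxFDerivAt.unique (hasApproxFDerivAt_euclidean fun a => ?_) (hL i)
  have hconst : ∀ k, p k = p i → J k = J i := by
    intro k hk
    have h1 : (J k).1 = (J i).1 := by rw [hJ1, hJ1, branch_congr f hk]
    exact Prod.ext h1 (hJ.2.1 k i h1)
  -- The branches are within `δ` of the centres at `x`, hence the affine approximations are within
  -- `2δ` nearby. There `clusterMean` reads off the affine branch, and comparing with its value at
  -- `f y` shows that `(J i).2` is an approximate differential of the branch.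
  have hnear : ∀ᶠ y in densityFilter x, ∀ k, ‖(J k).1 + (J k).2 (y - x) - p k‖ ≤ 2 * δ := by
    refine densityFilter_le_nhds x (eventually_all.2 fun k => ?_)
    have hc : Continuous fun y => ‖(J k).1 + (J k).2 (y - x) - p k‖ := by fun_prop
    refine (hc.continuousAt.eventually_lt continuousAt_const ?_).mono fun y hy => hy.le
    simp only [sub_self, map_zero, add_zero, hJ1]
    linarith [hx.2.2 k]
  have hmean : ∀ᶠ y in densityFilter x,
      clusterMean p δ i a (ofPoints fun k => (J k).1 + (J k).2 (y - x)) =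
        branch f p δ i x a + (J i).2 (y - x) a := by
    filter_upwards [hnear] with y hy
    rw [clusterMean_ofPoints hδ hp hy i a fun k hk => by rw [hconst k hk], ← hJ1 i]
    rfl
  rw [hasApproxFDerivAt_iff]
  have h1 := dG_sq_sub_isLittleO hJ (ofPoints (clusterShift p δ i a))
  have h2 := dG_sq_sub_isLittleO hJ (ofPoints p)
  refine ((h1.sub h2).const_mul_left (-(2 * δ * (cluster p i).card)⁻¹)).congr' ?_
    EventuallyEq.rfl
  filter_upwards [hmean] with y hy
  have h3 : branch f p δ i y a = clusterMean p δ i a (f y) := rfl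
  have h4 : ((EuclideanSpace.proj a).comp (J i).2 : Eu n →L[ℝ] ℝ) (y - x) = (J i).2 (y - x) a := rfl
  have h5 : branch f p δ i y a - branch f p δ i x a -
      ((EuclideanSpace.proj a).comp (J i).2 : Eu n →L[ℝ] ℝ) (y - x) = clusterMean p δ i a (f y) -
        clusterMean p δ i a (ofPoints fun k => (J k).1 + (J k).2 (y - x)) := by
    rw [h3, h4, hy]
    ring
  rw [h5]
  unfold clusterMean
  ring

/-- The differential of the `a`-th coordinate of the `i`-th branch, where `v T` is the weak
gradient of `𝒢(f, T)`. -/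
def branchCoordDeriv (f : Eu n → AQ Q m) (v : AQ Q m → Fin n → Eu n → ℝ) (p : Fin Q → Eu m)
    (δ : ℝ) (i : Fin Q) (a : Fin m) (x : Eu n) : Eu n →L[ℝ] ℝ :=
  -((2 * δ * (cluster p i).card)⁻¹ •
    ((2 * dG (f x) (ofPoints (clusterShift p δ i a))) •
        gradMap (fun j => v (ofPoints (clusterShift p δ i a)) j x) -
      (2 * dG (f x) (ofPoints p)) • gradMap (fun j => v (ofPoints p) j x)))

/-- The differential of the `i`-th branch. -/
def branchDeriv (f : Eu n → AQ Q m) (v : AQ Q m → Fin n → Eu n → ℝ) (p : Fin Q → Eu m)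
    (δ : ℝ) (i : Fin Q) (x : Eu n) : Eu n →L[ℝ] Eu m :=
  ∑ a, (branchCoordDeriv f v p δ i a x).smulRight (stdVec a)

theorem branchDeriv_apply (f : Eu n → AQ Q m) (v : AQ Q m → Fin n → Eu n → ℝ) (p : Fin Q → Eu m)
    (δ : ℝ) (i : Fin Q) (x h : Eu n) (a : Fin m) :
    branchDeriv f v p δ i x h a = branchCoordDeriv f v p δ i a x h := by
  simp [branchDeriv, stdVec, Finset.sum_apply, Pi.single_apply]

theorem hasApproxFDerivAt_branch {f : Eu n → AQ Q m} {v : AQ Q m → Fin n → Eu n → ℝ}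
    {p : Fin Q → Eu m} {δ : ℝ} {x : Eu n} {i : Fin Q}
    (h0 : HasApproxFDerivAt (fun y => dG (f y) (ofPoints p))
      (gradMap fun j => v (ofPoints p) j x) x)
    (h1 : ∀ a, HasApproxFDerivAt (fun y => dG (f y) (ofPoints (clusterShift p δ i a)))
      (gradMap fun j => v (ofPoints (clusterShift p δ i a)) j x) x) :
    HasApproxFDerivAt (branch f p δ i) (branchDeriv f v p δ i x) x := by
  refine hasApproxFDerivAt_euclidean fun a => ?_
  have h2 : (EuclideanSpace.proj a).comp (branchDeriv f v p δ i x) =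
      branchCoordDeriv f v p δ i a x := by
    ext h
    exact branchDeriv_apply f v p δ i x h a
  rw [h2]
  have h3 := hasApproxFDerivAt_iff.1 (h1 a).sq
  have h4 := hasApproxFDerivAt_iff.1 h0.sq
  rw [hasApproxFDerivAt_iff]
  refine ((h3.sub h4).const_mul_left (-(2 * δ * (cluster p i).card)⁻¹)).congr_left fun y => ?_
  have h5 : ∀ y, branch f p δ i y a = clusterMean p δ i a (f y) := fun _ => rfl
  rw [h5, h5]
  simp only [clusterMean, branchCoordDeriv, neg_apply,
    smul_apply, sub_apply, smul_eq_mul]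
  ring

/-- Almost everywhere on a piece, the jet consists of the branches and their differentials. -/
theorem ae_jet_eq_branch {f : Eu n → AQ Q m} {v : AQ Q m → Fin n → Eu n → ℝ}
    (hf : ∀ T, AEMeasurable (fun x => dG (f x) T) (volume.restrict (Metric.ball 0 1)))
    (hv : ∀ T, ∀ᵐ x ∂volume.restrict (Metric.ball (0 : Eu n) 1),
      HasApproxFDerivAt (fun y => dG (f y) T) (gradMap fun j => v T j x) x)
    {p : Fin Q → Eu m} {δ : ℝ} (hδ : 0 < δ) (hp : Separated p δ) :
    ∀ᵐ x ∂volume.restrict (piece f p δ), piece f p δ ∈ densityFilter x ∧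
      (∀ i, HasApproxFDerivAt (branch f p δ i) (branchDeriv f v p δ i x) x) ∧
      HasApproxJet f x (jet f x) ∧
      ∃ σ : Equiv.Perm (Fin Q), ∀ i,
        jet f x (σ i) = (branch f p δ i x, branchDeriv f v p δ i x) := by
  have hnull := nullMeasurableSet_piece hf p δ
  have hres : volume.restrict (piece f p δ) ≤ volume.restrict (Metric.ball (0 : Eu n) 1) :=
    Measure.restrict_mono (piece_subset f p δ) le_rfl
  have h1 : ∀ᵐ x ∂volume.restrict (piece f p δ), ∀ i a,
      HasApproxFDerivAt (fun y => dG (f y) (ofPoints (clusterShift p δ i a)))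
        (gradMap fun j => v (ofPoints (clusterShift p δ i a)) j x) x :=
    ae_all_iff.2 fun i => ae_all_iff.2 fun a => ae_mono hres (hv _)
  filter_upwards [ae_mem_densityFilter hnull, h1, ae_mono hres (hv (ofPoints p)),
    ae_restrict_mem₀ hnull] with x hd hx1 hx0 hx
  have hL : ∀ i, HasApproxFDerivAt (branch f p δ i) (branchDeriv f v p δ i x) x := fun i =>
    hasApproxFDerivAt_branch hx0 (hx1 i)
  have hJ : HasApproxJet f x (jet f x) := by
    have hex : ∃ J, HasApproxJet f x J := ⟨_, hasApproxJet_branch hδ hp hx hd hL⟩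
    unfold jet
    rw [dif_pos hex]
    exact hex.choose_spec
  refine ⟨hd, hL, hJ, ?_⟩
  have h2 : ofPoints (fun i => branch f p δ i x) = ofPoints fun i => (jet f x i).1 := by
    rw [← hx.2.1, hJ.1]
  obtain ⟨σ, hσ⟩ := (ofPoints_eq_iff _ _).1 h2
  have h3 : ∀ i, (jet f x (σ i)).1 = branch f p δ i x := fun i => (congrFun hσ i).symm
  refine ⟨σ, fun i => Prod.ext (h3 i) ?_⟩
  exact (hJ.comp_perm σ).snd_eq hδ hp hx hL h3 i

end Jets

/-! ### Integrability of the energy and the gradient of the modulus. -/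

section Energy

variable {n m Q : ℕ}

/-- The indices of the countably many pieces that cover the ball. -/
abbrev PieceIndex (Q m : ℕ) : Type :=
  {c : (Fin Q → ℕ) × ℕ // Separated (fun i => TopologicalSpace.denseSeq (Eu m) (c.1 i))
    (1 / ((c.2 : ℝ) + 1))}

/-- The centres of a piece. -/
def PieceIndex.center (c : PieceIndex Q m) (i : Fin Q) : Eu m :=
  TopologicalSpace.denseSeq (Eu m) (c.1.1 i)

/-- The radius of a piece. -/
def PieceIndex.radius (c : PieceIndex Q m) : ℝ := 1 / ((c.1.2 : ℝ) + 1)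

theorem PieceIndex.radius_pos (c : PieceIndex Q m) : 0 < c.radius := by
  unfold PieceIndex.radius
  positivity

theorem PieceIndex.separated (c : PieceIndex Q m) : Separated c.center c.radius := c.2

theorem iUnion_piece (f : Eu n → AQ Q m) :
    ⋃ c : PieceIndex Q m, piece f c.center c.radius = Metric.ball 0 1 := by
  refine Subset.antisymm (iUnion_subset fun c => piece_subset _ _ _) fun x hx => ?_
  obtain ⟨c, N, hs, hm⟩ := exists_mem_piece f hx
  exact mem_iUnion.2 ⟨⟨(c, N), hs⟩, hm⟩

theorem ae_ball_iff_pieces (f : Eu n → AQ Q m) {P : Eu n → Prop} :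
    (∀ᵐ x ∂volume.restrict (Metric.ball (0 : Eu n) 1), P x) ↔
      ∀ c : PieceIndex Q m, ∀ᵐ x ∂volume.restrict (piece f c.center c.radius), P x := by
  rw [← iUnion_piece f, ae_restrict_iUnion_iff]

theorem norm_sq_eq_sum_sq (y : Eu m) : ‖y‖ ^ 2 = ∑ a, y a ^ 2 := by
  rw [EuclideanSpace.norm_sq_eq]
  simp

theorem dG_ofPoints_le_of_norm_le {s t : Fin Q → Eu m} {r : ℝ}
    (h : ∀ i, ‖s i - t i‖ ≤ r) : dG (ofPoints s) (ofPoints t) ≤ Q * r := by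
  refine (dG_ofPoints_le s t).trans ?_
  refine (Real.sqrt_le_sqrt (Finset.sum_sq_le_sq_sum_of_nonneg fun i _ => norm_nonneg _)).trans ?_
  rw [Real.sqrt_sq (by positivity)]
  refine (Finset.sum_le_sum fun i _ => h i).trans ?_
  simp

/-- On the piece the two distances are at most `Q δ` and `2 Q δ`, which cancels the factor `1 / δ`
in the formula for the branch. The bound is therefore the same on all pieces, which makes the energy
integrable over their countable union. -/
theorem abs_branchCoordDeriv_le {f : Eu n → AQ Q m} {v : AQ Q m → Fin n → Eu n → ℝ}
    {p : Fin Q → Eu m} {δ : ℝ} (hδ : 0 < δ) {x : Eu n} (hx : x ∈ piece f p δ) {i : Fin Q}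
    {a : Fin m} {j : Fin n} {b : ℝ} (h0 : |v (ofPoints p) j x| ≤ b)
    (h1 : |v (ofPoints (clusterShift p δ i a)) j x| ≤ b) :
    |branchCoordDeriv f v p δ i a x (stdVec j)| ≤ 3 * Q * b := by
  have hκ : 1 ≤ ((cluster p i).card : ℝ) := by
    have := cluster_card_pos p i
    exact_mod_cast this
  have hb : 0 ≤ b := (abs_nonneg _).trans h0
  have hu0 : dG (f x) (ofPoints p) ≤ Q * δ := by
    rw [hx.2.1]
    exact dG_ofPoints_le_of_norm_le hx.2.2
  have hu1 : dG (f x) (ofPoints (clusterShift p δ i a)) ≤ Q * (2 * δ) := by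
    rw [hx.2.1]
    refine dG_ofPoints_le_of_norm_le fun k => ?_
    calc ‖branch f p δ k x - clusterShift p δ i a k‖
        = ‖(branch f p δ k x - p k) - (clusterShift p δ i a k - p k)‖ := by congr 1; abel
      _ ≤ _ := norm_sub_le _ _
      _ ≤ 2 * δ := by linarith [hx.2.2 k, norm_clusterShift_sub_le p hδ.le i a k]
  have hn0 := dG_nonneg (f x) (ofPoints p)
  have hn1 := dG_nonneg (f x) (ofPoints (clusterShift p δ i a))
  simp only [branchCoordDeriv, neg_apply, smul_apply, sub_apply, smul_eq_mul, gradMap_stdVec]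
  rw [abs_neg, abs_mul, abs_of_pos (by positivity), inv_mul_le_iff₀ (by positivity)]
  have h2 : |2 * dG (f x) (ofPoints (clusterShift p δ i a)) *
      v (ofPoints (clusterShift p δ i a)) j x| ≤ 2 * (Q * (2 * δ)) * b := by
    rw [abs_mul, abs_of_nonneg (by positivity)]
    gcongr
  have h3 : |2 * dG (f x) (ofPoints p) * v (ofPoints p) j x| ≤ 2 * (Q * δ) * b := by
    rw [abs_mul, abs_of_nonneg (by positivity)]
    gcongr
  refine (abs_sub _ _).trans ((add_le_add h2 h3).trans ?_)
  have h4 : 0 ≤ 6 * (Q * δ * b) := by positivity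
  nlinarith

/-- The entries of the matrix `∑ i, (Df_i)ᵀ Df_i`. -/
def energyForm (f : Eu n → AQ Q m) (j k : Fin n) (x : Eu n) : ℝ :=
  ∑ i, inner ℝ (sheetDeriv f i x (stdVec j)) (sheetDeriv f i x (stdVec k))

theorem energyForm_eq_of_perm {f : Eu n → AQ Q m} {x : Eu n} {σ : Equiv.Perm (Fin Q)}
    {g : Fin Q → Eu m} {L : Fin Q → Eu n →L[ℝ] Eu m} (h : ∀ i, jet f x (σ i) = (g i, L i))
    (j k : Fin n) : energyForm f j k x = ∑ i, inner ℝ (L i (stdVec j)) (L i (stdVec k)) := by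
  unfold energyForm sheetDeriv
  rw [← Equiv.sum_comp σ]
  simp only [h]

theorem hasApproxFDerivAt_sum_norm_sq {g : Fin Q → Eu n → Eu m} {L : Fin Q → Eu n →L[ℝ] Eu m}
    {x : Eu n} (h : ∀ i, HasApproxFDerivAt (g i) (L i) x) :
    HasApproxFDerivAt (fun y => ∑ i, ‖g i y‖ ^ 2)
      (∑ i, 2 • (innerSL ℝ (g i x)).comp (L i)) x := by
  refine HasFDerivAtFilter.fun_sum fun i _ => ?_
  have h1 : HasFDerivAt (fun y : Eu m => ‖y‖ ^ 2) (2 • innerSL ℝ (g i x)) (g i x) :=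
    (hasStrictFDerivAt_norm_sq (g i x)).hasFDerivAt
  have hc : HasFDerivAtFilter ((fun y : Eu m => ‖y‖ ^ 2) ∘ g i) _ (densityFilter x ×ˢ pure x) :=
    HasFDerivAtFilter.comp h1 (h i)
      (by
        refine Tendsto.prodMap ?_ (tendsto_pure_pure _ _)
        exact HasFDerivAtFilter.tendsto_nhds (densityFilter_le_nhds x) (h i))
  exact hc

/-- The bridge from the metric definition of `W^{1,2}` to the jets. Integrability comes from the
bound on the branch derivatives that is uniform over the pieces. The last identity holds because
`|f|²` has the approximate differential `2 |f| ∇|f|` as the square of a Sobolev function and `2 ∑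
⟨f_i, Df_i⟩` as a sum over branches. -/
theorem MemW12.integrableOn_energyForm_and_gradient {f : Eu n → AQ Q m} (hf : MemW12 (Metric.ball 0 1) f) :
    (∀ j k, IntegrableOn (energyForm f j k) (Metric.ball 0 1)) ∧
    MemLp (fun x => modulus (f x)) 2 (volume.restrict (Metric.ball 0 1)) ∧
    ∃ v : Fin n → Eu n → ℝ, (∀ j, MemLp (v j) 2 (volume.restrict (Metric.ball 0 1))) ∧
      (∀ j, IsWeakPartial (Metric.ball 0 1) j (fun x => modulus (f x)) (v j)) ∧
      ∀ᵐ x ∂volume.restrict (Metric.ball (0 : Eu n) 1),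
        modulus (f x) ^ 2 = ∑ i, ‖sheet f i x‖ ^ 2 ∧
        ∀ j, ∑ i, inner ℝ (sheet f i x) (sheetDeriv f i x (stdVec j)) = modulus (f x) * v j x := by
  obtain ⟨φ, hφ, hT⟩ := hf
  choose hu v hv hw hb using hT
  have hfin : IsFiniteMeasure (volume.restrict (Metric.ball (0 : Eu n) 1)) :=
    ⟨by simpa using measure_ball_lt_top⟩
  have hum : ∀ T, AEMeasurable (fun x => dG (f x) T) (volume.restrict (Metric.ball 0 1)) :=
    fun T => (hu T).aestronglyMeasurable.aemeasurable
  have hap : ∀ T, ∀ᵐ x ∂volume.restrict (Metric.ball (0 : Eu n) 1),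
      HasApproxFDerivAt (fun y => dG (f y) T) (gradMap fun j => v T j x) x := fun T =>
    ae_hasApproxFDerivAt ((hu T).integrable one_le_two)
      (fun j => (hv T j).integrable one_le_two) (hw T)
  have hjet := fun c : PieceIndex Q m => ae_jet_eq_branch hum hap c.radius_pos c.separated
  have hres : ∀ c : PieceIndex Q m, volume.restrict (piece f c.center c.radius) ≤
      volume.restrict (Metric.ball (0 : Eu n) 1) := fun c =>
    Measure.restrict_mono (piece_subset _ _ _) le_rfl
  have hcd : ∀ (c : PieceIndex Q m) i a j, AEMeasurable
      (fun x => branchCoordDeriv f v c.center c.radius i a x (stdVec j))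
      (volume.restrict (Metric.ball 0 1)) := by
    intro c i a j
    simp only [branchCoordDeriv, neg_apply, smul_apply, sub_apply, smul_eq_mul, gradMap_stdVec]
    exact (((((hum _).const_mul 2).mul (hv _ _).aestronglyMeasurable.aemeasurable).sub
      (((hum _).const_mul 2).mul (hv _ _).aestronglyMeasurable.aemeasurable)).const_mul _).neg
  have hinner : ∀ (c : PieceIndex Q m) i j k x,
      inner ℝ (branchDeriv f v c.center c.radius i x (stdVec j))
        (branchDeriv f v c.center c.radius i x (stdVec k)) =
      ∑ a, branchCoordDeriv f v c.center c.radius i a x (stdVec j) *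
        branchCoordDeriv f v c.center c.radius i a x (stdVec k) := by
    intro c i j k x
    rw [PiLp.inner_apply]
    refine Finset.sum_congr rfl fun a _ => ?_
    rw [branchDeriv_apply, branchDeriv_apply]
    simp [mul_comm]
  refine ⟨fun j k => ?_, hu _, v (Sym.replicate Q 0), hv _, hw _, ?_⟩
  · have hmeas : AEMeasurable (energyForm f j k) (volume.restrict (Metric.ball 0 1)) := by
      rw [← iUnion_piece f, aemeasurable_iUnion_iff]
      intro c
      have h1 : AEMeasurable (fun x => ∑ i, ∑ a,
          branchCoordDeriv f v c.center c.radius i a x (stdVec j) *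
            branchCoordDeriv f v c.center c.radius i a x (stdVec k))
          (volume.restrict (piece f c.center c.radius)) :=
        (Finset.aemeasurable_fun_sum _ fun i _ => Finset.aemeasurable_fun_sum _ fun a _ =>
          (hcd c i a j).mul (hcd c i a k)).mono_measure (hres c)
      refine h1.congr ?_
      filter_upwards [hjet c] with x hx
      obtain ⟨-, -, -, σ, hσ⟩ := hx
      rw [energyForm_eq_of_perm hσ]
      exact Finset.sum_congr rfl fun i _ => (hinner c i j k x).symm
    have hbound : ∀ᵐ x ∂volume.restrict (Metric.ball (0 : Eu n) 1), ‖energyForm f j k x‖ ≤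
        9 * Q ^ 3 * m * (φ j x ^ 2 + φ k x ^ 2) := by
      rw [ae_ball_iff_pieces f]
      intro c
      have hb' : ∀ᵐ x ∂volume.restrict (piece f c.center c.radius), ∀ l : Fin n, ∀ i a,
          |branchCoordDeriv f v c.center c.radius i a x (stdVec l)| ≤ 3 * Q * φ l x := by
        refine ae_all_iff.2 fun l => ae_all_iff.2 fun i => ae_all_iff.2 fun a => ?_
        filter_upwards [ae_mono (hres c) (hb (ofPoints c.center) l),
          ae_mono (hres c) (hb (ofPoints (clusterShift c.center c.radius i a)) l),
          ae_restrict_mem₀ (nullMeasurableSet_piece hum c.center c.radius)] with x h0 h1 hx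
        exact abs_branchCoordDeriv_le c.radius_pos hx h0 h1
      filter_upwards [hjet c, hb'] with x hx hxb
      obtain ⟨-, -, -, σ, hσ⟩ := hx
      rw [energyForm_eq_of_perm hσ]
      refine (norm_sum_le _ _).trans ?_
      have hterm : ∀ i : Fin Q, ‖inner ℝ (branchDeriv f v c.center c.radius i x (stdVec j))
          (branchDeriv f v c.center c.radius i x (stdVec k))‖ ≤
          9 * Q ^ 2 * m * (φ j x ^ 2 + φ k x ^ 2) := by
        intro i
        rw [hinner]
        refine (norm_sum_le _ _).trans ?_
        have h2 : ∀ a : Fin m, ‖branchCoordDeriv f v c.center c.radius i a x (stdVec j) *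
            branchCoordDeriv f v c.center c.radius i a x (stdVec k)‖ ≤
            9 * Q ^ 2 * (φ j x ^ 2 + φ k x ^ 2) := by
          intro a
          rw [norm_mul]
          have hj := hxb j i a
          have hk := hxb k i a
          have hj0 := (abs_nonneg _).trans hj
          have hk0 := (abs_nonneg _).trans hk
          calc _ ≤ (3 * Q * φ j x) * (3 * Q * φ k x) := by gcongr <;> assumption
            _ ≤ (3 * Q * φ j x) ^ 2 + (3 * Q * φ k x) ^ 2 := by
              nlinarith [sq_nonneg (3 * Q * φ j x - 3 * Q * φ k x), mul_nonneg hj0 hk0]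
            _ = _ := by ring
        refine (Finset.sum_le_sum fun a _ => h2 a).trans (le_of_eq ?_)
        simp only [Finset.sum_const, Finset.card_univ, Fintype.card_fin, nsmul_eq_mul]
        ring
      refine (Finset.sum_le_sum fun i _ => hterm i).trans (le_of_eq ?_)
      simp only [Finset.sum_const, Finset.card_univ, Fintype.card_fin, nsmul_eq_mul]
      ring
    have hi : Integrable (fun x => 9 * Q ^ 3 * m * (φ j x ^ 2 + φ k x ^ 2))
        (volume.restrict (Metric.ball 0 1)) :=
      ((hφ j).integrable_sq.add (hφ k).integrable_sq).const_mul _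
    exact hi.mono' hmeas.aestronglyMeasurable hbound
  · rw [ae_ball_iff_pieces f]
    intro c
    filter_upwards [hjet c, ae_mono (hres c) (hap (Sym.replicate Q 0)),
      ae_restrict_mem₀ (nullMeasurableSet_piece hum c.center c.radius)] with x hx hx0 hxp
    obtain ⟨hd, hL, hJ, σ, hσ⟩ := hx
    refine ⟨?_, fun j => ?_⟩
    · rw [hJ.1, modulus_ofPoints_sq]
      rfl
    · have h1 : HasApproxFDerivAt (fun y => dG (f y) (Sym.replicate Q 0) ^ 2)
          (∑ i, 2 • (innerSL ℝ (branch f c.center c.radius i x)).comp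
            (branchDeriv f v c.center c.radius i x)) x := by
        refine (hasApproxFDerivAt_sum_norm_sq hL).congr ?_ ?_
        · filter_upwards [hd] with y hy
          rw [← modulus_ofPoints_sq fun i => branch f c.center c.radius i y, ← hy.2.1]
          rfl
        · rw [← modulus_ofPoints_sq fun i => branch f c.center c.radius i x, ← hxp.2.1]
          rfl
      have h2 := congrArg (fun T : Eu n →L[ℝ] ℝ => T (stdVec j)) (h1.unique hx0.sq)
      simp only [smul_apply, smul_eq_mul, gradMap_stdVec] at h2
      have h3 : ∑ i, inner ℝ (sheet f i x) (sheetDeriv f i x (stdVec j)) =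
          ∑ i, inner ℝ (branch f c.center c.radius i x)
            (branchDeriv f v c.center c.radius i x (stdVec j)) := by
        unfold sheet sheetDeriv
        rw [← Equiv.sum_comp σ]
        simp only [hσ]
      rw [h3]
      have h4 : (∑ i, 2 • (innerSL ℝ (branch f c.center c.radius i x)).comp
          (branchDeriv f v c.center c.radius i x)) (stdVec j) =
          2 * ∑ i, inner ℝ (branch f c.center c.radius i x)
            (branchDeriv f v c.center c.radius i x (stdVec j)) := by
        rw [sum_apply, Finset.mul_sum]
        refine Finset.sum_congr rfl fun i _ => ?_
        simp
      rw [h4] at h2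
      unfold modulus
      linarith

end Energy

/-! ### Differential inequalities for the frequency. -/

section Frequency

/-- A nonnegative nondecreasing function `M` whose frequency `G / M` is nondecreasing cannot vanish
to infinite order at `0`, unless it is zero. -/
theorem eq_zero_of_frequency {d : ℝ} {M G D R : ℝ → ℝ}
    (hM : ∀ s ∈ Ioo (0 : ℝ) 1, HasDerivAt M ((G s + d * M s) / (2 * s)) s)
    (hG : ∀ s ∈ Ioo (0 : ℝ) 1, HasDerivAt G (D s) s)
    (hD : ∀ s ∈ Ioo (0 : ℝ) 1, 2 * s * D s = 4 * R s + d * G s)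
    (hCS : ∀ s ∈ Ioo (0 : ℝ) 1, G s ^ 2 ≤ 4 * R s * M s)
    (hM0 : ∀ s, 0 ≤ M s)
    (hvan : ∀ k : ℕ, ∀ ε > 0, ∃ᶠ s in 𝓝[>] (0 : ℝ), M s < ε * s ^ k) :
    ∀ s ∈ Ioo (0 : ℝ) 1, M s = 0 := by
  intro b hb
  by_contra hMb
  have hMb : 0 < M b := lt_of_le_of_ne (hM0 b) (Ne.symm hMb)
  have hsub : ∀ {a : ℝ}, 0 ≤ a → Ioc a b ⊆ Ioo 0 1 := fun ha s hs =>
    ⟨ha.trans_lt hs.1, hs.2.trans_lt hb.2⟩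
  -- With `G / M ≤ G b / M b` on the left of `b`, the logarithmic derivative `(G / M + d) / (2 s)`
  -- of `M` is at most `k / s`.
  obtain ⟨k, hk⟩ := exists_nat_ge ((G b / M b + d) / 2)
  have hlow : ∀ a, 0 ≤ a → (∀ s ∈ Ioc a b, 0 < M s) →
      ∀ s ∈ Ioc a b, M b / b ^ k * s ^ k ≤ M s := by
    intro a ha hpos
    have hfreq : MonotoneOn (fun s => G s / M s) (Ioc a b) := by
      refine monotoneOn_of_deriv_nonneg (convex_Ioc a b) ?_ ?_ ?_
      · intro s hs
        have hs' := hsub ha hs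
        exact ((hG s hs').continuousAt.div (hM s hs').continuousAt
          (hpos s hs).ne').continuousWithinAt
      · intro s hs
        rw [interior_Ioc] at hs
        have hs1 := Ioo_subset_Ioc_self hs
        have hs' := hsub ha hs1
        exact ((hG s hs').div (hM s hs') (hpos s hs1).ne').differentiableAt.differentiableWithinAt
      · intro s hs
        rw [interior_Ioc] at hs
        have hs1 := Ioo_subset_Ioc_self hs
        have hs' := hsub ha hs1
        have h0 : 0 < s := hs'.1
        have hd : HasDerivAt (fun s => G s / M s) _ s := (hG s hs').div (hM s hs') (hpos s hs1).ne'
        rw [hd.deriv]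
        refine div_nonneg ?_ (by positivity)
        have h1 : D s = (4 * R s + d * G s) / (2 * s) := by
          rw [eq_div_iff (by positivity), ← hD s hs']
          ring
        -- In the numerator of `(G / M)'` the terms with `d` cancel and the Cauchy–Schwarz defect
        -- remains.
        have h2 : D s * M s - G s * ((G s + d * M s) / (2 * s)) =
            (4 * R s * M s - G s ^ 2) / (2 * s) := by
          rw [h1]
          ring
        rw [h2]
        exact div_nonneg (sub_nonneg.2 (hCS s hs')) (by positivity)
    have hanti : AntitoneOn (fun s => M s / s ^ k) (Ioc a b) := by
      refine antitoneOn_of_deriv_nonpos (convex_Ioc a b) ?_ ?_ ?_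
      · intro s hs
        have hs' := hsub ha hs
        exact ((hM s hs').continuousAt.div (continuousAt_id.pow k)
          (pow_pos hs'.1 k).ne').continuousWithinAt
      · intro s hs
        rw [interior_Ioc] at hs
        have hs' := hsub ha (Ioo_subset_Ioc_self hs)
        exact ((hM s hs').div (hasDerivAt_pow k s)
          (pow_pos hs'.1 k).ne').differentiableAt.differentiableWithinAt
      · intro s hs
        rw [interior_Ioc] at hs
        have hs1 := Ioo_subset_Ioc_self hs
        have hs' := hsub ha hs1
        have h0 : 0 < s := hs'.1
        have hd : HasDerivAt (fun s => M s / s ^ k) _ s :=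
          (hM s hs').div (hasDerivAt_pow k s) (pow_pos h0 k).ne'
        rw [hd.deriv]
        refine div_nonpos_of_nonpos_of_nonneg ?_ (by positivity)
        have h1 := hfreq hs1 (right_mem_Ioc.2 (hs.1.trans hs.2)) hs.2.le
        have hMs := hpos s hs1
        have h2 : G s ≤ G b / M b * M s := (div_le_iff₀ hMs).1 h1
        have h3 : (G s + d * M s) / (2 * s) ≤ k * M s / s := by
          rw [div_le_div_iff₀ (by positivity) h0]
          have h4 : G s + d * M s ≤ 2 * k * M s := by nlinarith
          nlinarith
        have h5 : M s * ((k : ℝ) * s ^ (k - 1)) = k * M s / s * s ^ k := by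
          rcases Nat.eq_zero_or_pos k with hk0 | hk0
          · simp [hk0]
          · obtain ⟨l, rfl⟩ := Nat.exists_eq_succ_of_ne_zero hk0.ne'
            simp only [Nat.succ_sub_one, pow_succ]
            field_simp
        rw [h5, ← sub_mul]
        exact mul_nonpos_of_nonpos_of_nonneg (sub_nonpos.2 h3) (by positivity)
    intro s hs
    have h1 := hanti hs (right_mem_Ioc.2 (hs.1.trans_le hs.2)) hs.2
    have h0 : 0 < s := (hsub ha hs).1
    exact (le_div_iff₀ (by positivity)).1 h1
  have hpos : ∀ s ∈ Ioc 0 b, 0 < M s := by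
    by_contra! hcon
    obtain ⟨s₀, hs₀, hMs₀⟩ := hcon
    have hs₀b : s₀ ∈ Icc s₀ b := ⟨le_rfl, hs₀.2⟩
    have hcont : ContinuousOn M (Icc s₀ b) := fun s hs =>
      (hM s ⟨hs₀.1.trans_le hs.1, hs.2.trans_lt hb.2⟩).continuousAt.continuousWithinAt
    have hcpt : IsCompact (Icc s₀ b ∩ M ⁻¹' {0}) :=
      isCompact_Icc.of_isClosed_subset (hcont.preimage_isClosed_of_isClosed isClosed_Icc
        isClosed_singleton) inter_subset_left
    -- At the largest zero `a` before `b`, the lower bound valid on `(a, b]` passes to the limit and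
    -- gives `M a > 0`, a contradiction.
    obtain ⟨a, ⟨haI, haM⟩, hamax⟩ := hcpt.exists_isGreatest
      ⟨s₀, hs₀b, le_antisymm hMs₀ (hM0 _)⟩
    have haM : M a = 0 := haM
    have ha0 : 0 < a := hs₀.1.trans_le haI.1
    have hab : a < b := lt_of_le_of_ne haI.2 fun h => by rw [h] at haM; exact hMb.ne' haM
    have h1 := hlow a ha0.le fun s hs => by
      refine lt_of_le_of_ne (hM0 s) fun h => ?_
      exact absurd (hamax ⟨⟨haI.1.trans hs.1.le, hs.2⟩, h.symm⟩) (not_le.2 hs.1)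
    have hcw : Tendsto M (𝓝[>] a) (𝓝 (M a)) :=
      (hM a ⟨ha0, hab.trans hb.2⟩).continuousAt.continuousWithinAt
    have hcp : Tendsto (fun s => M b / b ^ k * s ^ k) (𝓝[>] a) (𝓝 (M b / b ^ k * a ^ k)) :=
      ((continuous_const.mul (continuous_pow k)).tendsto a).mono_left nhdsWithin_le_nhds
    have h2 : M b / b ^ k * a ^ k ≤ M a := by
      refine le_of_tendsto_of_tendsto hcp hcw ?_
      filter_upwards [Ioc_mem_nhdsGT hab] with s hs using h1 s hs
    have h3 : 0 < M b / b ^ k * a ^ k := by have := hb.1; positivity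
    linarith
  have hfin := hlow 0 le_rfl hpos
  have hc : 0 < M b / b ^ k := div_pos hMb (pow_pos hb.1 k)
  obtain ⟨s, hs, hs2⟩ := ((hvan k _ hc).and_eventually (Ioc_mem_nhdsGT hb.1)).exists
  linarith [hfin s hs2]

end Frequency

/-! ### Radial integrals as functions of the squared radius. -/

section Radial

variable {n : ℕ}

/-- The integral of `h` over `{‖x‖² < s}`. -/
def radialIntegral (h : Eu n → ℝ) (s : ℝ) : ℝ := ∫ x in {x : Eu n | ‖x‖ ^ 2 < s}, h x

/-- The integral of `(s - ‖x‖²)₊ h`. -/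
def radialPotential (h : Eu n → ℝ) (s : ℝ) : ℝ :=
  ∫ x in Metric.ball (0 : Eu n) 1, max (s - ‖x‖ ^ 2) 0 * h x

theorem measurableSet_sublevel (s : ℝ) : MeasurableSet {x : Eu n | ‖x‖ ^ 2 < s} :=
  measurableSet_lt (by fun_prop) measurable_const

theorem sublevel_subset_ball {s : ℝ} (hs : s ≤ 1) :
    {x : Eu n | ‖x‖ ^ 2 < s} ⊆ Metric.ball 0 1 := by
  intro x hx
  have hx : ‖x‖ ^ 2 < s := hx
  rw [mem_ball_zero_iff]
  nlinarith [norm_nonneg x]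

theorem radialIntegral_eq_ball {s : ℝ} (hs : s ≤ 1) (h : Eu n → ℝ) :
    radialIntegral h s = ∫ x in Metric.ball (0 : Eu n) 1,
      {x : Eu n | ‖x‖ ^ 2 < s}.indicator 1 x * h x := by
  unfold radialIntegral
  rw [← inter_eq_right.2 (sublevel_subset_ball (n := n) hs),
    ← setIntegral_indicator (measurableSet_sublevel s)]
  rw [inter_eq_right.2 (sublevel_subset_ball (n := n) hs)]
  refine integral_congr_ae (Eventually.of_forall fun x => ?_)
  by_cases hx : x ∈ {x : Eu n | ‖x‖ ^ 2 < s} <;> simp [hx]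

theorem integrableOn_sublevel {s : ℝ} (hs : s ≤ 1) {h : Eu n → ℝ}
    (hh : IntegrableOn h (Metric.ball 0 1)) : IntegrableOn h {x : Eu n | ‖x‖ ^ 2 < s} :=
  hh.mono_set (sublevel_subset_ball hs)

theorem integrableOn_norm_sq_mul {h : Eu n → ℝ} (hh : IntegrableOn h (Metric.ball 0 1)) :
    IntegrableOn (fun x => ‖x‖ ^ 2 * h x) (Metric.ball 0 1) := by
  refine Integrable.bdd_mul (c := 1) hh (by fun_prop) ?_
  filter_upwards [ae_restrict_mem measurableSet_ball] with x hx
  rw [mem_ball_zero_iff] at hx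
  rw [Real.norm_of_nonneg (by positivity)]
  nlinarith [norm_nonneg x]

/-- Write `‖x‖² = s - (s - ‖x‖²)`; on the sublevel set the bracket is its own positive part. -/
theorem radialIntegral_norm_sq_mul {s : ℝ} (hs : s ≤ 1) {h : Eu n → ℝ}
    (hh : IntegrableOn h (Metric.ball 0 1)) :
    radialIntegral (fun x => ‖x‖ ^ 2 * h x) s = s * radialIntegral h s - radialPotential h s := by
  have h1 : radialPotential h s = ∫ x in {x : Eu n | ‖x‖ ^ 2 < s}, (s - ‖x‖ ^ 2) * h x := by
    unfold radialPotential
    rw [← inter_eq_right.2 (sublevel_subset_ball (n := n) hs),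
      ← setIntegral_indicator (measurableSet_sublevel s)]
    refine integral_congr_ae (Eventually.of_forall fun x => ?_)
    by_cases hx : ‖x‖ ^ 2 < s
    · simp [hx, max_eq_left (sub_nonneg.2 hx.le)]
    · simp [hx, max_eq_right (sub_nonpos.2 (not_lt.1 hx))]
  rw [h1]
  simp only [sub_mul]
  rw [integral_sub ((integrableOn_sublevel hs hh).const_mul s)
    (integrableOn_sublevel hs (integrableOn_norm_sq_mul hh)), integral_const_mul]
  unfold radialIntegral
  ring

/-- The integrand is Lipschitz in `s` with the integrable constant `|h x|`, and differentiable at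
`s` off the null sphere `‖x‖² = s`. Hence the derivative exists at every `s`, not just almost every
one. -/
theorem hasDerivAt_radialPotential [Nontrivial (Eu n)] {s : ℝ} (hs : s ∈ Ioo (0 : ℝ) 1)
    {h : Eu n → ℝ} (hh : IntegrableOn h (Metric.ball 0 1)) :
    HasDerivAt (radialPotential h) (radialIntegral h s) s := by
  rw [radialIntegral_eq_ball hs.2.le]
  have hm : ∀ t : ℝ, AEStronglyMeasurable (fun x : Eu n => max (t - ‖x‖ ^ 2) 0)
      (volume.restrict (Metric.ball (0 : Eu n) 1)) := fun t =>
    Continuous.aestronglyMeasurable (by fun_prop)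
  refine (hasDerivAt_integral_of_dominated_loc_of_lip (μ := volume.restrict (Metric.ball (0 : Eu n) 1))
    (F := fun t x => max (t - ‖x‖ ^ 2) 0 * h x)
    (F' := fun x => {x : Eu n | ‖x‖ ^ 2 < s}.indicator 1 x * h x)
    (bound := fun x => |h x|) (s := univ) univ_mem ?_ ?_ ?_ ?_ ?_ ?_).2
  · exact Eventually.of_forall fun t => (hm t).mul hh.aestronglyMeasurable
  · refine Integrable.bdd_mul (c := 1) hh (hm s) (Eventually.of_forall fun x => ?_)
    rw [Real.norm_of_nonneg (le_max_right _ _)]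
    exact max_le (by nlinarith [norm_nonneg x, hs.2]) zero_le_one
  · exact ((measurable_one.indicator (measurableSet_sublevel s)).aestronglyMeasurable).mul
      hh.aestronglyMeasurable
  · refine Eventually.of_forall fun x => ?_
    have h1 : LipschitzWith 1 fun t : ℝ => max (t - ‖x‖ ^ 2) 0 :=
      (LipschitzWith.of_dist_le_mul fun a b => by simp [Real.dist_eq]).max_const 0
    refine (LipschitzWith.of_dist_le_mul fun a b => ?_).lipschitzOnWith
    rw [Real.dist_eq, ← sub_mul, abs_mul, mul_comm]
    have h2 := h1.dist_le_mul a b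
    rw [NNReal.coe_one, one_mul, Real.dist_eq] at h2
    simp only [Real.coe_nnabs, abs_abs]
    gcongr
  · exact hh.abs
  · have hnull : ∀ᵐ x ∂volume.restrict (Metric.ball (0 : Eu n) 1), ‖x‖ ^ 2 ≠ s := by
      refine ae_restrict_of_ae ?_
      have h0 := Measure.addHaar_sphere (volume : Measure (Eu n)) 0 (Real.sqrt s)
      refine measure_mono_null (fun x hx => ?_) h0
      have hx : ‖x‖ ^ 2 = s := by simpa using hx
      rw [mem_sphere_zero_iff_norm, ← hx, Real.sqrt_sq (norm_nonneg _)]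
    filter_upwards [hnull] with x hx
    refine HasDerivAt.mul_const ?_ _
    rcases lt_or_gt_of_ne hx with hlt | hgt
    · have h1 : HasDerivAt (fun t : ℝ => t - ‖x‖ ^ 2) 1 s := (hasDerivAt_id s).sub_const _
      have h2 : {x : Eu n | ‖x‖ ^ 2 < s}.indicator (1 : Eu n → ℝ) x = 1 :=
        indicator_of_mem (show x ∈ {x : Eu n | ‖x‖ ^ 2 < s} from hlt) _
      rw [h2]
      refine h1.congr_of_eventuallyEq ?_
      filter_upwards [Ioi_mem_nhds hlt] with t ht
      exact max_eq_left (sub_nonneg.2 (le_of_lt ht))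
    · have h2 : {x : Eu n | ‖x‖ ^ 2 < s}.indicator (1 : Eu n → ℝ) x = 0 :=
        indicator_of_notMem (show x ∉ {x : Eu n | ‖x‖ ^ 2 < s} from not_lt.2 hgt.le) _
      rw [h2]
      refine (hasDerivAt_const s (0 : ℝ)).congr_of_eventuallyEq ?_
      filter_upwards [Iio_mem_nhds hgt] with t ht
      exact max_eq_right (sub_nonpos.2 (le_of_lt ht))

/-- A smooth primitive of a smooth approximation of the indicator function of `(-∞, s)`. -/
def cutoffPrimitive (s : ℝ) (k : ℕ) (t : ℝ) : ℝ :=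
  -∫ τ in s..t, Real.smoothTransition (k * (s - τ))

theorem hasDerivAt_cutoffPrimitive (s : ℝ) (k : ℕ) (t : ℝ) :
    HasDerivAt (cutoffPrimitive s k) (-Real.smoothTransition (k * (s - t))) t := by
  have hc : Continuous fun τ : ℝ => Real.smoothTransition (k * (s - τ)) :=
    Real.smoothTransition.continuous.comp (by fun_prop)
  exact (intervalIntegral.integral_hasDerivAt_right (hc.intervalIntegrable _ _)
    (hc.stronglyMeasurableAtFilter _ _) hc.continuousAt).neg

theorem contDiff_cutoffPrimitive (s : ℝ) (k : ℕ) : ContDiff ℝ ∞ (cutoffPrimitive s k) := by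
  rw [contDiff_infty_iff_deriv]
  refine ⟨fun t => (hasDerivAt_cutoffPrimitive s k t).differentiableAt, ?_⟩
  have : deriv (cutoffPrimitive s k) = fun t => -Real.smoothTransition (k * (s - t)) :=
    funext fun t => (hasDerivAt_cutoffPrimitive s k t).deriv
  rw [this]
  exact (Real.smoothTransition.contDiff.comp (by fun_prop)).neg

theorem cutoffPrimitive_of_ge {s t : ℝ} (k : ℕ) (h : s ≤ t) : cutoffPrimitive s k t = 0 := by
  unfold cutoffPrimitive
  rw [intervalIntegral.integral_congr (g := fun _ => 0)]
  · simp
  · intro τ hτ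
    rw [uIcc_of_le h] at hτ
    exact Real.smoothTransition.zero_of_nonpos
      (mul_nonpos_of_nonneg_of_nonpos (by positivity) (sub_nonpos.2 hτ.1))

theorem tendsto_smoothTransition_mul (s t : ℝ) :
    Tendsto (fun k : ℕ => Real.smoothTransition (k * (s - t))) atTop
      (𝓝 ((Iio s).indicator 1 t)) := by
  by_cases h : t < s
  · rw [indicator_of_mem (show t ∈ Iio s from h)]
    refine tendsto_const_nhds.congr' ?_
    have h1 : Tendsto (fun k : ℕ => (k : ℝ) * (s - t)) atTop atTop :=
      tendsto_natCast_atTop_atTop.atTop_mul_const (sub_pos.2 h)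
    filter_upwards [h1.eventually_ge_atTop 1] with k hk
    exact (Real.smoothTransition.one_of_one_le hk).symm
  · rw [indicator_of_notMem (show t ∉ Iio s from h)]
    refine tendsto_const_nhds.congr fun k => ?_
    exact (Real.smoothTransition.zero_of_nonpos
      (mul_nonpos_of_nonneg_of_nonpos (by positivity) (sub_nonpos.2 (not_lt.1 h)))).symm

theorem abs_cutoffPrimitive_le (s : ℝ) (k : ℕ) (t : ℝ) : |cutoffPrimitive s k t| ≤ |t - s| := by
  unfold cutoffPrimitive
  rw [abs_neg, ← Real.norm_eq_abs]
  have := intervalIntegral.norm_integral_le_of_norm_le_const (a := s) (b := t) (C := 1)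
    (f := fun τ => Real.smoothTransition (k * (s - τ))) fun τ _ => by
      rw [Real.norm_of_nonneg (Real.smoothTransition.nonneg _)]
      exact Real.smoothTransition.le_one _
  simpa using this

theorem tendsto_cutoffPrimitive (s t : ℝ) :
    Tendsto (fun k : ℕ => cutoffPrimitive s k t) atTop (𝓝 (max (s - t) 0)) := by
  by_cases h : t < s
  · have h1 : Tendsto (fun k : ℕ => ∫ τ in s..t, Real.smoothTransition (k * (s - τ))) atTop
        (𝓝 (∫ τ in s..t, (Iio s).indicator 1 τ)) := by
      refine intervalIntegral.tendsto_integral_filter_of_dominated_convergence (fun _ => 1)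
        ?_ ?_ (intervalIntegrable_const) ?_
      · exact Eventually.of_forall fun k =>
          (Real.smoothTransition.continuous.comp (by fun_prop)).aestronglyMeasurable
      · refine Eventually.of_forall fun k => Eventually.of_forall fun τ _ => ?_
        rw [Real.norm_of_nonneg (Real.smoothTransition.nonneg _)]
        exact Real.smoothTransition.le_one _
      · exact Eventually.of_forall fun τ _ => tendsto_smoothTransition_mul s τ
    have h2 : ∫ τ in s..t, (Iio s).indicator (1 : ℝ → ℝ) τ = t - s := by
      rw [intervalIntegral.integral_symm, intervalIntegral.integral_of_le h.le,
        integral_Ioc_eq_integral_Ioo, setIntegral_congr_fun (g := fun _ => (1 : ℝ))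
          measurableSet_Ioo fun τ hτ => indicator_of_mem (show τ ∈ Iio s from hτ.2) _]
      simp [h.le]
    rw [h2] at h1
    rw [max_eq_left (sub_nonneg.2 h.le), ← neg_sub]
    exact h1.neg
  · rw [max_eq_right (sub_nonpos.2 (not_lt.1 h))]
    exact tendsto_const_nhds.congr fun k => (cutoffPrimitive_of_ge k (not_lt.1 h)).symm

/-- If `∫ ζ'(‖x‖²) h₁ = - ∫ ζ(‖x‖²) h₂` for all smooth `ζ` that vanish on `[s, ∞)`, then the same
holds for `ζ(t) = (s - t)₊`. -/
theorem radialIntegral_eq_radialPotential {s : ℝ} (hs : s ∈ Ioo (0 : ℝ) 1) {h₁ h₂ : Eu n → ℝ}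
    (hh₁ : IntegrableOn h₁ (Metric.ball 0 1)) (hh₂ : IntegrableOn h₂ (Metric.ball 0 1))
    (h : ∀ ζ : ℝ → ℝ, ContDiff ℝ ∞ ζ → (∀ t, s ≤ t → ζ t = 0) →
      ∫ x in Metric.ball (0 : Eu n) 1, deriv ζ (‖x‖ ^ 2) * h₁ x =
        -∫ x in Metric.ball (0 : Eu n) 1, ζ (‖x‖ ^ 2) * h₂ x) :
    radialIntegral h₁ s = radialPotential h₂ s := by
  -- For `ζ = cutoffPrimitive s k`, as `k → ∞`, `-ζ'` tends to the indicator of `(-∞, s)` and `ζ` to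
  -- `(s - t)₊`. Both are bounded by `1` on `[0, 1]`, so dominated convergence applies on either
  -- side.
  have hk := fun k => h (cutoffPrimitive s k) (contDiff_cutoffPrimitive s k)
    fun t ht => cutoffPrimitive_of_ge k ht
  simp only [fun k t => (hasDerivAt_cutoffPrimitive s k t).deriv, neg_mul, integral_neg,
    neg_inj] at hk
  have hl : Tendsto (fun k : ℕ => ∫ x in Metric.ball (0 : Eu n) 1,
      Real.smoothTransition (k * (s - ‖x‖ ^ 2)) * h₁ x) atTop (𝓝 (radialIntegral h₁ s)) := by
    rw [radialIntegral_eq_ball hs.2.le]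
    refine tendsto_integral_of_dominated_convergence (fun x => ‖h₁ x‖) ?_ hh₁.norm ?_ ?_
    · intro k
      exact ((Real.smoothTransition.continuous.comp (by fun_prop)).aestronglyMeasurable).mul
        hh₁.aestronglyMeasurable
    · intro k
      refine Eventually.of_forall fun x => ?_
      rw [norm_mul, Real.norm_of_nonneg (Real.smoothTransition.nonneg _)]
      exact mul_le_of_le_one_left (norm_nonneg _) (Real.smoothTransition.le_one _)
    · exact Eventually.of_forall fun x =>
        (tendsto_smoothTransition_mul s (‖x‖ ^ 2)).mul_const _
  have hr : Tendsto (fun k : ℕ => ∫ x in Metric.ball (0 : Eu n) 1,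
      cutoffPrimitive s k (‖x‖ ^ 2) * h₂ x) atTop (𝓝 (radialPotential h₂ s)) := by
    refine tendsto_integral_of_dominated_convergence (fun x => ‖h₂ x‖) ?_ hh₂.norm ?_ ?_
    · intro k
      exact (((contDiff_cutoffPrimitive s k).continuous.comp
        (by fun_prop)).aestronglyMeasurable).mul hh₂.aestronglyMeasurable
    · intro k
      filter_upwards [ae_restrict_mem measurableSet_ball] with x hx
      rw [mem_ball_zero_iff] at hx
      rw [norm_mul]
      refine mul_le_of_le_one_left (norm_nonneg _) ((abs_cutoffPrimitive_le s k _).trans ?_)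
      have h1 : ‖x‖ ^ 2 ≤ 1 := by nlinarith [norm_nonneg x]
      rw [abs_le]
      constructor <;> nlinarith [hs.1, hs.2, sq_nonneg ‖x‖]
    · exact Eventually.of_forall fun x => (tendsto_cutoffPrimitive s (‖x‖ ^ 2)).mul_const _
  exact tendsto_nhds_unique hl (hr.congr fun k => (hk k).symm)

end Radial

/-! ### Radial test fields in the variations. -/

section Variations

variable {n m Q : ℕ}

theorem inner_stdVec (x : Eu n) (j : Fin n) : inner ℝ x (stdVec j) = x j := by
  rw [stdVec, EuclideanSpace.inner_single_right]
  simp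

theorem contDiff_comp_norm_sq {ζ : ℝ → ℝ} (hζ : ContDiff ℝ ∞ ζ) :
    ContDiff ℝ ∞ fun x : Eu n => ζ (‖x‖ ^ 2) := hζ.comp (contDiff_norm_sq ℝ)

theorem fderiv_comp_norm_sq {ζ : ℝ → ℝ} (hζ : ContDiff ℝ ∞ ζ) (x h : Eu n) :
    fderiv ℝ (fun x : Eu n => ζ (‖x‖ ^ 2)) x h = 2 * deriv ζ (‖x‖ ^ 2) * inner ℝ x h := by
  have h1 : HasFDerivAt (fun y : Eu n => ‖y‖ ^ 2) (2 • innerSL ℝ x) x :=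
    (hasStrictFDerivAt_norm_sq x).hasFDerivAt
  have h2 := ((hζ.differentiable (by simp)) (‖x‖ ^ 2)).hasDerivAt.comp_hasFDerivAt x h1
  have h3 : HasFDerivAt (fun x : Eu n => ζ (‖x‖ ^ 2)) _ x := h2
  rw [h3.fderiv]
  simp
  ring

theorem tsupport_comp_norm_sq_subset {ζ : ℝ → ℝ} {s : ℝ}
    (hζs : ∀ t, s ≤ t → ζ t = 0) :
    tsupport (fun x : Eu n => ζ (‖x‖ ^ 2)) ⊆ Metric.closedBall 0 (Real.sqrt s) := by
  refine closure_minimal (fun x hx => ?_) Metric.isClosed_closedBall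
  rw [mem_closedBall_zero_iff]
  refine Real.le_sqrt_of_sq_le ?_
  by_contra! hlt
  exact hx (hζs _ hlt.le)

theorem closedBall_sqrt_subset {s : ℝ} (hs : s ∈ Ioo (0 : ℝ) 1) :
    Metric.closedBall (0 : Eu n) (Real.sqrt s) ⊆ Metric.ball 0 1 :=
  Metric.closedBall_subset_ball ((Real.sqrt_lt' one_pos).2 (by simpa using hs.2))

theorem hasCompactSupport_comp_norm_sq {ζ : ℝ → ℝ} {s : ℝ}
    (hζs : ∀ t, s ≤ t → ζ t = 0) : HasCompactSupport fun x : Eu n => ζ (‖x‖ ^ 2) :=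
  (isCompact_closedBall (0 : Eu n) (Real.sqrt s)).of_isClosed_subset (isClosed_tsupport _)
    (tsupport_comp_norm_sq_subset hζs)

theorem integrableOn_comp_norm_sq_mul {c : ℝ → ℝ} (hc : Continuous c) {h : Eu n → ℝ}
    (hh : IntegrableOn h (Metric.ball 0 1)) :
    IntegrableOn (fun x => c (‖x‖ ^ 2) * h x) (Metric.ball 0 1) := by
  obtain ⟨C, hC⟩ := (isCompact_Icc (a := (0 : ℝ)) (b := 1)).exists_bound_of_continuousOn
    hc.continuousOn
  refine Integrable.bdd_mul (c := C) hh (hc.comp (by fun_prop)).aestronglyMeasurable ?_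
  filter_upwards [ae_restrict_mem measurableSet_ball] with x hx
  rw [mem_ball_zero_iff] at hx
  exact hC _ ⟨by positivity, by nlinarith [norm_nonneg x]⟩

theorem integrableOn_coord_mul {h : Eu n → ℝ} (hh : IntegrableOn h (Metric.ball 0 1))
    (j : Fin n) : IntegrableOn (fun x => x j * h x) (Metric.ball 0 1) := by
  refine Integrable.bdd_mul (c := 1) hh (Continuous.aestronglyMeasurable (by fun_prop)) ?_
  filter_upwards [ae_restrict_mem measurableSet_ball] with x hx
  rw [mem_ball_zero_iff] at hx
  exact (PiLp.norm_apply_le x j).trans hx.le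

/-- The field is linear in `u`, so it and its `x`-derivative grow like `‖u‖` while the
`u`-derivative stays bounded: exactly the growth admitted by `IsOuterTest`. -/
theorem isOuterTest_radial {ζ : ℝ → ℝ} (hζ : ContDiff ℝ ∞ ζ) {s : ℝ} (hs : s ∈ Ioo (0 : ℝ) 1)
    (hζs : ∀ t, s ≤ t → ζ t = 0) :
    IsOuterTest (Metric.ball (0 : Eu n) 1) fun z : Eu n × Eu m => ζ (‖z.1‖ ^ 2) • z.2 := by
  have hη := contDiff_comp_norm_sq (n := n) hζ
  have hηc := hasCompactSupport_comp_norm_sq (n := n) hζs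
  obtain ⟨C, hC⟩ := hηc.exists_bound_of_continuous hη.continuous
  obtain ⟨C', hC'⟩ := (hηc.fderiv ℝ).exists_bound_of_continuous
    (hη.continuous_fderiv (by simp))
  have hC0 : 0 ≤ C := (norm_nonneg _).trans (hC 0)
  have hC0' : 0 ≤ C' := (norm_nonneg _).trans (hC' 0)
  refine ⟨(hη.comp contDiff_fst).smul contDiff_snd, ⟨_, isCompact_closedBall 0 (Real.sqrt s),
    closedBall_sqrt_subset hs, fun x hx u => ?_⟩, C + C', fun x u => ⟨?_, ?_⟩⟩
  · have h1 : ζ (‖x‖ ^ 2) = 0 := by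
      by_contra h
      exact hx (tsupport_comp_norm_sq_subset hζs (subset_tsupport _ h))
    simp [h1]
  · unfold derivU
    have h1 : fderiv ℝ (fun w : Eu m => ζ (‖x‖ ^ 2) • w) u =
        ζ (‖x‖ ^ 2) • ContinuousLinearMap.id ℝ (Eu m) :=
      ((hasFDerivAt_id u).const_smul (ζ (‖x‖ ^ 2))).fderiv
    dsimp only
    rw [h1, norm_smul]
    have h2 := ContinuousLinearMap.norm_id_le (𝕜 := ℝ) (E := Eu m)
    calc _ ≤ C * 1 := mul_le_mul (hC x) h2 (norm_nonneg _) hC0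
      _ ≤ _ := by linarith
  · unfold derivX
    have h1 : fderiv ℝ (fun y : Eu n => ζ (‖y‖ ^ 2) • u) x =
        (fderiv ℝ (fun y : Eu n => ζ (‖y‖ ^ 2)) x).smulRight u :=
      (((hη.differentiable (by simp)) x).hasFDerivAt.smul_const u).fderiv
    dsimp only
    rw [h1, ContinuousLinearMap.norm_smulRight_apply, norm_smul]
    have h2 := mul_le_mul_of_nonneg_right (hC x) (norm_nonneg u)
    have h3 := mul_le_mul_of_nonneg_right (hC' x) (norm_nonneg u)
    nlinarith [norm_nonneg u]

/-- The energy density `|Df|²`. -/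
def energyDensity (f : Eu n → AQ Q m) (x : Eu n) : ℝ := ∑ j, energyForm f j j x

/-- The radial energy density `∑ i, |Df_i(x) x|²`. -/
def radialEnergy (f : Eu n → AQ Q m) (x : Eu n) : ℝ := ∑ j, ∑ k, x j * (x k * energyForm f j k x)

theorem clm_apply_eq_sum (A : Eu n →L[ℝ] Eu m) (x : Eu n) : A x = ∑ j, x j • A (stdVec j) := by
  conv_lhs => rw [← sum_smul_stdVec x]
  simp only [map_sum, map_smul]

theorem radialEnergy_eq (f : Eu n → AQ Q m) (x : Eu n) :
    radialEnergy f x = ∑ i, ‖sheetDeriv f i x x‖ ^ 2 := by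
  have h1 : ∀ i, ‖sheetDeriv f i x x‖ ^ 2 = ∑ j, ∑ k, x j * (x k *
      inner ℝ (sheetDeriv f i x (stdVec j)) (sheetDeriv f i x (stdVec k))) := by
    intro i
    rw [← real_inner_self_eq_norm_sq, clm_apply_eq_sum (sheetDeriv f i x) x, sum_inner]
    refine Finset.sum_congr rfl fun j _ => ?_
    rw [inner_sum]
    refine Finset.sum_congr rfl fun k _ => ?_
    rw [real_inner_smul_left, real_inner_smul_right]
  simp only [h1, radialEnergy, energyForm, Finset.mul_sum]
  conv_rhs => rw [Finset.sum_comm]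
  exact Finset.sum_congr rfl fun j _ => Finset.sum_comm

/-- The outer variation along `ζ(‖x‖²) u`. -/
theorem DirStationary.outer_radial {f : Eu n → AQ Q m} (hf : DirStationary (Metric.ball 0 1) f)
    (hE : ∀ j k, IntegrableOn (energyForm f j k) (Metric.ball 0 1)) {g : Eu n → ℝ}
    (hgi : IntegrableOn g (Metric.ball 0 1))
    (hg : ∀ᵐ x ∂volume.restrict (Metric.ball (0 : Eu n) 1),
      g x = 2 * ∑ i, inner ℝ (sheet f i x) (sheetDeriv f i x x))
    {ζ : ℝ → ℝ} (hζ : ContDiff ℝ ∞ ζ) {s : ℝ} (hs : s ∈ Ioo (0 : ℝ) 1)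
    (hζs : ∀ t, s ≤ t → ζ t = 0) :
    ∫ x in Metric.ball (0 : Eu n) 1, deriv ζ (‖x‖ ^ 2) * g x =
      -∫ x in Metric.ball (0 : Eu n) 1, ζ (‖x‖ ^ 2) * energyDensity f x := by
  have h0 := hf.2.1 _ (isOuterTest_radial (n := n) (m := m) hζ hs hζs)
  have hEi : IntegrableOn (energyDensity f) (Metric.ball 0 1) :=
    integrable_finsetSum _ fun j _ => hE j j
  have hη := contDiff_comp_norm_sq (n := n) hζ
  rw [eq_neg_iff_add_eq_zero, ← integral_add
    (integrableOn_comp_norm_sq_mul (hζ.continuous_deriv (by simp)) hgi)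
    (integrableOn_comp_norm_sq_mul hζ.continuous hEi), ← h0]
  unfold outerVariation
  refine integral_congr_ae ?_
  filter_upwards [hg] with x hx
  have hX : ∀ u : Eu m, derivX (fun z : Eu n × Eu m => ζ (‖z.1‖ ^ 2) • z.2) x u =
      (fderiv ℝ (fun y : Eu n => ζ (‖y‖ ^ 2)) x).smulRight u := fun u =>
    (((hη.differentiable (by simp)) x).hasFDerivAt.smul_const u).fderiv
  have hU : ∀ u : Eu m, derivU (fun z : Eu n × Eu m => ζ (‖z.1‖ ^ 2) • z.2) x u =
      ζ (‖x‖ ^ 2) • ContinuousLinearMap.id ℝ (Eu m) := fun u =>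
    ((hasFDerivAt_id u).const_smul (ζ (‖x‖ ^ 2))).fderiv
  have h1 : ∀ i, QValued.hs (sheetDeriv f i x)
      (derivX (fun z : Eu n × Eu m => ζ (‖z.1‖ ^ 2) • z.2) x (sheet f i x)) =
      deriv ζ (‖x‖ ^ 2) * (2 * inner ℝ (sheet f i x) (sheetDeriv f i x x)) := by
    intro i
    rw [hX, QValued.hs, clm_apply_eq_sum (sheetDeriv f i x) x, inner_sum, Finset.mul_sum,
      Finset.mul_sum]
    refine Finset.sum_congr rfl fun j _ => ?_
    rw [ContinuousLinearMap.smulRight_apply, fderiv_comp_norm_sq hζ, inner_stdVec,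
      real_inner_smul_right, real_inner_smul_right, real_inner_comm]
    ring
  have h2 : ∀ i, QValued.hs (sheetDeriv f i x)
      ((derivU (fun z : Eu n × Eu m => ζ (‖z.1‖ ^ 2) • z.2) x (sheet f i x)).comp
        (sheetDeriv f i x)) = ζ (‖x‖ ^ 2) *
      ∑ j, inner ℝ (sheetDeriv f i x (stdVec j)) (sheetDeriv f i x (stdVec j)) := by
    intro i
    rw [hU, QValued.hs, Finset.mul_sum]
    refine Finset.sum_congr rfl fun j _ => ?_
    simp [real_inner_smul_right]
  simp only [h1, h2]
  rw [Finset.sum_add_distrib, ← Finset.mul_sum, ← Finset.mul_sum, ← Finset.mul_sum, hx]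
  congr 2
  unfold energyDensity energyForm
  exact Finset.sum_comm

/-- The inner variation along `ζ(‖x‖²) x`. -/
theorem DirStationary.inner_radial {f : Eu n → AQ Q m} (hf : DirStationary (Metric.ball 0 1) f)
    (hE : ∀ j k, IntegrableOn (energyForm f j k) (Metric.ball 0 1))
    {ζ : ℝ → ℝ} (hζ : ContDiff ℝ ∞ ζ) {s : ℝ} (hs : s ∈ Ioo (0 : ℝ) 1)
    (hζs : ∀ t, s ≤ t → ζ t = 0) :
    ∫ x in Metric.ball (0 : Eu n) 1, deriv ζ (‖x‖ ^ 2) *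
        (4 * radialEnergy f x - 2 * (‖x‖ ^ 2 * energyDensity f x)) =
      -∫ x in Metric.ball (0 : Eu n) 1, ζ (‖x‖ ^ 2) * ((2 - n) * energyDensity f x) := by
  have hη := contDiff_comp_norm_sq (n := n) hζ
  have hηc := hasCompactSupport_comp_norm_sq (n := n) hζs
  have hEi : IntegrableOn (energyDensity f) (Metric.ball 0 1) :=
    integrable_finsetSum _ fun j _ => hE j j
  have hRi : IntegrableOn (radialEnergy f) (Metric.ball 0 1) :=
    integrable_finsetSum _ fun j _ => integrable_finsetSum _ fun k _ =>
      integrableOn_coord_mul (integrableOn_coord_mul (hE j k) k) j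
  have hsub : tsupport (fun x : Eu n => ζ (‖x‖ ^ 2) • x) ⊆ tsupport fun x : Eu n => ζ (‖x‖ ^ 2) :=
    closure_mono fun x hx h => hx (by simp only [h, zero_smul])
  have h0 := hf.2.2 (fun x => ζ (‖x‖ ^ 2) • x) (hη.smul contDiff_id) hηc.smul_right
    (hsub.trans ((tsupport_comp_norm_sq_subset hζs).trans (closedBall_sqrt_subset hs)))
  -- Here `Dφ = ζ I + 2 ζ' x ⊗ x`. The identity part yields `ζ |Df|²`, the rank-one part `2 ζ' ∑
  -- |Df_i x|²`, and the trace `n ζ + 2 ζ' ‖x‖²`; the coefficient `2 - n` collects the terms with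
  -- `ζ`.
  have hd : ∀ x h : Eu n, fderiv ℝ (fun x : Eu n => ζ (‖x‖ ^ 2) • x) x h =
      ζ (‖x‖ ^ 2) • h + (2 * deriv ζ (‖x‖ ^ 2) * inner ℝ x h) • x := by
    intro x h
    have h1 : HasFDerivAt (fun x : Eu n => ζ (‖x‖ ^ 2) • x) _ x :=
      ((hη.differentiable (by simp)) x).hasFDerivAt.smul (hasFDerivAt_id x)
    rw [h1.fderiv, ← fderiv_comp_norm_sq hζ]
    simp
  have h1 : ∀ x, ∑ i, QValued.hs (sheetDeriv f i x)
      ((sheetDeriv f i x).comp (fderiv ℝ (fun x : Eu n => ζ (‖x‖ ^ 2) • x) x)) =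
      ζ (‖x‖ ^ 2) * energyDensity f x + 2 * (deriv ζ (‖x‖ ^ 2) * radialEnergy f x) := by
    intro x
    rw [radialEnergy_eq, energyDensity]
    simp only [energyForm]
    rw [Finset.sum_comm, Finset.mul_sum, Finset.mul_sum, Finset.mul_sum, ← Finset.sum_add_distrib]
    refine Finset.sum_congr rfl fun i _ => ?_
    have h2 : ‖sheetDeriv f i x x‖ ^ 2 =
        ∑ j, x j * inner ℝ (sheetDeriv f i x (stdVec j)) (sheetDeriv f i x x) := by
      rw [← real_inner_self_eq_norm_sq]
      conv_lhs => rw [clm_apply_eq_sum (sheetDeriv f i x) x, sum_inner,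
        ← clm_apply_eq_sum (sheetDeriv f i x) x]
      simp only [real_inner_smul_left]
    rw [h2, QValued.hs, Finset.mul_sum, Finset.mul_sum, Finset.mul_sum, ← Finset.sum_add_distrib]
    refine Finset.sum_congr rfl fun j _ => ?_
    rw [ContinuousLinearMap.comp_apply, hd, map_add, map_smul, map_smul, inner_add_right,
      real_inner_smul_right, real_inner_smul_right, inner_stdVec]
    ring
  have h2 : ∀ x : Eu n, divergence (fun x : Eu n => ζ (‖x‖ ^ 2) • x) x =
      n * ζ (‖x‖ ^ 2) + 2 * deriv ζ (‖x‖ ^ 2) * ‖x‖ ^ 2 := by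
    intro x
    unfold divergence
    simp only [hd, inner_stdVec]
    have h3 : ∀ j : Fin n, (ζ (‖x‖ ^ 2) • stdVec j + (2 * deriv ζ (‖x‖ ^ 2) * x j) • x) j =
        ζ (‖x‖ ^ 2) + 2 * deriv ζ (‖x‖ ^ 2) * x j ^ 2 := by
      intro j
      simp [stdVec]
      ring
    simp only [h3]
    rw [Finset.sum_add_distrib, ← Finset.mul_sum, norm_sq_eq_sum_sq]
    simp
  have h3 : ∀ x, ∑ i, QValued.hs (sheetDeriv f i x) (sheetDeriv f i x) = energyDensity f x := by
    intro x
    unfold energyDensity energyForm QValued.hs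
    exact Finset.sum_comm
  unfold innerVariation at h0
  simp only [h1, h2, h3] at h0
  have hc := hζ.continuous
  have hc' := hζ.continuous_deriv (by simp)
  have i1 := integrableOn_comp_norm_sq_mul hc hEi
  have i2 := integrableOn_comp_norm_sq_mul hc' hRi
  have i3 := integrableOn_comp_norm_sq_mul hc' (integrableOn_norm_sq_mul hEi)
  have e1 : ∫ x in Metric.ball (0 : Eu n) 1, (ζ (‖x‖ ^ 2) * energyDensity f x +
      2 * (deriv ζ (‖x‖ ^ 2) * radialEnergy f x)) =
      (∫ x in Metric.ball (0 : Eu n) 1, ζ (‖x‖ ^ 2) * energyDensity f x) +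
      2 * ∫ x in Metric.ball (0 : Eu n) 1, deriv ζ (‖x‖ ^ 2) * radialEnergy f x := by
    rw [integral_add i1 (i2.const_mul 2), integral_const_mul]
  have e2 : ∫ x in Metric.ball (0 : Eu n) 1, energyDensity f x *
      (n * ζ (‖x‖ ^ 2) + 2 * deriv ζ (‖x‖ ^ 2) * ‖x‖ ^ 2) =
      n * (∫ x in Metric.ball (0 : Eu n) 1, ζ (‖x‖ ^ 2) * energyDensity f x) +
      2 * ∫ x in Metric.ball (0 : Eu n) 1, deriv ζ (‖x‖ ^ 2) * (‖x‖ ^ 2 * energyDensity f x) := by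
    rw [← integral_const_mul, ← integral_const_mul, ← integral_add (i1.const_mul _)
      (i3.const_mul 2)]
    exact integral_congr_ae (Eventually.of_forall fun x => by ring)
  have e3 : ∫ x in Metric.ball (0 : Eu n) 1, deriv ζ (‖x‖ ^ 2) *
      (4 * radialEnergy f x - 2 * (‖x‖ ^ 2 * energyDensity f x)) =
      4 * (∫ x in Metric.ball (0 : Eu n) 1, deriv ζ (‖x‖ ^ 2) * radialEnergy f x) -
      2 * ∫ x in Metric.ball (0 : Eu n) 1, deriv ζ (‖x‖ ^ 2) * (‖x‖ ^ 2 * energyDensity f x) := by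
    rw [← integral_const_mul, ← integral_const_mul, ← integral_sub (i2.const_mul _)
      (i3.const_mul 2)]
    exact integral_congr_ae (Eventually.of_forall fun x => by ring)
  have e4 : ∫ x in Metric.ball (0 : Eu n) 1, ζ (‖x‖ ^ 2) * ((2 - n) * energyDensity f x) =
      (2 - n) * ∫ x in Metric.ball (0 : Eu n) 1, ζ (‖x‖ ^ 2) * energyDensity f x := by
    rw [← integral_const_mul]
    exact integral_congr_ae (Eventually.of_forall fun x => by ring)
  rw [e1, e2] at h0
  rw [e3, e4]
  linarith

/-- The weak gradient of `u²` tested with `ζ(‖x‖²) x`. -/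
theorem integral_radial_sq {u : Eu n → ℝ} {v : Fin n → Eu n → ℝ}
    (hu : MemLp u 2 (volume.restrict (Metric.ball 0 1)))
    (hv : ∀ j, MemLp (v j) 2 (volume.restrict (Metric.ball 0 1)))
    (hw : ∀ j, IsWeakPartial (Metric.ball 0 1) j u (v j))
    {ζ : ℝ → ℝ} (hζ : ContDiff ℝ ∞ ζ) {s : ℝ} (hs : s ∈ Ioo (0 : ℝ) 1)
    (hζs : ∀ t, s ≤ t → ζ t = 0) :
    ∫ x in Metric.ball (0 : Eu n) 1, deriv ζ (‖x‖ ^ 2) * (2 * (‖x‖ ^ 2 * u x ^ 2)) =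
      -∫ x in Metric.ball (0 : Eu n) 1,
        ζ (‖x‖ ^ 2) * ((∑ j, x j * (2 * u x * v j x)) + n * u x ^ 2) := by
  have hη := contDiff_comp_norm_sq (n := n) hζ
  have hηc := hasCompactSupport_comp_norm_sq (n := n) hζs
  have hc := hζ.continuous
  have hc' := hζ.continuous_deriv (by simp)
  have hu2 : IntegrableOn (fun x => u x ^ 2) (Metric.ball 0 1) := hu.integrable_sq
  have huv : ∀ j, IntegrableOn (fun x => 2 * u x * v j x) (Metric.ball 0 1) := fun j => by
    have := (hu.integrable_mul (hv j)).const_mul 2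
    simp only [Pi.mul_apply, ← mul_assoc] at this
    exact this
  -- The `j`-th component `ζ(‖x‖²) x_j` of the radial field is tested against the `j`-th partial
  -- derivative of `u²`; summing over `j` gives the divergence theorem for the whole field.
  have hj : ∀ j, ∫ x in Metric.ball (0 : Eu n) 1,
      u x ^ 2 * (ζ (‖x‖ ^ 2) + 2 * deriv ζ (‖x‖ ^ 2) * x j ^ 2) =
      -∫ x in Metric.ball (0 : Eu n) 1, ζ (‖x‖ ^ 2) * (x j * (2 * u x * v j x)) := by
    intro j
    have hcoord : ContDiff ℝ ∞ fun x : Eu n => x j := by fun_prop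
    have hsub : tsupport (fun x : Eu n => ζ (‖x‖ ^ 2) * x j) ⊆
        tsupport fun x : Eu n => ζ (‖x‖ ^ 2) :=
      closure_mono (Function.support_mul_subset_left _ _)
    have h1 := integral_sq_mul_fderiv Metric.isOpen_ball measure_ball_lt_top.ne hu (hv j) (hw j)
      (hη.mul hcoord) hηc.mul_right
      (hsub.trans ((tsupport_comp_norm_sq_subset hζs).trans (closedBall_sqrt_subset hs)))
    have h2 : ∀ x : Eu n, fderiv ℝ (fun x : Eu n => ζ (‖x‖ ^ 2) * x j) x (stdVec j) =
        ζ (‖x‖ ^ 2) + 2 * deriv ζ (‖x‖ ^ 2) * x j ^ 2 := by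
      intro x
      have h3 : HasFDerivAt (fun x : Eu n => x j) (EuclideanSpace.proj j : Eu n →L[ℝ] ℝ) x :=
        (EuclideanSpace.proj j : Eu n →L[ℝ] ℝ).hasFDerivAt
      have h4 : HasFDerivAt (fun x : Eu n => ζ (‖x‖ ^ 2) * x j) _ x :=
        ((hη.differentiable (by simp)) x).hasFDerivAt.mul h3
      rw [h4.fderiv]
      simp only [add_apply, smul_apply, smul_eq_mul, fderiv_comp_norm_sq hζ, inner_stdVec]
      simp [stdVec]
      ring
    simp only [h2] at h1
    rw [h1]
    congr 1
    exact integral_congr_ae (Eventually.of_forall fun x => by ring)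
  have hsum := Finset.sum_congr (rfl : (Finset.univ : Finset (Fin n)) = Finset.univ)
    fun j _ => hj j
  have i1 := integrableOn_comp_norm_sq_mul hc hu2
  have i2 := integrableOn_comp_norm_sq_mul hc' (integrableOn_norm_sq_mul hu2)
  have i3 : ∀ j, IntegrableOn (fun x => ζ (‖x‖ ^ 2) * (x j * (2 * u x * v j x)))
      (Metric.ball 0 1) := fun j =>
    integrableOn_comp_norm_sq_mul hc (integrableOn_coord_mul (huv j) j)
  have i4 : ∀ j, IntegrableOn (fun x => u x ^ 2 *
      (ζ (‖x‖ ^ 2) + 2 * deriv ζ (‖x‖ ^ 2) * x j ^ 2)) (Metric.ball 0 1) := by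
    intro j
    have h5 := integrableOn_comp_norm_sq_mul hc'
      (integrableOn_coord_mul (integrableOn_coord_mul hu2 j) j)
    refine (i1.add (h5.const_mul 2)).congr (Eventually.of_forall fun x => ?_)
    simp only [Pi.add_apply]
    ring
  rw [← integral_finsetSum _ fun j _ => i4 j, Finset.sum_neg_distrib,
    ← integral_finsetSum _ fun j _ => i3 j] at hsum
  have e1 : ∫ x in Metric.ball (0 : Eu n) 1, ∑ j, u x ^ 2 *
      (ζ (‖x‖ ^ 2) + 2 * deriv ζ (‖x‖ ^ 2) * x j ^ 2) =
      n * (∫ x in Metric.ball (0 : Eu n) 1, ζ (‖x‖ ^ 2) * u x ^ 2) +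
      2 * ∫ x in Metric.ball (0 : Eu n) 1, deriv ζ (‖x‖ ^ 2) * (‖x‖ ^ 2 * u x ^ 2) := by
    rw [← integral_const_mul, ← integral_const_mul, ← integral_add (i1.const_mul _)
      (i2.const_mul 2)]
    refine integral_congr_ae (Eventually.of_forall fun x => ?_)
    dsimp only
    rw [← Finset.mul_sum, Finset.sum_add_distrib, ← Finset.mul_sum, ← norm_sq_eq_sum_sq]
    simp
    ring
  have e2 : ∫ x in Metric.ball (0 : Eu n) 1, deriv ζ (‖x‖ ^ 2) * (2 * (‖x‖ ^ 2 * u x ^ 2)) =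
      2 * ∫ x in Metric.ball (0 : Eu n) 1, deriv ζ (‖x‖ ^ 2) * (‖x‖ ^ 2 * u x ^ 2) := by
    rw [← integral_const_mul]
    exact integral_congr_ae (Eventually.of_forall fun x => by ring)
  have e3 : ∫ x in Metric.ball (0 : Eu n) 1,
      ζ (‖x‖ ^ 2) * ((∑ j, x j * (2 * u x * v j x)) + n * u x ^ 2) =
      (∫ x in Metric.ball (0 : Eu n) 1, ∑ j, ζ (‖x‖ ^ 2) * (x j * (2 * u x * v j x))) +
      n * ∫ x in Metric.ball (0 : Eu n) 1, ζ (‖x‖ ^ 2) * u x ^ 2 := by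
    rw [← integral_const_mul, ← integral_add (integrable_finsetSum _ fun j _ => i3 j)
      (i1.const_mul _)]
    refine integral_congr_ae (Eventually.of_forall fun x => ?_)
    dsimp only
    rw [← Finset.mul_sum]
    ring
  rw [e2, e3]
  rw [e1] at hsum
  linarith

end Variations

/-! ### Monotonicity of the frequency and strong unique continuation. -/

section UniqueContinuation

variable {n m Q : ℕ}

theorem eq_replicate_of_modulus_sq_eq_zero {S : AQ Q m} (h : modulus S ^ 2 = 0) :
    S = Sym.replicate Q 0 :=
  eq_of_dG_eq_zero (pow_eq_zero_iff two_ne_zero |>.1 h)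

theorem radialIntegral_sq_eq_ball (h : Eu n → ℝ) {r : ℝ} (hr : 0 < r) :
    radialIntegral h (r ^ 2) = ∫ x in Metric.ball 0 r, h x := by
  have : {x : Eu n | ‖x‖ ^ 2 < r ^ 2} = Metric.ball 0 r := by
    ext x
    rw [mem_ball_zero_iff]
    exact sq_lt_sq₀ (norm_nonneg x) hr.le
  rw [radialIntegral, this]

/-- The three radial identities, for the outer variation, the inner variation and `|f|²`, supply the
differential relations of `eq_zero_of_frequency` with `d = n`. -/
theorem DirStationary.radialIntegral_modulus_eq_zero [Nontrivial (Eu n)] {f : Eu n → AQ Q m}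
    (hf : DirStationary (Metric.ball 0 1) f)
    (hvan : ∀ N : ℕ, Tendsto (fun r : ℝ => (1 / r ^ N) *
      ∫ x in Metric.ball (0 : Eu n) r, modulus (f x) ^ 2) (𝓝[>] 0) (𝓝 0)) :
    ∀ s ∈ Ioo (0 : ℝ) 1, radialIntegral (fun x => modulus (f x) ^ 2) s = 0 := by
  obtain ⟨hE, hu, v, hv, hw, hae⟩ := hf.1.integrableOn_energyForm_and_gradient
  set g : Eu n → ℝ := fun x => ∑ j, x j * (2 * modulus (f x) * v j x) with hg
  have hu2 : IntegrableOn (fun x => modulus (f x) ^ 2) (Metric.ball 0 1) := hu.integrable_sq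
  have hEi : IntegrableOn (energyDensity f) (Metric.ball 0 1) :=
    integrable_finsetSum _ fun j _ => hE j j
  have hRi : IntegrableOn (radialEnergy f) (Metric.ball 0 1) :=
    integrable_finsetSum _ fun j _ => integrable_finsetSum _ fun k _ =>
      integrableOn_coord_mul (integrableOn_coord_mul (hE j k) k) j
  have hgi : IntegrableOn g (Metric.ball 0 1) := by
    refine integrable_finsetSum _ fun j _ => integrableOn_coord_mul ?_ j
    have := (hu.integrable_mul (hv j)).const_mul 2
    simp only [Pi.mul_apply, ← mul_assoc] at this
    exact this
  have hgae : ∀ᵐ x ∂volume.restrict (Metric.ball (0 : Eu n) 1),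
      g x = 2 * ∑ i, inner ℝ (sheet f i x) (sheetDeriv f i x x) := by
    filter_upwards [hae] with x hx
    have h1 : ∀ i, inner ℝ (sheet f i x) (sheetDeriv f i x x) =
        ∑ j, x j * inner ℝ (sheet f i x) (sheetDeriv f i x (stdVec j)) := by
      intro i
      rw [clm_apply_eq_sum (sheetDeriv f i x) x, inner_sum]
      simp only [real_inner_smul_right]
    simp only [h1]
    rw [Finset.sum_comm, Finset.mul_sum]
    refine Finset.sum_congr rfl fun j _ => ?_
    rw [← Finset.mul_sum, hx.2 j]
    ring
  have hG : ∀ s ∈ Ioo (0 : ℝ) 1, radialIntegral g s = radialPotential (energyDensity f) s :=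
    fun s hs => radialIntegral_eq_radialPotential hs hgi hEi fun ζ hζ hζs =>
      hf.outer_radial hE hgi hgae hζ hs hζs
  have hI : ∀ s ∈ Ioo (0 : ℝ) 1, radialIntegral (fun x => 4 * radialEnergy f x -
      2 * (‖x‖ ^ 2 * energyDensity f x)) s =
      radialPotential (fun x => (2 - n) * energyDensity f x) s :=
    fun s hs => radialIntegral_eq_radialPotential hs
      ((hRi.const_mul 4).sub ((integrableOn_norm_sq_mul hEi).const_mul 2)) (hEi.const_mul _)
      fun ζ hζ hζs => hf.inner_radial hE hζ hs hζs
  have hS : ∀ s ∈ Ioo (0 : ℝ) 1,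
      radialIntegral (fun x => 2 * (‖x‖ ^ 2 * modulus (f x) ^ 2)) s =
      radialPotential (fun x => g x + n * modulus (f x) ^ 2) s :=
    fun s hs => radialIntegral_eq_radialPotential hs
      ((integrableOn_norm_sq_mul hu2).const_mul 2) (hgi.add (hu2.const_mul _))
      fun ζ hζ hζs => integral_radial_sq hu hv hw hζ hs hζs
  set M : ℝ → ℝ := radialIntegral fun x => modulus (f x) ^ 2 with hM
  set G : ℝ → ℝ := radialIntegral g with hGdef
  set D : ℝ → ℝ := radialIntegral (energyDensity f) with hD
  set R : ℝ → ℝ := radialIntegral (radialEnergy f) with hR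
  have hbdd : ∀ (s : ℝ), s ∈ Ioo (0 : ℝ) 1 → ∀ {h : Eu n → ℝ}, IntegrableOn h (Metric.ball 0 1) →
      IntegrableOn (fun x => max (s - ‖x‖ ^ 2) 0 * h x) (Metric.ball 0 1) := by
    intro s hs h hh
    exact integrableOn_comp_norm_sq_mul (c := fun t => max (s - t) 0) (by fun_prop) hh
  have hGd : ∀ s ∈ Ioo (0 : ℝ) 1, HasDerivAt G (D s) s := by
    intro s hs
    refine (hasDerivAt_radialPotential hs hEi).congr_of_eventuallyEq ?_
    filter_upwards [isOpen_Ioo.mem_nhds hs] with t ht using hG t ht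
  have hDeq : ∀ s ∈ Ioo (0 : ℝ) 1, 2 * s * D s = 4 * R s + n * G s := by
    intro s hs
    have h1 := hI s hs
    have h2 : radialIntegral (fun x => 4 * radialEnergy f x -
        2 * (‖x‖ ^ 2 * energyDensity f x)) s =
        4 * R s - 2 * radialIntegral (fun x => ‖x‖ ^ 2 * energyDensity f x) s := by
      unfold radialIntegral
      rw [integral_sub ((integrableOn_sublevel hs.2.le hRi).const_mul 4)
        ((integrableOn_sublevel hs.2.le (integrableOn_norm_sq_mul hEi)).const_mul 2),
        integral_const_mul, integral_const_mul]
      rfl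
    have h3 : radialPotential (fun x => (2 - n) * energyDensity f x) s = (2 - n) * G s := by
      rw [hG s hs]
      unfold radialPotential
      rw [← integral_const_mul]
      exact integral_congr_ae (Eventually.of_forall fun x => by ring)
    rw [h2, h3, radialIntegral_norm_sq_mul hs.2.le hEi, ← hG s hs] at h1
    linarith
  -- Being an integral over sublevel sets, `M` is not obviously differentiable. This formula
  -- expresses it through potentials, which are, and differentiating it gives `2 s M' = G + n M`.
  have hMeq : ∀ s ∈ Ioo (0 : ℝ) 1, M s = (radialPotential g s +
      (n + 2) * radialPotential (fun x => modulus (f x) ^ 2) s) / (2 * s) := by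
    intro s hs
    have h1 := hS s hs
    have h2 : radialIntegral (fun x => 2 * (‖x‖ ^ 2 * modulus (f x) ^ 2)) s =
        2 * radialIntegral (fun x => ‖x‖ ^ 2 * modulus (f x) ^ 2) s := integral_const_mul _ _
    have h3 : radialPotential (fun x => g x + n * modulus (f x) ^ 2) s =
        radialPotential g s + n * radialPotential (fun x => modulus (f x) ^ 2) s := by
      unfold radialPotential
      rw [← integral_const_mul, ← integral_add (hbdd s hs hgi) ((hbdd s hs hu2).const_mul _)]
      exact integral_congr_ae (Eventually.of_forall fun x => by ring)
    rw [h2, h3, radialIntegral_norm_sq_mul hs.2.le hu2] at h1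
    rw [eq_div_iff (by have := hs.1; positivity)]
    linarith
  have hMd : ∀ s ∈ Ioo (0 : ℝ) 1, HasDerivAt M ((G s + n * M s) / (2 * s)) s := by
    intro s hs
    have h0 : 0 < s := hs.1
    have h1 : HasDerivAt (fun s => (radialPotential g s +
        (n + 2) * radialPotential (fun x => modulus (f x) ^ 2) s) / (2 * s)) _ s :=
      ((hasDerivAt_radialPotential hs hgi).add
        ((hasDerivAt_radialPotential hs hu2).const_mul (n + 2 : ℝ))).div
        ((hasDerivAt_id s).const_mul 2) (by simp; exact h0.ne')
    have h2 : HasDerivAt M _ s := h1.congr_of_eventuallyEq (by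
      filter_upwards [isOpen_Ioo.mem_nhds hs] with t ht using hMeq t ht)
    refine h2.congr_deriv ?_
    have h3 := hMeq s hs
    rw [eq_div_iff (by positivity)] at h3
    simp only [Pi.add_apply, mul_one]
    rw [← h3]
    change ((G s + (n + 2) * M s) * (2 * s) - M s * (2 * s) * 2) / (2 * s) ^ 2 = _
    field_simp
    ring
  have hCS : ∀ s ∈ Ioo (0 : ℝ) 1, G s ^ 2 ≤ 4 * R s * M s := by
    intro s hs
    -- Cauchy–Schwarz through the discriminant: the polynomial is the integral of `∑ ‖t f_i + Df_i
    -- x‖²`.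
    have hquad : ∀ t : ℝ, 0 ≤ M s * (t * t) + G s * t + R s := by
      intro t
      have i1 := (integrableOn_sublevel hs.2.le hu2).mul_const (t * t)
      have i2 := (integrableOn_sublevel hs.2.le hgi).mul_const t
      have i3 := integrableOn_sublevel hs.2.le hRi
      have h1 : M s * (t * t) + G s * t + R s = ∫ x in {x : Eu n | ‖x‖ ^ 2 < s},
          (modulus (f x) ^ 2 * (t * t) + g x * t + radialEnergy f x) := by
        have i12 : Integrable (fun x => modulus (f x) ^ 2 * (t * t) + g x * t)
            (volume.restrict {x : Eu n | ‖x‖ ^ 2 < s}) := i1.add i2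
        rw [integral_add i12 i3, integral_add i1 i2, integral_mul_const,
          integral_mul_const]
        rfl
      rw [h1]
      refine integral_nonneg_of_ae ?_
      have hres : volume.restrict {x : Eu n | ‖x‖ ^ 2 < s} ≤
          volume.restrict (Metric.ball (0 : Eu n) 1) :=
        Measure.restrict_mono (sublevel_subset_ball hs.2.le) le_rfl
      filter_upwards [ae_mono hres hae, ae_mono hres hgae] with x hx hxg
      have h2 : modulus (f x) ^ 2 * (t * t) + g x * t + radialEnergy f x =
          ∑ i, ‖t • sheet f i x + sheetDeriv f i x x‖ ^ 2 := by
        rw [hx.1, hxg, radialEnergy_eq, Finset.mul_sum, Finset.sum_mul, Finset.sum_mul,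
          ← Finset.sum_add_distrib, ← Finset.sum_add_distrib]
        refine Finset.sum_congr rfl fun i _ => ?_
        rw [norm_add_sq_real, norm_smul, real_inner_smul_left, mul_pow, Real.norm_eq_abs, sq_abs]
        ring
      rw [Pi.zero_apply, h2]
      positivity
    have := discrim_le_zero hquad
    unfold discrim at this
    linarith
  refine eq_zero_of_frequency hMd hGd hDeq hCS
    (fun s => integral_nonneg fun x => sq_nonneg _) fun k ε hε => ?_
  -- The exponent doubles because `s = r²`.
  have h1 := hvan (2 * k)
  have h2 : ∀ᶠ r in 𝓝[>] (0 : ℝ), M (r ^ 2) < ε * (r ^ 2) ^ k := by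
    filter_upwards [h1.eventually_lt_const hε, self_mem_nhdsWithin] with r hr h0
    have h0 : 0 < r := h0
    rw [hM, radialIntegral_sq_eq_ball _ h0, ← pow_mul]
    rwa [one_div, inv_mul_lt_iff₀ (by positivity), mul_comm] at hr
  have h3 : Tendsto (fun r : ℝ => r ^ 2) (𝓝[>] 0) (𝓝[>] 0) := by
    refine tendsto_nhdsWithin_iff.2 ⟨?_, ?_⟩
    · have : Tendsto (fun r : ℝ => r ^ 2) (𝓝 0) (𝓝 (0 ^ 2)) := (continuous_pow 2).tendsto 0
      rw [zero_pow two_ne_zero] at this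
      exact this.mono_left nhdsWithin_le_nhds
    · filter_upwards [self_mem_nhdsWithin] with r hr
      exact pow_pos (show 0 < r from hr) 2
  exact h3.frequently h2.frequently

end UniqueContinuation

end QValued

end

theorem theorem1p2 (n m Q : ℕ) (f : QValued.Eu n → QValued.AQ Q m)
    (hf : QValued.DirStationary (Metric.ball 0 1) f)
    (hvan : ∀ N : ℕ, Tendsto
      (fun r : ℝ => (1 / r ^ N) * ∫ x in Metric.ball (0 : QValued.Eu n) r,
        QValued.modulus (f x) ^ 2) (𝓝[>] 0) (𝓝 0)) :
    ∀ᵐ x ∂volume.restrict (Metric.ball (0 : QValued.Eu n) 1), f x = Sym.replicate Q 0 := by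
  have hu2 : IntegrableOn (fun x => QValued.modulus (f x) ^ 2)
      (Metric.ball (0 : QValued.Eu n) 1) :=
    hf.1.integrableOn_energyForm_and_gradient.2.1.integrable_sq
  suffices h : ∀ᵐ x ∂volume.restrict (Metric.ball (0 : QValued.Eu n) 1),
      QValued.modulus (f x) ^ 2 = 0 by
    filter_upwards [h] with x hx using QValued.eq_replicate_of_modulus_sq_eq_zero hx
  -- The radial argument assumes positive dimension. In dimension zero every ball is the whole
  -- one-point space, and the hypothesis with `N = 0` already says that the integral vanishes.
  rcases Nat.eq_zero_or_pos n with rfl | hn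
  · have hball : ∀ r : ℝ, 0 < r → Metric.ball (0 : QValued.Eu 0) r = univ := fun r hr =>
      eq_univ_of_forall fun x => by rw [Subsingleton.elim x 0]; exact Metric.mem_ball_self hr
    have h1 : ∫ x : QValued.Eu 0, QValued.modulus (f x) ^ 2 = 0 := by
      refine tendsto_nhds_unique (tendsto_const_nhds.congr' ?_) (hvan 0)
      filter_upwards [self_mem_nhdsWithin] with r hr
      rw [hball r hr, setIntegral_univ]
      simp
    rw [hball 1 one_pos, integrableOn_univ] at hu2
    rw [hball 1 one_pos, Measure.restrict_univ]
    exact (integral_eq_zero_iff_of_nonneg (fun x => sq_nonneg _) hu2).1 h1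
  · have : Nonempty (Fin n) := ⟨⟨0, hn⟩⟩
    have : Nontrivial (QValued.Eu n) := inferInstance
    have h0 := hf.radialIntegral_modulus_eq_zero hvan
    -- The shift by `2` keeps `1 - 1 / (k + 2)` strictly between `0` and `1` even for `k = 0`.
    have h1 : ∀ k : ℕ, ∀ᵐ x : QValued.Eu n, ‖x‖ ^ 2 < 1 - 1 / ((k : ℝ) + 2) →
        QValued.modulus (f x) ^ 2 = 0 := by
      intro k
      have hk : 1 / ((k : ℝ) + 2) < 1 := by
        rw [div_lt_one (by positivity)]
        linarith [(Nat.cast_nonneg k : (0 : ℝ) ≤ k)]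
      have hk0 : 0 < 1 / ((k : ℝ) + 2) := by positivity
      have h2 := h0 (1 - 1 / ((k : ℝ) + 2)) ⟨by linarith, by linarith⟩
      have h3 := (integral_eq_zero_iff_of_nonneg (fun x => sq_nonneg _)
        (QValued.integrableOn_sublevel (by linarith) hu2)).1 h2
      exact (ae_restrict_iff' (QValued.measurableSet_sublevel _)).1 h3
    rw [ae_restrict_iff' measurableSet_ball]
    filter_upwards [ae_all_iff.2 h1] with x hx hxb
    rw [mem_ball_zero_iff] at hxb
    have h4 : 0 < 1 - ‖x‖ ^ 2 := by nlinarith [norm_nonneg x]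
    obtain ⟨k, hk⟩ := exists_nat_one_div_lt h4
    refine hx k ?_
    have h5 : 1 / ((k : ℝ) + 2) ≤ 1 / ((k : ℝ) + 1) := by
      apply one_div_le_one_div_of_le <;> [positivity; linarith]
    linarith
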